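/- **Setting.** Let $\mathbb{Q}_{q,t}=\mathbb{Q}(q^{1/4},t^{1/2})$ and let $\mathcal{H}\!\!\mathcal{H}$ be the $\mathbb{Q}_{q,t}$-algebra generated by invertible $T,X,Y$ with relations $TXT=X^{-1}$, $T^{-1}YT^{-1}=Y^{-1}$, $Y^{-1}X^{-1}YXT^2=q^{-1/2}$, $(T-t^{1/2})(T+t^{-1/2})=0$. Its automorphisms $\tau_\pm$ fix $T$ and satisfy $\tau_+:X\mapsto X,\ Y\mapsto q^{-1/4}XY$; $\tau_-:X\mapsto q^{1/4}YX,\ Y\mapsto Y$. Put $\sigma=\tau_+\tau_-^{-1}\tau_+$. *Polynomial representation* $H\mapsto\widehat H$ in $\mathcal{L}=\mathbb{Q}_{q,t}[X^{\pm1}]$, $X=q^x$: $X$ acts by multiplication, $\widehat T=t^{1/2}s+(X^2-1)^{-1}(t^{1/2}-t^{-1/2})(s-1)$, $\widehat Y=sp\widehat T$, where $sf(x)=f(-x)$, $pf(x)=f(x+1/2)$ (so $pX=q^{1/2}X$). With $t=q^k$ put $n_\sharp=\frac{n+k}2$ for $n>0$ and $n_\sharp=\frac{n-k}2$ for $n\le0$;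 thus $q^{n_\sharp}=q^{n/2}t^{\pm1/2}$. *Functional representation* $H\mapsto H'$ in the space $\mathfrak F$ of all functions $\{n_\sharp: n\in\mathbb{Z}\}\to\mathbb{Q}_{q,t}$: $X'f(z)=q^zf(z)$, $T'f(z)=\frac{t^{1/2}q^{2z}-t^{-1/2}}{q^{2z}-1}f(-z)-\frac{t^{1/2}-t^{-1/2}}{q^{2z}-1}f(z)$, $Y'=spT'$ with $spf(z)=f(1/2-z)$. The finitely supported functions form a submodule $\mathcal{F}$. *Polynomials.* $e_n$ $(n\in\mathbb{Z})$ is the Laurent polynomial in the span of the $X^m$, $|m|\le|n|$, with $\widehat Ye_n=q^{-n_\sharp}e_n$, coefficient $1$ at $X^n$ and, for $n>0$, coefficient $0$ at $X^{-n}$; $\epsilon_n=e_n/e_n(-k/2)$. The involution $*$ sends $X,q^{1/4},t^{1/2}$ to their inverses; on functions $f^*(z)=f(z)^*$. *Functionals.* Let $$\mu=\prod_{j\ge0}\frac{(1-q^jX^2)(1-q^{j+1}X^{-2})}{(1-q^jtX^2)(1-q^{j+1}tX^{-2})}$$ be expanded in nonnegative powers of $q$ and $t$ with coefficients in $\mathbb{Z}[X^{\pm1}]$,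 and let $\mu_\circ$ be $\mu$ divided by its constant term in $X$; the coefficients of $\mu_\circ$ at the powers of $X$ are rational functions of $q,t$. Put $\langle f\rangle_\circ=\mathrm{Const\,Term}(f\mu_\circ)$ and $\langle f,g\rangle_\circ=\langle fg^*\rangle_\circ$; $\langle f\rangle_\bullet=\sum_{n\in\mathbb{Z}}f(n_\sharp)\mu_\bullet(n_\sharp)$ and $\langle f,g\rangle_\bullet=\langle fg^*\rangle_\bullet$, where $\mu_\bullet(n_\sharp)=\mu_\bullet((1-n)_\sharp)=t^{-(n-1)}\prod_{j=1}^{n-1}\frac{1-t^2q^j}{1-q^j}$ for $n>0$. Put $F_\circ(f)(n_\sharp)=\langle f\epsilon_n\rangle_\circ$ for $f\in\mathcal{L}$ and $F_\bullet(f)(n_\sharp)=\langle f\epsilon_n^*\rangle_\bullet$ for $f\in\mathcal{F}$. **Theorem.** (i) Over $\mathbb{Q}_{q,t}$ with $q,t$ independent, all $e_n$ exist and are unique, $e_n(-k/2)\ne0$, and $F_\circ$ maps $\mathcal{L}$ to $\mathcal{F}$. For all $H\in\mathcal{H}\!\!\mathcal{H}$ and $f,g\in\mathcal{L}$, $$F_\circ(\widehat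 H(f))=(\sigma(H))'(F_\circ(f)),\qquad \langle f,g\rangle_\circ=\langle F_\circ(f),F_\circ(g)\rangle_\bullet ,$$ and $F_\bullet(H'(f))=(\sigma^{-1}(H))'(F_\bullet(f))$ for all $H\in\mathcal{H}\!\!\mathcal{H}$ and $f\in\mathcal{F}$. (ii) Let $0<q<1$ be a real number and let $k\in\mathbb{C}$ satisfy $q^{2k+j}\ne1$ for $j=1,2,3,\dots$ (for real $k$: $2k\notin\{-1,-2,\dots\}$). Put $t=q^k$, $t^{1/2}=q^{k/2}$, $\gamma(z)=q^{z^2}$, $\tilde\gamma^{-1}=\sum_{n\in\mathbb{Z}}q^{n^2/4}X^n$. Then the $e_n$ for $(q,t)$ and for $(q^{-1},t^{-1})$ exist, are unique, and can be normalized (so that $\epsilon_n$ and $\epsilon_n^*$ are defined), the coefficients of $\mu_\circ$ are regular at $(q,t)$, and for all $m,n\in\mathbb{Z}$ $$\langle\epsilon_m\epsilon_n\tilde\gamma^{-1}\rangle_\circ=q^{\frac{m^2+n^2+2k(|m|+|n|)}4}\,\epsilon_n(m_\sharp)\,\langle\tilde\gamma^{-1}\rangle_\circ,$$ $$\langle\epsilon_m\epsilon_n^*\gamma\rangle_\bullet=q^{-\frac{m^2+n^2+2k(|m|+|n|)}4}\,\epsilon_n(m_\sharp)\,\langle\gamma\rangle_\bullet,$$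 where the series over $\mathbb{Z}$ which define the four pairings (the constant term of the product of the Laurent series $\epsilon_m\epsilon_n\tilde\gamma^{-1}$ and $\mu_\circ$, respectively the sum over the points $j_\sharp$) converge absolutely. -/

import Mathlib

noncomputable section

namespace RankOneDAHA

open scoped LaurentPolynomial
open LaurentPolynomial (T)

/-! ## Laurent polynomials and the difference operators

Throughout, `K` is a field of constants, `u = q^{1/4}` and `v = t^{1/2}`, so that `q = u ^ 4`
and `t = v ^ 2`.  `K[T;T⁻¹]` is the space of Laurent polynomials in `X = q^x`, and `T n` is
the monomial `X ^ n`. -/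

section Operators

variable {K : Type*} [Field K]

/-- The linear operator on Laurent polynomials with prescribed values on the monomials. -/
def ofMonomials (F : ℤ → K[T;T⁻¹]) : K[T;T⁻¹] →ₗ[K] K[T;T⁻¹] :=
  (Finsupp.lsum K fun n => LinearMap.toSpanSingleton K K[T;T⁻¹] (F n)) ∘ₗ
    (AddMonoidAlgebra.coeffLinearEquiv K).toLinearMap

@[simp] theorem ofMonomials_T (F : ℤ → K[T;T⁻¹]) (n : ℤ) : ofMonomials F (T n) = F n := by
  have h : (T n : K[T;T⁻¹]).coeff = Finsupp.single n 1 := rfl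
  simp [ofMonomials, h]

theorem linearMap_ext {A B : K[T;T⁻¹] →ₗ[K] K[T;T⁻¹]} (h : ∀ n, A (T n) = B (T n)) : A = B := by
  refine LinearMap.ext fun f => ?_
  induction f using LaurentPolynomial.induction_on' with
  | add p q hp hq => rw [map_add, map_add, hp, hq]
  | C_mul_T n a => rw [← LaurentPolynomial.smul_eq_C_mul, map_smul, map_smul, h]

/-- The value `f(x)` of a Laurent polynomial at a point where `X` takes the value `x`. -/
def evalAt (x : K) (f : K[T;T⁻¹]) : K := f.coeff.sum fun n a => a * x ^ n

/-- `s f(x) = f(-x)`. -/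
def sOp : K[T;T⁻¹] →ₗ[K] K[T;T⁻¹] := ofMonomials fun n => T (-n)

/-- `p f(x) = f(x + 1/2)`, that is `X ↦ q^{1/2} X`. -/
def pOp (u : K) : K[T;T⁻¹] →ₗ[K] K[T;T⁻¹] := ofMonomials fun n => (u ^ 2) ^ n • T n

/-- Multiplication by `X ^ m`. -/
def xOp (m : ℤ) : K[T;T⁻¹] →ₗ[K] K[T;T⁻¹] := ofMonomials fun n => T (m + n)

/-- The value `(X^2 - 1)^{-1} (X^{-n} - X^n)` of the divided difference on a monomial. -/
def divDiffMonomial : ℤ → K[T;T⁻¹]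
  | Int.ofNat n => - ∑ i ∈ Finset.range n, T (2 * (i : ℤ) - n)
  | Int.negSucc n => ∑ i ∈ Finset.range (n + 1), T (2 * (i : ℤ) - (n + 1))

/-- The divided difference `(X^2 - 1)^{-1} (s - 1)`; see `divDiff_spec`. -/
def divDiff : K[T;T⁻¹] →ₗ[K] K[T;T⁻¹] := ofMonomials divDiffMonomial

/-- `T̂ = t^{1/2} s + (X^2 - 1)^{-1} (t^{1/2} - t^{-1/2}) (s - 1)`. -/
def tOp (v : K) : K[T;T⁻¹] →ₗ[K] K[T;T⁻¹] := v • sOp + (v - v⁻¹) • divDiff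

/-- `Ŷ = s p T̂`. -/
def yOp (u v : K) : K[T;T⁻¹] →ₗ[K] K[T;T⁻¹] := sOp ∘ₗ pOp u ∘ₗ tOp v

private theorem geom_aux (m : ℤ) (n : ℕ) :
    ((T 2 : K[T;T⁻¹]) - 1) * ∑ i ∈ Finset.range n, T (2 * (i : ℤ) + m)
      = T (2 * (n : ℤ) + m) - T m := by
  induction n with
  | zero => simp
  | succ n ih =>
    rw [Finset.sum_range_succ, mul_add, ih, sub_mul, one_mul, ← LaurentPolynomial.T_add]
    have : 2 + (2 * (n : ℤ) + m) = 2 * ((n + 1 : ℕ) : ℤ) + m := by push_cast; ring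
    rw [this]; ring

/-- `(X^2 - 1) D f = s f - f`. -/
theorem divDiff_spec (f : K[T;T⁻¹]) : (T 2 - 1) * divDiff f = sOp f - f := by
  induction f using LaurentPolynomial.induction_on' with
  | add p q hp hq => rw [map_add, map_add, mul_add, hp, hq]; ring
  | C_mul_T n a =>
    rw [← LaurentPolynomial.smul_eq_C_mul, map_smul, map_smul, mul_smul_comm, ← smul_sub]
    congr 1
    rw [divDiff, sOp, ofMonomials_T, ofMonomials_T]
    cases n with
    | ofNat n =>
      have h := geom_aux (K := K) (-(n : ℤ)) n
      simp only [divDiffMonomial, sub_eq_add_neg (2 * _) (n : ℤ), mul_neg]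
      rw [h]
      have : 2 * (n : ℤ) + -(n : ℤ) = n := by ring
      rw [this]; simp
    | negSucc n =>
      have h := geom_aux (K := K) (-((n : ℤ) + 1)) (n + 1)
      simp only [divDiffMonomial, sub_eq_add_neg (2 * _) ((n : ℤ) + 1)]
      rw [h]
      have h1 : 2 * ((n + 1 : ℕ) : ℤ) + -((n : ℤ) + 1) = -(Int.negSucc n) := by
        rw [Int.neg_negSucc]; push_cast; ring
      have h2 : -((n : ℤ) + 1) = Int.negSucc n := by
        rw [Int.negSucc_eq]
      rw [h1, h2]

private theorem T_two_sub_one_ne : (T 2 - 1 : K[T;T⁻¹]) ≠ 0 := by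
  intro h
  have h1 := congrArg (fun f : K[T;T⁻¹] => f.coeff 2) h
  rw [← LaurentPolynomial.T_zero] at h1
  simp [LaurentPolynomial.T_apply, -LaurentPolynomial.T_zero] at h1

theorem sOp_mul (f g : K[T;T⁻¹]) : sOp (f * g) = sOp f * sOp g := by
  have h : (sOp : K[T;T⁻¹] →ₗ[K] K[T;T⁻¹]) = LaurentPolynomial.invert.toLinearMap :=
    linearMap_ext fun n => by simp [sOp]
  rw [h]; simp

@[simp] theorem sOp_T (n : ℤ) : sOp (T n : K[T;T⁻¹]) = T (-n) := by simp [sOp]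

theorem sOp_sOp (f : K[T;T⁻¹]) : sOp (sOp f) = f :=
  congrArg (fun A : K[T;T⁻¹] →ₗ[K] K[T;T⁻¹] => A f)
    (linearMap_ext (A := sOp ∘ₗ sOp) (B := LinearMap.id) fun n => by simp)

theorem xOp_apply (m : ℤ) (f : K[T;T⁻¹]) : xOp m f = T m * f :=
  congrArg (fun A : K[T;T⁻¹] →ₗ[K] K[T;T⁻¹] => A f)
    (linearMap_ext (A := xOp m) (B := LinearMap.mulLeft K (T m)) fun n => by
      simp only [xOp, ofMonomials_T, LinearMap.mulLeft_apply, LaurentPolynomial.T_add])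

private theorem cancel {f g : K[T;T⁻¹]} (h : (T 2 - 1) * f = (T 2 - 1) * g) : f = g :=
  mul_left_cancel₀ T_two_sub_one_ne h

private theorem T_mul_T (m n : ℤ) : (T m * T n : K[T;T⁻¹]) = T (m + n) :=
  (LaurentPolynomial.T_add m n).symm

private theorem s_divDiff (f : K[T;T⁻¹]) : sOp (divDiff f) = T 2 * divDiff f := by
  apply cancel
  have h := congrArg sOp (divDiff_spec f)
  rw [sOp_mul, map_sub, map_sub, sOp_T, sOp_sOp, ← LaurentPolynomial.T_zero, sOp_T] at h
  have h2 := divDiff_spec f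
  have e : (T 2 : K[T;T⁻¹]) * T (-2) = 1 := by rw [T_mul_T]; simp
  simp only [neg_zero, LaurentPolynomial.T_zero] at h
  linear_combination (-(T 2 : K[T;T⁻¹])) * h - T 2 * h2 + sOp (divDiff f) * e

private theorem divDiff_s (f : K[T;T⁻¹]) : divDiff (sOp f) = - divDiff f := by
  apply cancel
  have h := divDiff_spec f
  have h2 := divDiff_spec (sOp f)
  rw [sOp_sOp] at h2
  linear_combination h + h2

private theorem divDiff_divDiff (f : K[T;T⁻¹]) : divDiff (divDiff f) = divDiff f := by
  apply cancel
  have h := divDiff_spec (divDiff f)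
  rw [s_divDiff] at h
  linear_combination h

private theorem divDiff_X (f : K[T;T⁻¹]) :
    divDiff (T 1 * f) = T (-1) * divDiff f - T (-1) * f := by
  apply cancel
  have h := divDiff_spec f
  have h2 := divDiff_spec (T 1 * f)
  rw [sOp_mul, sOp_T] at h2
  have e : (T 2 : K[T;T⁻¹]) * T (-1) = T 1 := by rw [T_mul_T]; norm_num
  linear_combination h2 - T (-1) * h + f * e

theorem tOp_apply (v : K) (f : K[T;T⁻¹]) :
    tOp v f = v • sOp f + (v - v⁻¹) • divDiff f := rfl

/-- The quadratic relation for `T̂`. -/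
theorem tOp_tOp {v : K} (hv : v ≠ 0) (f : K[T;T⁻¹]) :
    tOp v (tOp v f) = (v - v⁻¹) • tOp v f + f := by
  simp only [tOp_apply, map_add, map_smul, sOp_sOp, s_divDiff, divDiff_s, divDiff_divDiff]
  have h : (T 2 : K[T;T⁻¹]) * divDiff f = divDiff f + sOp f - f := by
    linear_combination divDiff_spec f
  rw [h]
  have e : v * v⁻¹ = 1 := mul_inv_cancel₀ hv
  have e' : v * v - v * (v - v⁻¹) = 1 := by linear_combination e
  match_scalars
  · linear_combination e
  · ring
  · ring

/-- `T̂ X T̂ = X^{-1}`. -/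
theorem tOp_X_tOp {v : K} (hv : v ≠ 0) (f : K[T;T⁻¹]) :
    tOp v (xOp 1 (tOp v f)) = xOp (-1) f := by
  have key : ∀ g : K[T;T⁻¹], tOp v (T 1 * g) = T (-1) * (tOp v g - (v - v⁻¹) • g) := by
    intro g
    rw [tOp_apply, tOp_apply, sOp_mul, sOp_T, divDiff_X]
    simp only [LaurentPolynomial.smul_eq_C_mul]
    ring
  rw [xOp_apply, xOp_apply, key, tOp_tOp hv]
  simp

/-- `(s p)^2 = 1`. -/
theorem sp_sp {u : K} (hu : u ≠ 0) (f : K[T;T⁻¹]) :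
    sOp (pOp u (sOp (pOp u f))) = f :=
  congrArg (fun A : K[T;T⁻¹] →ₗ[K] K[T;T⁻¹] => A f)
    (linearMap_ext (A := sOp ∘ₗ pOp u ∘ₗ sOp ∘ₗ pOp u) (B := LinearMap.id) fun n => by
      simp only [LinearMap.comp_apply, pOp, ofMonomials_T, map_smul, sOp_T, smul_smul,
        LinearMap.id_apply, neg_neg]
      rw [← zpow_add₀ (pow_ne_zero 2 hu)]; simp)

/-- `(s p) X (s p) = q^{1/2} X^{-1}`. -/
theorem sp_X_sp {u : K} (hu : u ≠ 0) (f : K[T;T⁻¹]) :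
    sOp (pOp u (xOp 1 (sOp (pOp u f)))) = u ^ 2 • xOp (-1) f :=
  congrArg (fun A : K[T;T⁻¹] →ₗ[K] K[T;T⁻¹] => A f)
    (linearMap_ext (A := sOp ∘ₗ pOp u ∘ₗ xOp 1 ∘ₗ sOp ∘ₗ pOp u) (B := u ^ 2 • xOp (-1))
    fun n => by
      simp only [LinearMap.comp_apply, LinearMap.smul_apply, xOp, pOp, ofMonomials_T, map_smul,
        sOp_T, smul_smul]
      rw [← zpow_add₀ (pow_ne_zero 2 hu)]
      have h1 : n + (1 + -n) = 1 := by ring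
      have h2 : -(1 + -n) = -1 + n := by ring
      rw [h1, h2]; simp)

/-! ## The points `n_♯` and the polynomials `e_n`, `ε_n` -/

/-- `X(n_♯) = q^{n_♯}` for `n_♯ = (n + sgn(n - 1/2) k)/2` and `t = q^k`: this is
`q^{n/2} t^{1/2}` if `n > 0` and `q^{n/2} t^{-1/2}` if `n ≤ 0`. -/
def qSharp (u v : K) (n : ℤ) : K := u ^ (2 * n) * if 0 < n then v else v⁻¹

/-- `e` is the nonsymmetric Macdonald polynomial `e_n`: a combination of the `X^m`, `|m| ≤ |n|`,
with `Ŷ e = q^{-n_♯} e`, with leading coefficient `1` at `X^n`, and (for `n > 0`) without the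
monomial `X^{-n}`. -/
structure IsMacdonald (u v : K) (n : ℤ) (e : K[T;T⁻¹]) : Prop where
  eigen : yOp u v e = (qSharp u v n)⁻¹ • e
  support : ∀ m : ℤ, |n| < |m| → e.coeff m = 0
  leading : e.coeff n = 1
  no_opposite : 0 < n → e.coeff (-n) = 0

open Classical in
/-- The nonsymmetric Macdonald polynomial `e_n` (`0` if there is none). -/
def ePoly (u v : K) (n : ℤ) : K[T;T⁻¹] :=
  if h : ∃ e, IsMacdonald u v n e then h.choose else 0

/-- The spherical polynomial `ε_n = e_n / e_n(-k/2)`; note `X(-k/2) = t^{-1/2}`. -/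
def epsPoly (u v : K) (n : ℤ) : K[T;T⁻¹] := (evalAt v⁻¹ (ePoly u v n))⁻¹ • ePoly u v n

/-- All `e_n` exist, are unique, and can be normalized at `-k/2`. -/
def SphericalDefined (u v : K) : Prop :=
  ∀ n : ℤ, (∃! e, IsMacdonald u v n e) ∧ evalAt v⁻¹ (ePoly u v n) ≠ 0

/-- `μ_•(n_♯) = μ_•((1-n)_♯) = q^{-k(n-1)} ∏_{j=1}^{n-1} (1 - q^{2k+j})/(1 - q^j)`, `n > 0`. -/
def muBullet (u v : K) (n : ℤ) : K :=
  let N : ℕ := if 0 < n then (n - 1).toNat else (-n).toNat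
  ((v ^ 2) ^ N)⁻¹ * ∏ j ∈ Finset.Icc 1 N, (1 - (v ^ 2) ^ 2 * (u ^ 4) ^ j) / (1 - (u ^ 4) ^ j)

end Operators

/-! ## The Laurent series `μ` and the constant term functional

`μ = ∏_{j ≥ 0} (1 - q^j X^2)(1 - q^{j+1} X^{-2}) / ((1 - q^j t X^2)(1 - q^{j+1} t X^{-2}))`
is expanded as a formal power series in the variables `q` (number `0`) and `t` (number `1`),
whose coefficients are Laurent polynomials in `X`. -/

section Mu

/-- The variable `q`. -/
def qVar : MvPowerSeries (Fin 2) ℤ[T;T⁻¹] := MvPowerSeries.X 0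

/-- The variable `t`. -/
def tVar : MvPowerSeries (Fin 2) ℤ[T;T⁻¹] := MvPowerSeries.X 1

/-- The power `X^m`. -/
def xVar (m : ℤ) : MvPowerSeries (Fin 2) ℤ[T;T⁻¹] := MvPowerSeries.C (T m)

/-- The `j`-th factor of the infinite product `μ`. -/
def muFactor (j : ℕ) : MvPowerSeries (Fin 2) ℤ[T;T⁻¹] :=
  (1 - qVar ^ j * xVar 2) * (1 - qVar ^ (j + 1) * xVar (-2)) *
    MvPowerSeries.invOfUnit (1 - qVar ^ j * tVar * xVar 2) 1 *
    MvPowerSeries.invOfUnit (1 - qVar ^ (j + 1) * tVar * xVar (-2)) 1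

/-- The infinite product `μ`.  As the `j`-th factor is `1` modulo `q^j`, the coefficient at
`q^a t^b` is that of the product of the factors with `j ≤ a`; see `coeff_prod_muFactor`. -/
def muSeries : MvPowerSeries (Fin 2) ℤ[T;T⁻¹] := fun n =>
  MvPowerSeries.coeff n (∏ j ∈ Finset.range (n 0 + 1), muFactor j)

theorem muFactor_eq (j : ℕ) : ∃ g, muFactor j = 1 + qVar ^ j * g := by
  have h : ∀ a : MvPowerSeries (Fin 2) ℤ[T;T⁻¹], ∀ w, a = qVar ^ j * w →
      MvPowerSeries.constantCoeff a = 0 →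
      ∃ g, MvPowerSeries.invOfUnit (1 - a) 1 = 1 + qVar ^ j * g := by
    intro a w hw ha
    have hm := MvPowerSeries.mul_invOfUnit (1 - a) 1 (by simp [ha])
    refine ⟨w * MvPowerSeries.invOfUnit (1 - a) 1, ?_⟩
    linear_combination hm + MvPowerSeries.invOfUnit (1 - a) 1 * hw
  obtain ⟨g₁, h₁⟩ := h (qVar ^ j * tVar * xVar 2) (tVar * xVar 2) (by ring)
    (by simp [tVar, MvPowerSeries.constantCoeff_X])
  obtain ⟨g₂, h₂⟩ := h (qVar ^ (j + 1) * tVar * xVar (-2)) (qVar * tVar * xVar (-2)) (by ring)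
    (by simp [tVar, MvPowerSeries.constantCoeff_X])
  rw [muFactor, h₁, h₂]
  set Q := (qVar : MvPowerSeries (Fin 2) ℤ[T;T⁻¹]) ^ j with hQ
  have e : (qVar : MvPowerSeries (Fin 2) ℤ[T;T⁻¹]) ^ (j + 1) = Q * qVar := pow_succ _ _
  rw [e]
  set A := (xVar 2)
  set B := qVar * xVar (-2)
  have : Q * qVar * xVar (-2) = Q * B := by ring
  rw [this]
  refine ⟨-A - B + Q * A * B + (1 - Q * A) * (1 - Q * B) * (g₁ + g₂ + Q * g₁ * g₂), ?_⟩
  ring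

/-- The partial products of `μ` stabilize coefficientwise to `muSeries`. -/
theorem coeff_prod_muFactor (n : Fin 2 →₀ ℕ) (M : ℕ) (hM : n 0 < M) :
    MvPowerSeries.coeff n (∏ j ∈ Finset.range M, muFactor j) = MvPowerSeries.coeff n muSeries := by
  induction M, hM using Nat.le_induction with
  | base => rfl
  | succ M hM ih =>
    rw [Finset.prod_range_succ, ← ih]
    obtain ⟨g, hg⟩ := muFactor_eq M
    rw [hg, mul_add, mul_one, map_add]
    have : MvPowerSeries.coeff n ((∏ j ∈ Finset.range M, muFactor j) * (qVar ^ M * g)) = 0 := by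
      have e : (∏ j ∈ Finset.range M, muFactor j) * (qVar ^ M * g)
          = MvPowerSeries.monomial (Finsupp.single 0 M) 1
            * ((∏ j ∈ Finset.range M, muFactor j) * g) := by
        rw [← MvPowerSeries.X_pow_eq, qVar]; ring
      rw [e, MvPowerSeries.coeff_monomial_mul, if_neg]
      intro h
      have := h 0
      simp at this
      omega
    rw [this, add_zero]

/-- The coefficient of `X^m` in `μ`, a power series in `q`, `t`. -/
def muCoeff (m : ℤ) : MvPowerSeries (Fin 2) ℤ := fun n => (MvPowerSeries.coeff n muSeries).coeff m

variable {K : Type*} [Field K]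

/-- `r` is the value at `(q, t)` of the coefficient of `X^m` in `μ_∘ = μ / ⟨μ⟩`, considered as
a rational function `a / b` of `q` and `t` which is regular at that point. -/
def IsMuCircCoeff (q t : K) (m : ℤ) (r : K) : Prop :=
  ∃ a b : MvPolynomial (Fin 2) ℤ,
    (b : MvPowerSeries (Fin 2) ℤ) * muCoeff m = (a : MvPowerSeries (Fin 2) ℤ) * muCoeff 0 ∧
    MvPolynomial.aeval ![q, t] b ≠ 0 ∧
    r = MvPolynomial.aeval ![q, t] a / MvPolynomial.aeval ![q, t] b

open Classical in
/-- The value at `(q, t)` of the coefficient of `X^m` in `μ_∘` (`0` at a pole). -/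
def muCirc (q t : K) (m : ℤ) : K :=
  if h : ∃ r, IsMuCircCoeff q t m r then h.choose else 0

/-- `⟨f⟩_∘ = Const Term (f μ_∘)` for a Laurent polynomial `f`. -/
def constTerm (u v : K) (f : K[T;T⁻¹]) : K :=
  f.coeff.sum fun m a => a * muCirc (u ^ 4) (v ^ 2) (-m)

end Mu

/-! ## The field `ℚ(q^{1/4}, t^{1/2})` and its involution `*` -/

section Constants

/-- The field `ℚ(q^{1/4}, t^{1/2})`, as the field of fractions of `ℚ[q^{±1/4}, t^{±1/2}]`. -/
abbrev Kqt : Type := FractionRing (AddMonoidAlgebra ℚ (ℤ × ℤ))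

/-- The monomial `q^{a/4} t^{b/2}`. -/
def mon (a b : ℤ) : Kqt :=
  algebraMap (AddMonoidAlgebra ℚ (ℤ × ℤ)) Kqt (AddMonoidAlgebra.single (a, b) 1)

/-- `q^{1/4}`. -/
def u₀ : Kqt := mon 1 0

/-- `t^{1/2}`. -/
def v₀ : Kqt := mon 0 1

theorem mon_mul (a b c d : ℤ) : mon a b * mon c d = mon (a + c) (b + d) := by
  rw [mon, mon, mon, ← map_mul, AddMonoidAlgebra.single_mul_single]; simp

theorem mon_zero : mon 0 0 = 1 := map_one _

theorem mon_injective {a b c d : ℤ} (h : mon a b = mon c d) : a = c ∧ b = d := by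
  have := IsFractionRing.injective (AddMonoidAlgebra ℚ (ℤ × ℤ)) Kqt h
  have h2 := congrArg (fun f : AddMonoidAlgebra ℚ (ℤ × ℤ) => f.coeff (a, b)) this
  simp [Finsupp.single_apply] at h2
  simpa [eq_comm] using h2

theorem mon_ne_zero (a b : ℤ) : mon a b ≠ 0 := by
  intro h
  have := mon_mul a b (-a) (-b)
  rw [h, zero_mul, add_neg_cancel, add_neg_cancel, mon_zero] at this
  exact zero_ne_one this

theorem u₀_ne : u₀ ≠ 0 := mon_ne_zero _ _

theorem v₀_ne : v₀ ≠ 0 := mon_ne_zero _ _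

theorem mon_inv (a b : ℤ) : (mon a b)⁻¹ = mon (-a) (-b) := by
  apply inv_eq_of_mul_eq_one_right
  rw [mon_mul]
  simp [mon_zero]

/-- The involution `*` of the field of constants: `q ↦ q^{-1}`, `t ↦ t^{-1}`. -/
def starK : Kqt ≃+* Kqt :=
  IsFractionRing.ringEquivOfRingEquiv
    (AddMonoidAlgebra.domCongr ℚ ℚ (AddEquiv.neg (ℤ × ℤ))).toRingEquiv

theorem starK_mon (a b : ℤ) : starK (mon a b) = mon (-a) (-b) := by
  rw [starK, mon, IsFractionRing.ringEquivOfRingEquiv_algebraMap]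
  simp [mon]

theorem starK_u₀ : starK u₀ = u₀⁻¹ := by rw [u₀, starK_mon, mon_inv]

theorem starK_v₀ : starK v₀ = v₀⁻¹ := by rw [v₀, starK_mon, mon_inv]

/-- The involution `*` of Laurent polynomials: `X ↦ X^{-1}`, `q ↦ q^{-1}`, `t ↦ t^{-1}`. -/
def starL (f : Kqt[T;T⁻¹]) : Kqt[T;T⁻¹] :=
  LaurentPolynomial.invert (AddMonoidAlgebra.mapRingHom ℤ (starK : Kqt →+* Kqt) f)

end Constants

/-! ## The double affine Hecke algebra -/

section Algebra

/-- The generators `T`, `X`, `Y`. -/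
inductive Gen
  | T | X | Y

/-- The group algebra of the free group on `T`, `X`, `Y`. -/
abbrev FreeAlg : Type := MonoidAlgebra Kqt (FreeGroup Gen)

/-- A word in `T^{±1}`, `X^{±1}`, `Y^{±1}` as an element of the group algebra. -/
def word (w : FreeGroup Gen) : FreeAlg := MonoidAlgebra.of Kqt (FreeGroup Gen) w

/-- The letters of the free group. -/
abbrev gT : FreeGroup Gen := FreeGroup.of Gen.T

/-- See `gT`. -/
abbrev gX : FreeGroup Gen := FreeGroup.of Gen.X

/-- See `gT`. -/
abbrev gY : FreeGroup Gen := FreeGroup.of Gen.Y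

/-- The defining relations `TXT = X^{-1}`, `T^{-1}YT^{-1} = Y^{-1}`,
`Y^{-1}X^{-1}YXT^2 = q^{-1/2}` and `(T - t^{1/2})(T + t^{-1/2}) = 0`. -/
inductive Rel : FreeAlg → FreeAlg → Prop
  | txt : Rel (word (gT * gX * gT)) (word gX⁻¹)
  | tyt : Rel (word (gT⁻¹ * gY * gT⁻¹)) (word gY⁻¹)
  | comm : Rel (word (gY⁻¹ * gX⁻¹ * gY * gX * gT ^ 2)) (algebraMap Kqt FreeAlg (u₀ ^ 2)⁻¹)
  | quad : Rel ((word gT - algebraMap Kqt FreeAlg v₀) * (word gT + algebraMap Kqt FreeAlg v₀⁻¹)) 0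

/-- The double affine Hecke algebra of type `A₁` over `ℚ(q^{1/4}, t^{1/2})`. -/
abbrev HH : Type := RingQuot Rel

variable {A : Type*} [Semiring A] [Algebra Kqt A]

/-- The central unit `q^{1/4}` of a `Kqt`-algebra. -/
def cU (A : Type*) [Semiring A] [Algebra Kqt A] : Aˣ :=
  Units.map (algebraMap Kqt A : Kqt →* A) (Units.mk0 u₀ u₀_ne)

theorem cU_comm (a : Aˣ) : cU A * a = a * cU A :=
  Units.ext (Algebra.commutes u₀ (a : A))

theorem cU_val : ((cU A : Aˣ) : A) = algebraMap Kqt A u₀ := rfl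

/-- Three invertible elements satisfying the defining relations, with the quadratic relation
multiplied out. -/
structure IsTriple (t x y : Aˣ) : Prop where
  txt : t * x * t = x⁻¹
  tyt : t⁻¹ * y * t⁻¹ = y⁻¹
  comm : y⁻¹ * x⁻¹ * y * x * t ^ 2 = (cU A ^ 2)⁻¹
  quad : (t : A) * t = (v₀ - v₀⁻¹) • (t : A) + 1

/-- The images of the generators. -/
def genMap (t x y : Aˣ) : Gen → Aˣ
  | .T => t
  | .X => x
  | .Y => y

/-- The homomorphism from the group algebra of the free group. -/
def freeLift (t x y : Aˣ) : FreeAlg →ₐ[Kqt] A :=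
  MonoidAlgebra.lift Kqt A (FreeGroup Gen) ((Units.coeHom A).comp (FreeGroup.lift (genMap t x y)))

theorem freeLift_word (t x y : Aˣ) (w : FreeGroup Gen) :
    freeLift t x y (word w) = (FreeGroup.lift (genMap t x y) w : Aˣ) := by
  simp [freeLift, word]

theorem quad_expand {B : Type*} [Ring B] [Algebra Kqt B] (w : B) :
    (w - algebraMap Kqt B v₀) * (w + algebraMap Kqt B v₀⁻¹) + ((v₀ - v₀⁻¹) • w + 1) = w * w := by
  have e : algebraMap Kqt B v₀ * algebraMap Kqt B v₀⁻¹ = 1 := by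
    rw [← map_mul, mul_inv_cancel₀ v₀_ne, map_one]
  rw [sub_mul, mul_add, mul_add, e, ← Algebra.commutes, Algebra.smul_def, map_sub]
  noncomm_ring

theorem freeLift_rel {t x y : Aˣ} (h : IsTriple t x y) ⦃a b : FreeAlg⦄ (r : Rel a b) :
    freeLift t x y a = freeLift t x y b := by
  cases r with
  | txt => rw [freeLift_word, freeLift_word]; simpa [genMap] using congrArg Units.val h.txt
  | tyt => rw [freeLift_word, freeLift_word]; simpa [genMap] using congrArg Units.val h.tyt
  | comm =>
    rw [freeLift_word, AlgHom.commutes]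
    have e : ((cU A ^ 2)⁻¹ : Aˣ) = Units.map (algebraMap Kqt A : Kqt →* A)
        ((Units.mk0 u₀ u₀_ne ^ 2)⁻¹) := by rw [map_inv, map_pow]; rfl
    have h2 := congrArg Units.val h.comm
    rw [e] at h2
    simp only [map_mul, map_inv, map_pow, FreeGroup.lift_apply_of, genMap]
    rw [h2]
    simp [-map_inv₀, -map_pow]
  | quad =>
    have e : (word gT - algebraMap Kqt FreeAlg v₀) * (word gT + algebraMap Kqt FreeAlg v₀⁻¹)
        + ((v₀ - v₀⁻¹) • word gT + 1) = word gT * word gT := quad_expand (word gT)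
    have h1 := congrArg (freeLift t x y) e
    have h2 := h.quad
    rw [map_add, map_add, map_smul, map_mul _ (word gT) (word gT), map_one, freeLift_word] at h1
    simp only [FreeGroup.lift_apply_of, genMap] at h1
    rw [h2] at h1
    rw [map_zero]
    have h3 := congrArg (fun z => z + (-1 : Kqt) • ((v₀ - v₀⁻¹) • (t : A) + 1)) h1
    have h4 : ∀ z : A, z + (-1 : Kqt) • z = 0 := fun z => by
      rw [← one_smul Kqt z, smul_smul, ← add_smul]; simp
    simpa only [add_assoc, h4, add_zero] using h3

/-- The homomorphism from the double affine Hecke algebra with given images of `T`, `X`, `Y`. -/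
def HHlift {t x y : Aˣ} (h : IsTriple t x y) : HH →ₐ[Kqt] A :=
  RingQuot.liftAlgHom Kqt ⟨freeLift t x y, freeLift_rel h⟩

/-- Words in the generators as units of the double affine Hecke algebra. -/
def wordU : FreeGroup Gen →* HHˣ :=
  (Units.map ((RingQuot.mkAlgHom Kqt Rel : FreeAlg →* HH).comp
    (MonoidAlgebra.of Kqt (FreeGroup Gen)))).comp (toUnits (G := FreeGroup Gen)).toMonoidHom

/-- The generator `T`. -/
def tH : HHˣ := wordU gT

/-- The generator `X`. -/
def xH : HHˣ := wordU gX

/-- The generator `Y`. -/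
def yH : HHˣ := wordU gY

theorem wordU_val (w : FreeGroup Gen) : (wordU w : HH) = RingQuot.mkAlgHom Kqt Rel (word w) := rfl

theorem isTriple_gen : IsTriple tH xH yH where
  txt := by
    rw [tH, xH, ← map_mul, ← map_mul, ← map_inv]
    exact Units.ext (RingQuot.mkAlgHom_rel Kqt Rel.txt)
  tyt := by
    rw [tH, yH, ← map_inv, ← map_mul, ← map_mul, ← map_inv]
    exact Units.ext (RingQuot.mkAlgHom_rel Kqt Rel.tyt)
  comm := by
    have e : ((cU HH ^ 2)⁻¹ : HHˣ) = Units.map (algebraMap Kqt HH : Kqt →* HH)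
        ((Units.mk0 u₀ u₀_ne ^ 2)⁻¹) := by rw [map_inv, map_pow]; rfl
    rw [tH, xH, yH, ← map_inv, ← map_inv, ← map_pow, ← map_mul, ← map_mul, ← map_mul, ← map_mul, e]
    refine Units.ext ((RingQuot.mkAlgHom_rel Kqt Rel.comm).trans ?_)
    rw [AlgHom.commutes]
    simp [-map_inv₀, -map_pow]
  quad := by
    have h := RingQuot.mkAlgHom_rel Kqt Rel.quad
    have e := congrArg (RingQuot.mkAlgHom Kqt Rel) (quad_expand (word gT))
    rw [map_add, h, map_zero, zero_add, map_mul, map_add, map_smul, map_one] at e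
    exact e.symm

theorem HHlift_word {t x y : Aˣ} (h : IsTriple t x y) (w : FreeGroup Gen) :
    HHlift h (wordU w) = (FreeGroup.lift (genMap t x y) w : Aˣ) := by
  rw [wordU_val, HHlift, RingQuot.liftAlgHom_mkAlgHom_apply, freeLift_word]

@[simp] theorem HHlift_t {t x y : Aˣ} (h : IsTriple t x y) : HHlift h tH = t := by
  simp [tH, HHlift_word, genMap]

@[simp] theorem HHlift_x {t x y : Aˣ} (h : IsTriple t x y) : HHlift h xH = x := by
  simp [xH, HHlift_word, genMap]

@[simp] theorem HHlift_y {t x y : Aˣ} (h : IsTriple t x y) : HHlift h yH = y := by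
  simp [yH, HHlift_word, genMap]

theorem HH_hom_ext {f g : HH →ₐ[Kqt] A} (hT : f tH = g tH) (hX : f xH = g xH)
    (hY : f yH = g yH) : f = g := by
  apply RingQuot.ringQuot_ext'
  refine MonoidAlgebra.algHom_ext (fun w => ?_) (Subsingleton.elim _ _)
  have key : (Units.map (f : HH →* A)).comp wordU = (Units.map (g : HH →* A)).comp wordU := by
    apply FreeGroup.ext_hom
    intro a
    apply Units.ext
    cases a
    · exact hT
    · exact hX
    · exact hY
  exact congrArg Units.val (DFunLike.congr_fun key w)

/-- A triple `T`, `X`, `Y = π T` from `T`, `X` and an involution `π` with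
`π X π = q^{1/2} X^{-1}`. -/
theorem isTriple_of_pi {t x π : Aˣ} (txt : t * x * t = x⁻¹) (hπ : π * π = 1)
    (hx : π * x * π = cU A ^ 2 * x⁻¹)
    (quad : (t : A) * t = (v₀ - v₀⁻¹) • (t : A) + 1) :
    IsTriple t x (π * t) where
  txt := txt
  tyt := by
    have : π⁻¹ = π := inv_eq_of_mul_eq_one_left hπ
    rw [mul_inv_rev, this]; group
  comm := by
    have hi : π⁻¹ = π := inv_eq_of_mul_eq_one_left hπ
    have h1 : (π * t)⁻¹ * x⁻¹ * (π * t) * x * t ^ 2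
        = t⁻¹ * (π * x * π)⁻¹ * (t * x * t) * t := by
      simp only [mul_inv_rev, hi, pow_two, mul_assoc]
    have hc : Commute (cU A ^ 2)⁻¹ t := ((show Commute (cU A) t from cU_comm t).pow_left 2).inv_left
    rw [h1, hx, txt]
    calc t⁻¹ * (cU A ^ 2 * x⁻¹)⁻¹ * x⁻¹ * t = t⁻¹ * (x * (cU A ^ 2)⁻¹ * x⁻¹) * t := by group
      _ = t⁻¹ * ((cU A ^ 2)⁻¹ * t) := by
        have hcx : Commute (cU A ^ 2)⁻¹ x :=
          ((show Commute (cU A) x from cU_comm x).pow_left 2).inv_left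
        rw [← hcx.eq]; group
      _ = (cU A ^ 2)⁻¹ := by rw [hc.eq]; group
  quad := quad

section Tau

variable {t x y : Aˣ} (h : IsTriple t x y)

private theorem sq_eq (h : IsTriple t x y) :
    t ^ 2 = x⁻¹ * y⁻¹ * x * y * (cU A ^ 2)⁻¹ := by
  rw [← h.comm]; group

private theorem xt_eq (h : IsTriple t x y) : t⁻¹ * x⁻¹ = x * t := by
  rw [← h.txt]; group

private theorem yt_eq (h : IsTriple t x y) : y * t⁻¹ = t * y⁻¹ := by
  rw [← h.tyt]; group

private theorem c_inv (a : Aˣ) : (cU A)⁻¹ * a = a * (cU A)⁻¹ :=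
  ((show Commute (cU A) a from cU_comm a).inv_left).eq

private theorem c_sq_inv (a : Aˣ) : (cU A ^ 2)⁻¹ * a = a * (cU A ^ 2)⁻¹ :=
  (((show Commute (cU A) a from cU_comm a).pow_left 2).inv_left).eq

private theorem c_sq (a : Aˣ) : cU A ^ 2 * a = a * cU A ^ 2 :=
  ((show Commute (cU A) a from cU_comm a).pow_left 2).eq

theorem isTriple_tauPlus (h : IsTriple t x y) : IsTriple t x ((cU A)⁻¹ * x * y) where
  txt := h.txt
  tyt := by
    calc t⁻¹ * ((cU A)⁻¹ * x * y) * t⁻¹ = (t⁻¹ * (cU A)⁻¹) * x * (y * t⁻¹) := by group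
      _ = ((cU A)⁻¹ * t⁻¹) * x * (t * y⁻¹) := by rw [← c_inv, yt_eq h]
      _ = (cU A)⁻¹ * t⁻¹ * (x * t) * y⁻¹ := by group
      _ = (cU A)⁻¹ * (t ^ 2)⁻¹ * x⁻¹ * y⁻¹ := by rw [← xt_eq h]; group
      _ = (cU A)⁻¹ * (x⁻¹ * y⁻¹ * x * y * (cU A ^ 2)⁻¹)⁻¹ * x⁻¹ * y⁻¹ := by rw [sq_eq h]
      _ = cU A * (y⁻¹ * x⁻¹) := by group
      _ = ((cU A)⁻¹ * x * y)⁻¹ := by rw [cU_comm]; group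
  comm := by
    rw [← h.comm]
    calc ((cU A)⁻¹ * x * y)⁻¹ * x⁻¹ * ((cU A)⁻¹ * x * y) * x * t ^ 2
        = y⁻¹ * x⁻¹ * (cU A * x⁻¹) * (cU A)⁻¹ * x * y * x * t ^ 2 := by group
      _ = y⁻¹ * x⁻¹ * y * x * t ^ 2 := by rw [cU_comm]; group
  quad := h.quad

theorem isTriple_tauPlusInv (h : IsTriple t x y) : IsTriple t x (cU A * x⁻¹ * y) where
  txt := h.txt
  tyt := by
    calc t⁻¹ * (cU A * x⁻¹ * y) * t⁻¹ = (t⁻¹ * cU A) * x⁻¹ * (y * t⁻¹) := by group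
      _ = (cU A * t⁻¹) * x⁻¹ * (t * y⁻¹) := by rw [← cU_comm, yt_eq h]
      _ = cU A * (t⁻¹ * x⁻¹) * t * y⁻¹ := by group
      _ = cU A * x * t ^ 2 * y⁻¹ := by rw [xt_eq h, pow_two]; group
      _ = cU A * y⁻¹ * x * y * ((cU A ^ 2)⁻¹ * y⁻¹) := by rw [sq_eq h]; group
      _ = cU A * (y⁻¹ * x) * (cU A ^ 2)⁻¹ := by rw [c_sq_inv]; group
      _ = (cU A * x⁻¹ * y)⁻¹ := by rw [cU_comm]; group
  comm := by
    rw [← h.comm]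
    calc (cU A * x⁻¹ * y)⁻¹ * x⁻¹ * (cU A * x⁻¹ * y) * x * t ^ 2
        = y⁻¹ * x * ((cU A)⁻¹ * x⁻¹) * cU A * x⁻¹ * y * x * t ^ 2 := by group
      _ = y⁻¹ * x⁻¹ * y * x * t ^ 2 := by rw [c_inv]; group
  quad := h.quad

theorem isTriple_tauMinus (h : IsTriple t x y) : IsTriple t (cU A * y * x) y where
  txt := by
    calc t * (cU A * y * x) * t = (t * cU A) * y * (x * t) := by group
      _ = (cU A * t) * (y * t⁻¹) * x⁻¹ := by rw [← cU_comm, ← xt_eq h]; group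
      _ = cU A * t ^ 2 * y⁻¹ * x⁻¹ := by rw [yt_eq h, pow_two]; group
      _ = cU A * x⁻¹ * y⁻¹ * x * y * ((cU A ^ 2)⁻¹ * (y⁻¹ * x⁻¹)) := by rw [sq_eq h]; group
      _ = cU A * (x⁻¹ * y⁻¹) * (cU A ^ 2)⁻¹ := by rw [c_sq_inv]; group
      _ = (cU A * y * x)⁻¹ := by rw [cU_comm]; group
  tyt := h.tyt
  comm := by
    rw [← h.comm]
    calc y⁻¹ * (cU A * y * x)⁻¹ * y * (cU A * y * x) * t ^ 2
        = y⁻¹ * x⁻¹ * y⁻¹ * ((cU A)⁻¹ * y) * cU A * y * x * t ^ 2 := by group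
      _ = y⁻¹ * x⁻¹ * y * x * t ^ 2 := by rw [c_inv]; group
  quad := h.quad

theorem isTriple_tauMinusInv (h : IsTriple t x y) : IsTriple t ((cU A)⁻¹ * y⁻¹ * x) y where
  txt := by
    calc t * ((cU A)⁻¹ * y⁻¹ * x) * t = (t * (cU A)⁻¹) * y⁻¹ * (x * t) := by group
      _ = (cU A)⁻¹ * (t * y⁻¹) * t⁻¹ * x⁻¹ := by rw [← c_inv, ← xt_eq h]; group
      _ = (cU A)⁻¹ * y * (t ^ 2)⁻¹ * x⁻¹ := by rw [← yt_eq h]; group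
      _ = (cU A)⁻¹ * (y * cU A ^ 2) * y⁻¹ * x⁻¹ * y := by rw [sq_eq h]; group
      _ = cU A * (x⁻¹ * y) := by rw [← c_sq]; group
      _ = ((cU A)⁻¹ * y⁻¹ * x)⁻¹ := by rw [cU_comm]; group
  tyt := h.tyt
  comm := by
    rw [← h.comm]
    calc y⁻¹ * ((cU A)⁻¹ * y⁻¹ * x)⁻¹ * y * ((cU A)⁻¹ * y⁻¹ * x) * t ^ 2
        = y⁻¹ * x⁻¹ * y * (cU A * y) * (cU A)⁻¹ * y⁻¹ * x * t ^ 2 := by group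
      _ = y⁻¹ * x⁻¹ * y * x * t ^ 2 := by rw [cU_comm]; group
  quad := h.quad

end Tau

/-- The effect of an algebra homomorphism on units. -/
abbrev unitMap (f : HH →ₐ[Kqt] A) : HHˣ →* Aˣ := Units.map (f : HH →* A)

theorem unitMap_cU (f : HH →ₐ[Kqt] A) : unitMap f (cU HH) = cU A := Units.ext (f.commutes u₀)

theorem unitMap_t {t x y : Aˣ} (h : IsTriple t x y) : unitMap (HHlift h) tH = t :=
  Units.ext (HHlift_t h)

theorem unitMap_x {t x y : Aˣ} (h : IsTriple t x y) : unitMap (HHlift h) xH = x :=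
  Units.ext (HHlift_x h)

theorem unitMap_y {t x y : Aˣ} (h : IsTriple t x y) : unitMap (HHlift h) yH = y :=
  Units.ext (HHlift_y h)

theorem comp_eq_id {t x y : HHˣ} (h : IsTriple t x y) (f : HH →ₐ[Kqt] HH)
    (ht : unitMap f t = tH) (hx : unitMap f x = xH) (hy : unitMap f y = yH) :
    f.comp (HHlift h) = AlgHom.id Kqt HH := by
  apply HH_hom_ext
  · rw [AlgHom.comp_apply, HHlift_t]; exact congrArg Units.val ht
  · rw [AlgHom.comp_apply, HHlift_x]; exact congrArg Units.val hx
  · rw [AlgHom.comp_apply, HHlift_y]; exact congrArg Units.val hy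

/-- The automorphism `τ_+`: `X ↦ X`, `Y ↦ q^{-1/4} X Y`, `T ↦ T`. -/
def tauPlus : HH ≃ₐ[Kqt] HH :=
  AlgEquiv.ofAlgHom (HHlift (isTriple_tauPlus isTriple_gen))
    (HHlift (isTriple_tauPlusInv isTriple_gen))
    (comp_eq_id _ _ (unitMap_t _) (unitMap_x _) (by
      simp only [map_mul, map_inv, unitMap_cU, unitMap_x, unitMap_y]
      rw [cU_comm]; group))
    (comp_eq_id _ _ (unitMap_t _) (unitMap_x _) (by
      simp only [map_mul, map_inv, unitMap_cU, unitMap_x, unitMap_y]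
      rw [c_inv]; group))

/-- The automorphism `τ_-`: `X ↦ q^{1/4} Y X`, `Y ↦ Y`, `T ↦ T`. -/
def tauMinus : HH ≃ₐ[Kqt] HH :=
  AlgEquiv.ofAlgHom (HHlift (isTriple_tauMinus isTriple_gen))
    (HHlift (isTriple_tauMinusInv isTriple_gen))
    (comp_eq_id _ _ (unitMap_t _) (by
      simp only [map_mul, map_inv, unitMap_cU, unitMap_x, unitMap_y]
      rw [c_inv]; group) (unitMap_y _))
    (comp_eq_id _ _ (unitMap_t _) (by
      simp only [map_mul, unitMap_cU, unitMap_x, unitMap_y]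
      rw [cU_comm]; group) (unitMap_y _))

/-- `σ = τ_+ τ_-^{-1} τ_+`. -/
def sigma : HH ≃ₐ[Kqt] HH := tauPlus * tauMinus⁻¹ * tauPlus

end Algebra

/-! ## The polynomial and the functional representation -/

section Representations

/-- `T̂` as a unit. -/
def tPoly : (Module.End Kqt Kqt[T;T⁻¹])ˣ where
  val := tOp v₀
  inv := tOp v₀ - (v₀ - v₀⁻¹) • 1
  val_inv := LinearMap.ext fun f => by
    simp [Module.End.mul_apply, tOp_tOp v₀_ne]
  inv_val := LinearMap.ext fun f => by
    simp [Module.End.mul_apply, tOp_tOp v₀_ne]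

/-- Multiplication by `X` as a unit. -/
def xPoly : (Module.End Kqt Kqt[T;T⁻¹])ˣ where
  val := xOp 1
  inv := xOp (-1)
  val_inv := LinearMap.ext fun f => by
    rw [Module.End.mul_apply, xOp_apply, xOp_apply, ← mul_assoc, ← LaurentPolynomial.T_add]; simp
  inv_val := LinearMap.ext fun f => by
    rw [Module.End.mul_apply, xOp_apply, xOp_apply, ← mul_assoc, ← LaurentPolynomial.T_add]; simp

/-- `s p` as a unit. -/
def piPoly : (Module.End Kqt Kqt[T;T⁻¹])ˣ where
  val := sOp ∘ₗ pOp u₀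
  inv := sOp ∘ₗ pOp u₀
  val_inv := LinearMap.ext fun f => sp_sp u₀_ne f
  inv_val := LinearMap.ext fun f => sp_sp u₀_ne f

theorem isTriple_poly : IsTriple tPoly xPoly (piPoly * tPoly) := by
  apply isTriple_of_pi
  · exact Units.ext (LinearMap.ext fun f => tOp_X_tOp v₀_ne f)
  · exact Units.ext (LinearMap.ext fun f => sp_sp u₀_ne f)
  · refine Units.ext (LinearMap.ext fun f => (sp_X_sp u₀_ne f).trans ?_)
    simp [cU, xPoly, Algebra.algebraMap_eq_smul_one, pow_two, mul_smul]
  · exact LinearMap.ext fun f => tOp_tOp v₀_ne f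

/-- The polynomial representation `H ↦ Ĥ` in the space of Laurent polynomials. -/
def polyRep : HH →ₐ[Kqt] Module.End Kqt Kqt[T;T⁻¹] := HHlift isTriple_poly

/-- The space of all functions on `{n_♯ : n ∈ ℤ}`; a function is written in terms of `n`
(the `n_♯` are pairwise distinct).  In these terms `s(n_♯) = (-n)_♯` for `n ≠ 0` and
`(s p)(n_♯) = 1/2 - n_♯ = (1 - n)_♯`. -/
abbrev Fun : Type := ℤ → Kqt

/-- Linear operators on functions of the form `f ↦ a(z) f(w(z)) + b(z) f(z)`. -/
def funOp (a : ℤ → Kqt) (w : ℤ → ℤ) (b : ℤ → Kqt) : Module.End Kqt Fun where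
  toFun f n := a n * f (w n) + b n * f n
  map_add' f g := by ext n; simp; ring
  map_smul' c f := by ext n; simp; ring

/-- The coefficient `(t^{1/2} q^{2z} - t^{-1/2}) / (q^{2z} - 1)` at `z = n_♯`; zero for `n = 0`. -/
def tFunA (n : ℤ) : Kqt :=
  (v₀ * qSharp u₀ v₀ n ^ 2 - v₀⁻¹) / (qSharp u₀ v₀ n ^ 2 - 1)

/-- The coefficient `-(t^{1/2} - t^{-1/2}) / (q^{2z} - 1)` at `z = n_♯`. -/
def tFunB (n : ℤ) : Kqt := -((v₀ - v₀⁻¹) / (qSharp u₀ v₀ n ^ 2 - 1))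

/-- `T'`: the term with `f(s(z))` is absent for `n = 0`, where its coefficient vanishes. -/
def tFun : Module.End Kqt Fun := funOp tFunA (fun n => -n) tFunB

/-- `(X' f)(z) = q^z f(z)`. -/
def xFun : Module.End Kqt Fun := funOp 0 id (qSharp u₀ v₀)

/-- `(s p f)(z) = f(1/2 - z)`. -/
def piFun : Module.End Kqt Fun := funOp 1 (fun n => 1 - n) 0

theorem qSharp_eq_mon (n : ℤ) : qSharp u₀ v₀ n = mon (2 * n) (if 0 < n then 1 else -1) := by
  have hu : ∀ m : ℤ, u₀ ^ m = mon m 0 := by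
    intro m
    have hn : ∀ j : ℕ, u₀ ^ j = mon j 0 := by
      intro j
      induction j with
      | zero => simp [mon_zero]
      | succ j ih => rw [pow_succ, ih, u₀, mon_mul]; simp
    cases m with
    | ofNat j => simpa using hn j
    | negSucc j =>
      rw [zpow_negSucc, hn, mon_inv, neg_zero, Int.negSucc_eq]; push_cast; rfl
  rw [qSharp, hu]
  split_ifs
  · rw [v₀, mon_mul]; simp
  · rw [v₀, mon_inv, mon_mul]; simp

theorem qSharp_ne_zero (n : ℤ) : qSharp u₀ v₀ n ≠ 0 := by
  rw [qSharp_eq_mon]; exact mon_ne_zero _ _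

theorem qSharp_sq_sub_one_ne_zero (n : ℤ) : qSharp u₀ v₀ n ^ 2 - 1 ≠ 0 := by
  rw [sub_ne_zero, pow_two, qSharp_eq_mon, mon_mul, ← mon_zero]
  intro h
  have := (mon_injective h).2
  split_ifs at this <;> omega

theorem qSharp_neg {n : ℤ} (hn : n ≠ 0) : qSharp u₀ v₀ (-n) = (qSharp u₀ v₀ n)⁻¹ := by
  rw [qSharp_eq_mon, qSharp_eq_mon, mon_inv]
  congr 1
  · ring
  · split_ifs <;> omega

theorem qSharp_one_sub (n : ℤ) : qSharp u₀ v₀ (1 - n) = u₀ ^ 2 * (qSharp u₀ v₀ n)⁻¹ := by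
  rw [qSharp_eq_mon, qSharp_eq_mon, mon_inv, pow_two, u₀, mon_mul, mon_mul]
  congr 1
  · ring
  · split_ifs <;> omega

theorem qSharp_zero : qSharp u₀ v₀ 0 = v₀⁻¹ := by simp [qSharp]

theorem tFunA_zero : tFunA 0 = 0 := by
  have h := v₀_ne
  have e : v₀ * v₀⁻¹ ^ 2 - v₀⁻¹ = 0 := by field_simp; ring
  rw [tFunA, qSharp_zero, e, zero_div]

theorem tFunB_zero : tFunB 0 = v₀ := by
  have h := qSharp_sq_sub_one_ne_zero 0
  have hv := v₀_ne
  rw [tFunB]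
  rw [qSharp_zero] at h ⊢
  rw [neg_eq_iff_eq_neg, div_eq_iff h]
  field_simp
  ring

theorem tFun_tFun (f : Fun) : tFun (tFun f) = (v₀ - v₀⁻¹) • tFun f + f := by
  ext n
  change tFunA n * (tFunA (-n) * f (- -n) + tFunB (-n) * f (-n))
      + tFunB n * (tFunA n * f (-n) + tFunB n * f n)
    = (v₀ - v₀⁻¹) * (tFunA n * f (-n) + tFunB n * f n) + f n
  have hv := v₀_ne
  rcases eq_or_ne n 0 with rfl | hn
  · rw [tFunA_zero, tFunB_zero]
    field_simp
    ring
  · have h1 := qSharp_sq_sub_one_ne_zero n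
    have h2 := qSharp_sq_sub_one_ne_zero (-n)
    have h0 := qSharp_ne_zero n
    rw [qSharp_neg hn] at h2
    have h3 : 1 - qSharp u₀ v₀ n ^ 2 ≠ 0 := by rw [← neg_sub]; exact neg_ne_zero.mpr h1
    have e1 : tFunA n * tFunA (-n) + tFunB n * tFunB n = (v₀ - v₀⁻¹) * tFunB n + 1 := by
      rw [tFunA, tFunA, tFunB, qSharp_neg hn]
      generalize qSharp u₀ v₀ n = x at *
      have h4 : x⁻¹ ^ 2 - 1 = (1 - x ^ 2) / x ^ 2 := by field_simp
      rw [h4]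
      have h5 : 1 - x ^ 2 = -(x ^ 2 - 1) := by ring
      rw [h5]
      field_simp
      ring
    have e2 : tFunA n * tFunB (-n) + tFunB n * tFunA n = (v₀ - v₀⁻¹) * tFunA n := by
      rw [tFunA, tFunB, tFunB, qSharp_neg hn]
      generalize qSharp u₀ v₀ n = x at *
      have h4 : x⁻¹ ^ 2 - 1 = (1 - x ^ 2) / x ^ 2 := by field_simp
      rw [h4]
      have h5 : 1 - x ^ 2 = -(x ^ 2 - 1) := by ring
      rw [h5]
      field_simp
      ring
    rw [neg_neg]
    linear_combination f n * e1 + f (-n) * e2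

theorem tFun_X_tFun (f : Fun) : xFun (tFun (xFun (tFun f))) = f := by
  have hT := tFun_tFun f
  have key : ∀ g : Fun, xFun (tFun (xFun g)) = tFun g - (v₀ - v₀⁻¹) • g := by
    intro g
    ext n
    change 0 * _ + qSharp u₀ v₀ n * (tFunA n * (0 * _ + qSharp u₀ v₀ (-n) * g (-n))
        + tFunB n * (0 * _ + qSharp u₀ v₀ n * g n))
      = tFunA n * g (-n) + tFunB n * g n - (v₀ - v₀⁻¹) * g n
    have h0 := qSharp_ne_zero n
    have h1 := qSharp_sq_sub_one_ne_zero n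
    have e1 : qSharp u₀ v₀ n * tFunA n * qSharp u₀ v₀ (-n) = tFunA n := by
      rcases eq_or_ne n 0 with rfl | hn
      · rw [tFunA_zero]; ring
      · rw [qSharp_neg hn]; field_simp
    have e2 : qSharp u₀ v₀ n ^ 2 * tFunB n = tFunB n - (v₀ - v₀⁻¹) := by
      rw [tFunB]
      generalize qSharp u₀ v₀ n = x at *
      generalize v₀ - v₀⁻¹ = c
      field_simp
      ring
    linear_combination g (-n) * e1 + g n * e2
  rw [key, hT]
  simp

/-- `T'` as a unit. -/
def tFunU : (Module.End Kqt Fun)ˣ where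
  val := tFun
  inv := tFun - (v₀ - v₀⁻¹) • 1
  val_inv := LinearMap.ext fun f => by simp [Module.End.mul_apply, tFun_tFun]
  inv_val := LinearMap.ext fun f => by simp [Module.End.mul_apply, tFun_tFun]

/-- `X'` as a unit. -/
def xFunU : (Module.End Kqt Fun)ˣ where
  val := xFun
  inv := funOp 0 id fun n => (qSharp u₀ v₀ n)⁻¹
  val_inv := LinearMap.ext fun f => by
    ext n
    have h0 := qSharp_ne_zero n
    simp [Module.End.mul_apply, xFun, funOp, h0]
  inv_val := LinearMap.ext fun f => by
    ext n
    have h0 := qSharp_ne_zero n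
    simp [Module.End.mul_apply, xFun, funOp, h0]

/-- `s p` as a unit. -/
def piFunU : (Module.End Kqt Fun)ˣ where
  val := piFun
  inv := piFun
  val_inv := LinearMap.ext fun f => by
    ext n
    simp [Module.End.mul_apply, piFun, funOp]
  inv_val := LinearMap.ext fun f => by
    ext n
    simp [Module.End.mul_apply, piFun, funOp]

theorem isTriple_fun : IsTriple tFunU xFunU (piFunU * tFunU) := by
  apply isTriple_of_pi
  · have h : xFunU * (tFunU * xFunU * tFunU) = 1 :=
      Units.ext (LinearMap.ext fun f => tFun_X_tFun f)
    exact eq_inv_of_mul_eq_one_right h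
  · exact Units.ext piFunU.val_inv
  · refine Units.ext (LinearMap.ext fun f => ?_)
    ext n
    simp [cU, xFunU, piFunU, piFun, xFun, funOp, Module.End.mul_apply, qSharp_one_sub,
      Algebra.algebraMap_eq_smul_one, pow_two, mul_assoc]
  · exact LinearMap.ext fun f => tFun_tFun f

/-- The functional representation `H ↦ H'` in the space of all functions on `{n_♯}`. -/
def funRep : HH →ₐ[Kqt] Module.End Kqt Fun := HHlift isTriple_fun

theorem funOp_finite {a : ℤ → Kqt} {w : ℤ → ℤ} {b : ℤ → Kqt} (hw : Function.Injective w)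
    {f : Fun} (hf : f.support.Finite) : (funOp a w b f).support.Finite := by
  refine ((hf.preimage hw.injOn).union hf).subset fun n hn => ?_
  by_contra hc
  simp only [Set.mem_union, Set.mem_preimage, Function.mem_support, not_or, not_not] at hc
  exact hn (by simp [funOp, hc.1, hc.2])

/-- The finitely supported functions form a submodule with respect to `H ↦ H'`. -/
theorem funRep_finite (H : HH) {f : Fun} (hf : f.support.Finite) :
    (funRep H f).support.Finite := by
  have sm : ∀ (c : Kqt) (g : Fun), g.support.Finite → (c • g).support.Finite :=
    fun c g hg => hg.subset (Function.support_const_smul_subset c g)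
  have ht : ∀ g : Fun, g.support.Finite → (tFun g).support.Finite :=
    fun g hg => funOp_finite neg_injective hg
  have hti : ∀ g : Fun, g.support.Finite → ((tFun - (v₀ - v₀⁻¹) • 1) g).support.Finite :=
    fun g hg => ((ht g hg).union (sm _ g hg)).subset (Function.support_sub _ _)
  have hπ : ∀ g : Fun, g.support.Finite → (piFun g).support.Finite :=
    fun g hg => funOp_finite sub_right_injective hg
  have hw : ∀ (w : FreeGroup Gen) (g : Fun), g.support.Finite →
      (funRep (wordU w) g).support.Finite := by
    intro w
    rw [funRep, HHlift_word]
    induction w using FreeGroup.induction_on with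
    | C1 => intro g hg; simpa using hg
    | of a =>
      intro g hg
      rw [FreeGroup.lift_apply_of]
      cases a with
      | T => exact ht g hg
      | X => exact funOp_finite (fun _ _ h => h) hg
      | Y => exact hπ _ (ht g hg)
    | inv_of a _ =>
      intro g hg
      rw [map_inv, FreeGroup.lift_apply_of]
      cases a with
      | T => exact hti g hg
      | X => exact funOp_finite (b := fun n => (qSharp u₀ v₀ n)⁻¹) (fun _ _ h => h) hg
      | Y =>
        rw [genMap, mul_inv_rev]
        exact hti _ (hπ g hg)
    | mul x y hx hy =>
      intro g hg
      rw [map_mul]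
      exact hx _ (hy g hg)
  obtain ⟨z, rfl⟩ := RingQuot.mkAlgHom_surjective Kqt Rel H
  induction z using MonoidAlgebra.induction_on with
  | of w => exact hw w f hf
  | add x y hx hy =>
    rw [map_add, map_add]
    exact (hx.union hy).subset (Function.support_add _ _)
  | smul r x hx =>
    rw [map_smul, map_smul]
    exact sm r _ hx

end Representations

/-! ## Fourier transforms and inner products over `ℚ(q^{1/4}, t^{1/2})` -/

section Fourier

/-- `F_∘(f)(n_♯) = ⟨f ε_n⟩_∘`. -/
def FCirc (f : Kqt[T;T⁻¹]) : Fun := fun n => constTerm u₀ v₀ (f * epsPoly u₀ v₀ n)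

/-- `⟨F⟩_• = ∑_n F(n_♯) μ_•(n_♯)` for a finitely supported function `F`. -/
def sumBullet (F : Fun) : Kqt := ∑ᶠ n, F n * muBullet u₀ v₀ n

/-- `F_•(f)(n_♯) = ⟨f ε_n^*⟩_•`, for a finitely supported function `f`. -/
def FBullet (f : Fun) : Fun := fun n =>
  sumBullet fun m => f m * evalAt (qSharp u₀ v₀ m) (starL (epsPoly u₀ v₀ n))

/-- `⟨f, g⟩_∘ = ⟨f g^*⟩_∘`. -/
def formCirc (f g : Kqt[T;T⁻¹]) : Kqt := constTerm u₀ v₀ (f * starL g)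

/-- `⟨f, g⟩_• = ⟨f g^*⟩_•`, where `g^*(z) = g(z)^*`. -/
def formBullet (f g : Fun) : Kqt := sumBullet fun n => f n * starK (g n)

end Fourier

/-! ## Numerical parameters `0 < q < 1`, `k ∈ ℂ`, `t = q^k`, and the Gaussians -/

section Gauss

/-- `q^z` for a positive number `q`. -/
def qpow (q : ℝ) (z : ℂ) : ℂ := (q : ℂ) ^ z

/-- `q^{1/4}`. -/
def uNum (q : ℝ) : ℂ := qpow q (1 / 4)

/-- `t^{1/2} = q^{k/2}`. -/
def vNum (q : ℝ) (k : ℂ) : ℂ := qpow q (k / 2)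

/-- `n_♯ = (n + sgn(n - 1/2) k) / 2`. -/
def sharp (k : ℂ) (n : ℤ) : ℂ := (n + if 0 < n then k else -k) / 2

/-- The spherical polynomial `ε_n` for the given `q`, `k`. -/
def epsNum (q : ℝ) (k : ℂ) (n : ℤ) : ℂ[T;T⁻¹] := epsPoly (uNum q) (vNum q k) n

/-- `ε_n^*`: the result of `X ↦ X^{-1}`, `q ↦ q^{-1}`, `t ↦ t^{-1}` in `ε_n`. -/
def epsStarNum (q : ℝ) (k : ℂ) (n : ℤ) : ℂ[T;T⁻¹] :=
  LaurentPolynomial.invert (epsPoly (uNum q)⁻¹ (vNum q k)⁻¹ n)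

/-- The coefficient of `X^j` in `f γ̃^{-1}`, where `γ̃^{-1} = ∑_n q^{n²/4} X^n`. -/
def gaussMulCoeff (q : ℝ) (f : ℂ[T;T⁻¹]) (j : ℤ) : ℂ :=
  f.coeff.sum fun i a => a * qpow q (((j - i : ℤ) : ℂ) ^ 2 / 4)

/-- The `j`-th term of the constant term of `(f γ̃^{-1}) μ_∘`: the coefficient of `X^j` in the
first series times that of `X^{-j}` in the second one. -/
def gaussCircTerm (q : ℝ) (k : ℂ) (f : ℂ[T;T⁻¹]) (j : ℤ) : ℂ :=
  gaussMulCoeff q f j * muCirc (uNum q ^ 4) (vNum q k ^ 2) (-j)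

/-- `⟨f γ̃^{-1}⟩_∘ = Const Term (f γ̃^{-1} μ_∘)`. -/
def gaussCirc (q : ℝ) (k : ℂ) (f : ℂ[T;T⁻¹]) : ℂ := ∑' j : ℤ, gaussCircTerm q k f j

/-- The term `f(j_♯) γ(j_♯) μ_•(j_♯)` of `⟨f γ⟩_•`, where `γ(z) = q^{z²}`. -/
def gaussBulletTerm (q : ℝ) (k : ℂ) (f : ℂ[T;T⁻¹]) (j : ℤ) : ℂ :=
  evalAt (qpow q (sharp k j)) f * qpow q (sharp k j ^ 2) * muBullet (uNum q) (vNum q k) j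

/-- `⟨f γ⟩_• = ∑_j f(j_♯) γ(j_♯) μ_•(j_♯)`. -/
def gaussBullet (q : ℝ) (k : ℂ) (f : ℂ[T;T⁻¹]) : ℂ := ∑' j : ℤ, gaussBulletTerm q k f j

end Gauss


end RankOneDAHA

end

open RankOneDAHA
open scoped LaurentPolynomial

noncomputable section

namespace RankOneDAHA

open scoped LaurentPolynomial
open LaurentPolynomial (T)

/-! ### Linear functionals on Laurent polynomials, values of the operators, self-adjointness of
`T̂`. -/

section LinearFunctionals

variable {K : Type*} [Field K]

/-! Write π for s p. Everything rests on three relations, `Generic.X_mul_tOp_epsPoly`,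
`Generic.tOp_epsPoly` and `Generic.piOp_epsPoly`: X T̂ ε_n = ε_{1-n}, T̂ ε_n = A_n ε_{-n} + B_n ε_n,
π ε_n = q^{n_♯} T̂ ε_n. Here A_n, B_n are the coefficients of T' at z = n_♯, so T acts on the index
n by the formula by which it acts on the argument z. The relations come from the intertwiners X T̂
and T̂ - B_n of Ŷ, which produce eigenvectors along 0, 1, -1, 2, -2, … starting from the constant 1
and keep track of the value at -k/2. Triangularity of Ŷ and simplicity of its spectrum give
uniqueness.

Part (i). The functional equation of μ is a two-term recursion for its coefficients. It yields that
the constant term functional is invariant under π and that T̂ is self-adjoint for the bilinear form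
⟨fg⟩_∘. Transposing the three relations gives F_∘ T̂ = T' F_∘, F_∘ π = X'T' F_∘ and F_∘ T̂X = π F_∘;
this is σ, because σ(T) = T, σ(X) = Y^{-1}, σ(Y) = XT². The image of 1 is the delta function at 0_♯,
and X on one side and Y' on the other preserve the forms, so the isometry reduces to ⟨g^*⟩_∘ =
(⟨g⟩_∘)^*. For F_• the argument is the same: T', X' and π are unitary for ⟨ , ⟩_•, and taking values
at the points n_♯ turns Ĥ into H' (`sharpValues_tOp`, `sharpValues_X`, `sharpValues_piOp`).

Part (ii). With a Gaussian inserted, T̂ stays self-adjoint for both functionals Λ, while invariance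
under π becomes q^{1/4} Λ(f) = Λ(X πf), respectively Λ(f) = q^{1/4} Λ(X^{-1} πf). Put g_m =
q^{(m²+2k|m|)/4}. Then Λ(ε_m ε_n)/(g_m g_n), respectively g_m g_n Λ(ε_m ε_n^*), satisfies in m and n
the recursions of the matrix ε_n(m_♯), and these determine the matrix from its column n = 0
(`Generic.eq_const_mul_evalAt`). Convergence holds because q^{j²/4} beats the geometric growth of
the coefficients of μ_∘ and of the weights μ_•. -/

/-- The linear functional on Laurent polynomials with prescribed values on the monomials. -/
def functional (F : ℤ → K) : K[T;T⁻¹] →ₗ[K] K :=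
  (Finsupp.lsum K fun n => LinearMap.toSpanSingleton K K (F n)) ∘ₗ
    (AddMonoidAlgebra.coeffLinearEquiv K).toLinearMap

theorem functional_apply (F : ℤ → K) (f : K[T;T⁻¹]) :
    functional F f = f.coeff.sum fun n a => a * F n := by
  simp [functional, Finsupp.sum]

@[simp] theorem functional_T (F : ℤ → K) (n : ℤ) : functional F (T n) = F n := by
  have h : (T n : K[T;T⁻¹]).coeff = Finsupp.single n 1 := rfl
  simp [functional_apply, h]

theorem laurent_ext {V : Type*} [AddCommMonoid V] [Module K V] {A B : K[T;T⁻¹] →ₗ[K] V}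
    (h : ∀ n, A (T n) = B (T n)) : A = B := by
  refine LinearMap.ext fun f => ?_
  induction f using LaurentPolynomial.induction_on' with
  | add p q hp hq => rw [map_add, map_add, hp, hq]
  | C_mul_T n a => rw [← LaurentPolynomial.smul_eq_C_mul, map_smul, map_smul, h]

theorem laurent_bilin_ext {V : Type*} [AddCommMonoid V] [Module K V]
    {A B : K[T;T⁻¹] →ₗ[K] K[T;T⁻¹] →ₗ[K] V}
    (h : ∀ m n, A (T m) (T n) = B (T m) (T n)) (f g : K[T;T⁻¹]) : A f g = B f g := by
  rw [laurent_ext fun m => laurent_ext fun n => h m n]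

theorem evalAt_eq (x : K) (f : K[T;T⁻¹]) : evalAt x f = functional (fun n => x ^ n) f :=
  (functional_apply _ f).symm

@[simp] theorem evalAt_T (x : K) (n : ℤ) : evalAt x (T n) = x ^ n := by
  rw [evalAt_eq, functional_T]

@[simp] theorem evalAt_one (x : K) : evalAt x 1 = 1 := by
  rw [← LaurentPolynomial.T_zero, evalAt_T, zpow_zero]

@[simp] theorem evalAt_add (x : K) (f g : K[T;T⁻¹]) :
    evalAt x (f + g) = evalAt x f + evalAt x g := by
  simp [evalAt_eq]

@[simp] theorem evalAt_sub (x : K) (f g : K[T;T⁻¹]) :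
    evalAt x (f - g) = evalAt x f - evalAt x g := by
  simp [evalAt_eq]

@[simp] theorem evalAt_smul (x c : K) (f : K[T;T⁻¹]) : evalAt x (c • f) = c * evalAt x f := by
  simp [evalAt_eq]

theorem evalAt_mul {x : K} (hx : x ≠ 0) (f g : K[T;T⁻¹]) :
    evalAt x (f * g) = evalAt x f * evalAt x g := by
  have := laurent_bilin_ext
    (A := (LinearMap.mul K K[T;T⁻¹]).compr₂ (functional fun n => x ^ n))
    (B := (LinearMap.mul K K).compl₁₂ (functional fun n => x ^ n) (functional fun n => x ^ n))
    (fun m n => by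
      simp only [LinearMap.compr₂_apply, LinearMap.mul_apply', LinearMap.compl₁₂_apply,
        ← LaurentPolynomial.T_add, functional_T, zpow_add₀ hx]) f g
  simpa [evalAt_eq] using this

theorem T_mul_T' (m n : ℤ) : (T m * T n : K[T;T⁻¹]) = T (m + n) :=
  (LaurentPolynomial.T_add m n).symm

theorem T_two_sub_one_mul_cancel {f g : K[T;T⁻¹]} (h : (T 2 - 1) * f = (T 2 - 1) * g) :
    f = g := by
  refine mul_left_cancel₀ (fun h0 => ?_) h
  have h1 := congrArg (fun f : K[T;T⁻¹] => f.coeff 2) h0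
  rw [← LaurentPolynomial.T_zero] at h1
  simp [LaurentPolynomial.T_apply, -LaurentPolynomial.T_zero] at h1

theorem sOp_divDiff (f : K[T;T⁻¹]) : sOp (divDiff f) = T 2 * divDiff f := by
  apply T_two_sub_one_mul_cancel
  have h := congrArg sOp (divDiff_spec f)
  rw [sOp_mul, map_sub, map_sub, sOp_T, sOp_sOp, ← LaurentPolynomial.T_zero, sOp_T] at h
  have h2 := divDiff_spec f
  have e : (T 2 : K[T;T⁻¹]) * T (-2) = 1 := by rw [T_mul_T']; simp
  simp only [neg_zero, LaurentPolynomial.T_zero] at h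
  linear_combination (-(T 2 : K[T;T⁻¹])) * h - T 2 * h2 + sOp (divDiff f) * e

theorem evalAt_sOp (x : K) (f : K[T;T⁻¹]) : evalAt x (sOp f) = evalAt x⁻¹ f := by
  have : functional (fun n => x ^ n) ∘ₗ sOp = functional fun n => x⁻¹ ^ n :=
    laurent_ext fun n => by simp
  rw [evalAt_eq, evalAt_eq, ← this]; rfl

theorem evalAt_pOp (u x : K) (f : K[T;T⁻¹]) : evalAt x (pOp u f) = evalAt (u ^ 2 * x) f := by
  have : functional (fun n => x ^ n) ∘ₗ pOp u = functional fun n => (u ^ 2 * x) ^ n :=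
    laurent_ext fun n => by simp [pOp, mul_zpow]
  rw [evalAt_eq, evalAt_eq, ← this]; rfl

/-- The involution `s p`, that is `f(x) ↦ f(1/2 - x)`. -/
def piOp (u : K) : K[T;T⁻¹] →ₗ[K] K[T;T⁻¹] := sOp ∘ₗ pOp u

theorem piOp_T (u : K) (n : ℤ) : piOp u (T n) = (u ^ 2) ^ n • T (-n) := by
  simp [piOp, pOp]

theorem piOp_mul {u : K} (hu : u ≠ 0) (f g : K[T;T⁻¹]) :
    piOp u (f * g) = piOp u f * piOp u g := by
  have := laurent_bilin_ext
    (A := (LinearMap.mul K K[T;T⁻¹]).compr₂ (piOp u))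
    (B := (LinearMap.mul K K[T;T⁻¹]).compl₁₂ (piOp u) (piOp u))
    (fun m n => by
      simp only [LinearMap.compr₂_apply, LinearMap.mul_apply', LinearMap.compl₁₂_apply, T_mul_T',
        piOp_T, smul_mul_smul_comm, zpow_add₀ (pow_ne_zero 2 hu), neg_add]) f g
  simpa using this

theorem piOp_piOp {u : K} (hu : u ≠ 0) (f : K[T;T⁻¹]) : piOp u (piOp u f) = f := sp_sp hu f

theorem evalAt_piOp (u x : K) (f : K[T;T⁻¹]) :
    evalAt x (piOp u f) = evalAt (u ^ 2 * x⁻¹) f := by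
  rw [piOp, LinearMap.comp_apply, evalAt_sOp, evalAt_pOp]

theorem yOp_eq (u v : K) (f : K[T;T⁻¹]) : yOp u v f = piOp u (tOp v f) := rfl

theorem tOp_X_tOp' {v : K} (hv : v ≠ 0) (f : K[T;T⁻¹]) :
    tOp v (T 1 * tOp v f) = T (-1) * f := by
  have := tOp_X_tOp hv f
  rwa [xOp_apply, xOp_apply] at this

/-- The value of `T̂ f` at a point where `X² ≠ 1`. -/
theorem evalAt_tOp (v : K) {x : K} (hx : x ≠ 0) (hx1 : x ^ 2 - 1 ≠ 0) (f : K[T;T⁻¹]) :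
    evalAt x (tOp v f) = (v * x ^ 2 - v⁻¹) / (x ^ 2 - 1) * evalAt x⁻¹ f
      + -((v - v⁻¹) / (x ^ 2 - 1)) * evalAt x f := by
  have h := congrArg (evalAt x) (divDiff_spec f)
  rw [evalAt_mul hx, evalAt_sub, evalAt_sub, evalAt_sOp, evalAt_T, evalAt_one, zpow_ofNat] at h
  rw [tOp_apply, evalAt_add, evalAt_smul, evalAt_smul, evalAt_sOp]
  generalize v⁻¹ = v' at *
  generalize evalAt x⁻¹ f = fi at *
  field_simp
  linear_combination (v - v') * h

/-- The value of `T̂ f` at `-k/2`. -/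
theorem evalAt_tOp_inv {v : K} (hv : v ≠ 0) (f : K[T;T⁻¹]) :
    evalAt v⁻¹ (tOp v f) = v * evalAt v⁻¹ f := by
  have hi : v⁻¹ ≠ 0 := inv_ne_zero hv
  -- The value formula needs X² ≠ 1. If t = 1 the divided difference drops out of T̂, and the point
  -- is its own inverse.
  by_cases h : v⁻¹ ^ 2 - 1 = 0
  · have h1 : v⁻¹ = v := by
      have h2 : v * (v⁻¹ * v⁻¹ - 1) = 0 := by rw [← pow_two, h, mul_zero]
      rw [mul_sub, mul_inv_cancel_left₀ hv, mul_one, sub_eq_zero] at h2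
      exact h2
    rw [tOp_apply, evalAt_add, evalAt_smul, evalAt_smul, evalAt_sOp, inv_inv, h1, sub_self]
    ring
  · rw [evalAt_tOp v hi h]
    have h2 : v * v⁻¹ ^ 2 - v⁻¹ = 0 := by field_simp; ring
    have h3 : v - v⁻¹ = -v * (v⁻¹ ^ 2 - 1) := by field_simp; ring
    rw [h2, h3, zero_div, zero_mul, zero_add, mul_div_assoc, div_self h]
    ring

/-- A functional which kills `(v X - v⁻¹ X⁻¹) w` for all symmetric `w`. -/
def TSelfAdjoint (v : K) (Λ : K[T;T⁻¹] →ₗ[K] K) : Prop :=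
  ∀ w : K[T;T⁻¹], sOp w = w → Λ ((v • T 1 - v⁻¹ • T (-1)) * w) = 0

/-- With D the divided difference, T̂f·g - f·T̂g = (vX - v⁻¹X⁻¹)w for w = X(Df·g - f·Dg), and w is
symmetric because sD = X²D and sf = f + (X² - 1)Df. -/
theorem TSelfAdjoint.tOp_mul {v : K} {Λ : K[T;T⁻¹] →ₗ[K] K} (h : TSelfAdjoint v Λ)
    (f g : K[T;T⁻¹]) : Λ (tOp v f * g) = Λ (f * tOp v g) := by
  set w := T 1 * (divDiff f * g - f * divDiff g) with hw
  have hf := divDiff_spec f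
  have hg := divDiff_spec g
  have e2 : (T (-1) : K[T;T⁻¹]) * T 2 = T 1 := by rw [T_mul_T']; norm_num
  have e1 : (T (-1) : K[T;T⁻¹]) * T 1 = 1 := by rw [T_mul_T']; simp
  have e3 : (T 1 : K[T;T⁻¹]) * T 1 = T 2 := by rw [T_mul_T']; norm_num
  have hs : sOp w = w := by
    rw [hw, sOp_mul, map_sub, sOp_mul, sOp_mul, sOp_divDiff, sOp_divDiff, sOp_T,
      sub_eq_iff_eq_add.mp hf.symm, sub_eq_iff_eq_add.mp hg.symm]
    linear_combination (divDiff f * g - f * divDiff g) * e2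
  have key : tOp v f * g - f * tOp v g = (v • T 1 - v⁻¹ • T (-1)) * w := by
    rw [tOp_apply, tOp_apply, sub_eq_iff_eq_add.mp hf.symm, sub_eq_iff_eq_add.mp hg.symm, hw]
    simp only [LaurentPolynomial.smul_eq_C_mul, map_sub]
    linear_combination (-LaurentPolynomial.C v * (divDiff f * g - f * divDiff g)) * e3
      + LaurentPolynomial.C v⁻¹ * (divDiff f * g - f * divDiff g) * e1
  rw [← sub_eq_zero, ← map_sub, key]
  exact h w hs

end LinearFunctionals

/-! ### Eigenvectors of `Ŷ`: existence by intertwiners. -/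

section Eigenvectors

variable {K : Type*} [Field K]

/-- The parameters for which the spherical polynomials are defined: `q^j ≠ 1` and
`t^2 q^j ≠ 1` for `j ≥ 1`. -/
structure Generic (u v : K) : Prop where
  u_ne : u ≠ 0
  v_ne : v ≠ 0
  q_pow : ∀ j : ℕ, 1 ≤ j → (u ^ 4) ^ j ≠ 1
  t_pow : ∀ j : ℕ, 1 ≤ j → v ^ 4 * (u ^ 4) ^ j ≠ 1

theorem Generic.inv {u v : K} (h : Generic u v) : Generic u⁻¹ v⁻¹ where
  u_ne := inv_ne_zero h.u_ne
  v_ne := inv_ne_zero h.v_ne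
  q_pow j hj := by
    have := h.q_pow j hj
    rwa [inv_pow, inv_pow, Ne, inv_eq_one]
  t_pow j hj := by
    have := h.t_pow j hj
    rwa [inv_pow, inv_pow, inv_pow, ← mul_inv, Ne, inv_eq_one]

/-- The reflections n ↦ 1 - n and n ↦ -n, used alternately, run through 0, 1, -1, 2, -2, …. On the
points n_♯ they are π and s, so each step is one application of an intertwiner. -/
theorem sharp_induction {P : ℤ → Prop} (h0 : P 0) (h1 : ∀ n ≤ 0, P n → P (1 - n))
    (h2 : ∀ n, 0 < n → P n → P (-n)) (n : ℤ) : P n := by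
  have key : ∀ N : ℕ, P (-(N : ℤ)) ∧ P ((N : ℤ) + 1) := by
    intro N
    induction N with
    | zero => exact ⟨by simpa using h0, by simpa using h1 0 le_rfl h0⟩
    | succ N ih =>
      have h3 := h2 _ (by omega) ih.2
      refine ⟨by simpa using h3, ?_⟩
      have h4 := h1 _ (by omega) h3
      rwa [show (1 : ℤ) - -((N : ℤ) + 1) = ((N + 1 : ℕ) : ℤ) + 1 by push_cast; ring] at h4
  rcases le_or_gt n 0 with hn | hn
  · obtain ⟨N, rfl⟩ : ∃ N : ℕ, n = -(N : ℤ) := ⟨n.natAbs, by omega⟩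
    exact (key N).1
  · obtain ⟨N, rfl⟩ : ∃ N : ℕ, n = (N : ℤ) + 1 := ⟨(n - 1).natAbs, by omega⟩
    exact (key N).2

theorem qSharp_neg_eq {u v : K} {n : ℤ} (hn : n ≠ 0) : qSharp u v (-n) = (qSharp u v n)⁻¹ := by
  have e : 2 * -n = -(2 * n) := by ring
  rw [qSharp, qSharp, mul_inv, e, zpow_neg]
  congr 1
  split_ifs <;> first | omega | simp

theorem qSharp_sq_of_pos {u v : K} {n : ℤ} (hn : 0 < n) :
    qSharp u v n ^ 2 = (u ^ 4) ^ n * v ^ 2 := by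
  rw [qSharp, if_pos hn, mul_pow, ← zpow_natCast (u ^ (2 * n)), ← zpow_mul, ← zpow_natCast u 4,
    ← zpow_mul]
  congr 2
  push_cast; ring

theorem qSharp_sq_of_nonpos {u v : K} {n : ℤ} (hn : n ≤ 0) :
    qSharp u v n ^ 2 = (u ^ 4) ^ n * (v ^ 2)⁻¹ := by
  rw [qSharp, if_neg (by omega), mul_pow, ← zpow_natCast (u ^ (2 * n)), ← zpow_mul,
    ← zpow_natCast u 4, ← zpow_mul, inv_pow]
  congr 2
  push_cast; ring

section Sharp

variable {u v : K} (h : Generic u v)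
include h

theorem Generic.qSharp_ne (n : ℤ) : qSharp u v n ≠ 0 := by
  have := h.v_ne
  rw [qSharp]
  refine mul_ne_zero (zpow_ne_zero _ h.u_ne) ?_
  split_ifs <;> simpa

theorem Generic.qSharp_one_sub (n : ℤ) : qSharp u v (1 - n) = u ^ 2 * (qSharp u v n)⁻¹ := by
  have e : 2 * (1 - n) = 2 + -(2 * n) := by ring
  rw [qSharp, qSharp, mul_inv, e, zpow_add₀ h.u_ne, zpow_neg, mul_assoc]
  norm_cast
  congr 2
  split_ifs <;> first | omega | simp

theorem Generic.q_zpow {n : ℤ} (hn : n ≠ 0) : (u ^ 4) ^ n ≠ 1 := by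
  rcases lt_or_gt_of_ne hn with h1 | h1
  · obtain ⟨N, rfl⟩ : ∃ N : ℕ, n = -(N : ℤ) := ⟨n.natAbs, by omega⟩
    have := h.q_pow N (by omega)
    rwa [zpow_neg, zpow_natCast, Ne, inv_eq_one]
  · obtain ⟨N, rfl⟩ : ∃ N : ℕ, n = (N : ℤ) := ⟨n.natAbs, by omega⟩
    exact_mod_cast h.q_pow N (by omega)

theorem Generic.t_zpow {n : ℤ} (hn : 0 < n) : v ^ 4 * (u ^ 4) ^ n ≠ 1 := by
  obtain ⟨N, rfl⟩ : ∃ N : ℕ, n = (N : ℤ) := ⟨n.natAbs, by omega⟩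
  exact_mod_cast h.t_pow N (by omega)

/-- If t q^j = 1 then t² q^{2j} = 1. Thus the conditions for the spherical polynomials also exclude
the poles of μ_∘. -/
theorem Generic.one_sub_t_mul_pow_ne {j : ℕ} (hj : 1 ≤ j) : 1 - v ^ 2 * (u ^ 4) ^ j ≠ 0 := by
  intro h0
  apply h.t_pow (2 * j) (by omega)
  rw [pow_mul' (u ^ 4) 2 j]
  linear_combination (-1 - v ^ 2 * (u ^ 4) ^ j) * h0

theorem Generic.qSharp_sq_sub_one_ne {n : ℤ} (hn : n ≠ 0) : qSharp u v n ^ 2 - 1 ≠ 0 := by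
  have key : ∀ m : ℤ, 0 < m → qSharp u v m ^ 2 - 1 ≠ 0 := by
    intro m hm h0
    rw [qSharp_sq_of_pos hm] at h0
    obtain ⟨N, rfl⟩ : ∃ N : ℕ, m = (N : ℤ) := ⟨m.natAbs, by omega⟩
    apply h.one_sub_t_mul_pow_ne (j := N) (by omega)
    rw [zpow_natCast] at h0
    linear_combination -h0
  rcases lt_or_gt_of_ne hn with h1 | h1
  · have h2 := key (-n) (by omega)
    rw [qSharp_neg_eq hn] at h2
    intro h3
    apply h2
    rw [inv_pow, sub_eq_zero.mp h3, inv_one, sub_self]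
  · exact key n h1

/-- Simplicity of the spectrum of Ŷ. After squaring, a coincidence of q^m t with q^n t⁻¹, m > 0 ≥ n,
means t² q^{m-n} = 1, and a coincidence on one side means q^{m-n} = 1. -/
theorem Generic.qSharp_injective : Function.Injective (qSharp u v) := by
  have hu : u ^ 4 ≠ 0 := pow_ne_zero 4 h.u_ne
  have hv := h.v_ne
  have key : ∀ m n : ℤ, 0 < m → n ≤ 0 → qSharp u v m ≠ qSharp u v n := by
    intro m n hm hn e
    have e2 := congrArg (· ^ 2) e
    simp only [qSharp_sq_of_pos hm, qSharp_sq_of_nonpos hn] at e2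
    apply h.t_zpow (n := m - n) (by omega)
    rw [zpow_sub₀ hu]
    have h3 : (u ^ 4) ^ n ≠ 0 := zpow_ne_zero _ hu
    field_simp
    field_simp at e2
    linear_combination e2
  have key2 : ∀ m n : ℤ, (u ^ 4) ^ m = (u ^ 4) ^ n → m = n := by
    intro m n e
    by_contra hne
    apply h.q_zpow (sub_ne_zero.mpr hne)
    rw [zpow_sub₀ hu, e, div_self (zpow_ne_zero _ hu)]
  intro m n e
  rcases lt_or_ge 0 m with hm | hm <;> rcases lt_or_ge 0 n with hn | hn
  · apply key2
    have e2 := congrArg (· ^ 2) e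
    simp only [qSharp_sq_of_pos hm, qSharp_sq_of_pos hn] at e2
    exact mul_right_cancel₀ (pow_ne_zero 2 hv) e2
  · exact absurd e (key m n hm hn)
  · exact absurd e.symm (key n m hn hm)
  · apply key2
    have e2 := congrArg (· ^ 2) e
    simp only [qSharp_sq_of_nonpos hm, qSharp_sq_of_nonpos hn] at e2
    exact mul_right_cancel₀ (inv_ne_zero (pow_ne_zero 2 hv)) e2

end Sharp

/-- The coefficient of `f(-z)` in `T' f(z)` at `z = n_♯`. -/
def tA (u v : K) (n : ℤ) : K :=
  -- At n = 0 the numerator vanishes, but for t = 1 so does the denominator; the value valid for t ≠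
  -- 1 is therefore imposed. The same applies to `tB`.
  if n = 0 then 0 else (v * qSharp u v n ^ 2 - v⁻¹) / (qSharp u v n ^ 2 - 1)

/-- The coefficient of `f(z)` in `T' f(z)` at `z = n_♯`. -/
def tB (u v : K) (n : ℤ) : K :=
  if n = 0 then v else -((v - v⁻¹) / (qSharp u v n ^ 2 - 1))

@[simp] theorem tA_zero (u v : K) : tA u v 0 = 0 := if_pos rfl

@[simp] theorem tB_zero (u v : K) : tB u v 0 = v := if_pos rfl

theorem qSharp_at_zero (u v : K) : qSharp u v 0 = v⁻¹ := by simp [qSharp]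

theorem tOp_one (v : K) : tOp v 1 = v • (1 : K[T;T⁻¹]) := by
  rw [← LaurentPolynomial.T_zero, tOp_apply, sOp_T, divDiff, ofMonomials_T, neg_zero]
  simp [divDiffMonomial]

theorem piOp_one (u : K) : piOp u 1 = (1 : K[T;T⁻¹]) := by
  rw [← LaurentPolynomial.T_zero, piOp_T]
  simp

theorem yOp_one (u v : K) : yOp u v 1 = (qSharp u v 0)⁻¹ • (1 : K[T;T⁻¹]) := by
  rw [yOp_eq, tOp_one, map_smul, piOp_one, qSharp_at_zero, inv_inv]

section Relations

variable {u v : K} (h : Generic u v)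
include h

/-- The numerator is v⁻¹(t² q^n - 1) for n > 0 and v⁻¹(q^n - 1) for n < 0, so both halves of
`Generic` are needed. -/
theorem Generic.tA_ne {n : ℤ} (hn : n ≠ 0) : tA u v n ≠ 0 := by
  have hv := h.v_ne
  rw [tA, if_neg hn]
  refine div_ne_zero (fun h0 => ?_) (h.qSharp_sq_sub_one_ne hn)
  rcases lt_or_gt_of_ne hn with h1 | h1
  · rw [qSharp_sq_of_nonpos h1.le] at h0
    apply h.q_zpow hn
    field_simp at h0
    linear_combination h0
  · rw [qSharp_sq_of_pos h1] at h0
    apply h.t_zpow h1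
    field_simp at h0
    linear_combination h0

/-- `A_n + B_n = t^{1/2}`. -/
theorem Generic.tA_add_tB (n : ℤ) : tA u v n + tB u v n = v := by
  rcases eq_or_ne n 0 with rfl | hn
  · simp
  · have := h.qSharp_sq_sub_one_ne hn
    rw [tA, tB, if_neg hn, if_neg hn]
    generalize v⁻¹ = v'
    field_simp
    ring

theorem Generic.sub_tB (n : ℤ) : v - tB u v n = tA u v n :=
  sub_eq_of_eq_add (h.tA_add_tB n).symm

theorem Generic.sq_mul_tB (n : ℤ) : qSharp u v n ^ 2 * tB u v n = tB u v n - (v - v⁻¹) := by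
  rcases eq_or_ne n 0 with rfl | hn
  · have hv := h.v_ne
    rw [qSharp_at_zero, tB_zero]
    field_simp
    ring
  · have := h.qSharp_sq_sub_one_ne hn
    rw [tB, if_neg hn]
    generalize v - v⁻¹ = c
    field_simp
    ring

/-- Taking values at the points m_♯ maps T̂ to T'. The set of these points is not stable under s,
since k/2 is missing; this is harmless because A_0 = 0. -/
theorem Generic.evalAt_tOp_sharp (m : ℤ) (f : K[T;T⁻¹]) :
    evalAt (qSharp u v m) (tOp v f)
      = tA u v m * evalAt (qSharp u v (-m)) f + tB u v m * evalAt (qSharp u v m) f := by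
  rcases eq_or_ne m 0 with rfl | hm
  · rw [tA_zero, tB_zero, qSharp_at_zero, evalAt_tOp_inv h.v_ne, zero_mul, zero_add]
  · rw [evalAt_tOp v (h.qSharp_ne m) (h.qSharp_sq_sub_one_ne hm), tA, tB, if_neg hm, if_neg hm,
      qSharp_neg_eq hm]

theorem Generic.evalAt_piOp_sharp (m : ℤ) (f : K[T;T⁻¹]) :
    evalAt (qSharp u v m) (piOp u f) = evalAt (qSharp u v (1 - m)) f := by
  rw [evalAt_piOp, h.qSharp_one_sub]

theorem Generic.piOp_of_eigen {n : ℤ} {f : K[T;T⁻¹]}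
    (hf : yOp u v f = (qSharp u v n)⁻¹ • f) : piOp u f = qSharp u v n • tOp v f := by
  have h0 := h.qSharp_ne n
  have h1 := congrArg (piOp u) hf
  rw [yOp_eq, piOp_piOp h.u_ne, map_smul] at h1
  rw [h1, smul_smul, mul_inv_cancel₀ h0, one_smul]

/-- X T̂ is the affine intertwiner: T̂XT̂ = X⁻¹ gives Ŷ(X T̂ f) = π(X⁻¹f), and the eigenvalue
equation reads πf = q^{n_♯} T̂ f. -/
theorem Generic.eigen_one_sub {n : ℤ} {f : K[T;T⁻¹]}
    (hf : yOp u v f = (qSharp u v n)⁻¹ • f) :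
    yOp u v (T 1 * tOp v f) = (qSharp u v (1 - n))⁻¹ • (T 1 * tOp v f) := by
  rw [yOp_eq, tOp_X_tOp' h.v_ne, piOp_mul h.u_ne, h.piOp_of_eigen hf, piOp_T, h.qSharp_one_sub,
    smul_mul_smul_comm, neg_neg, mul_inv, inv_inv, zpow_neg_one]

/-- T̂ - B_n is the nonaffine intertwiner. On the span of f and T̂f the operator Ŷ is triangular,
and `Generic.sq_mul_tB` is the condition on B_n for the f-component to match. -/
theorem Generic.eigen_neg {n : ℤ} (hn : n ≠ 0) {f : K[T;T⁻¹]}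
    (hf : yOp u v f = (qSharp u v n)⁻¹ • f) :
    yOp u v (tOp v f - tB u v n • f) = (qSharp u v (-n))⁻¹ • (tOp v f - tB u v n • f) := by
  have h0 := h.qSharp_ne n
  have h1 := h.sq_mul_tB n
  have h2 : yOp u v (tOp v f) = (v - v⁻¹) • (qSharp u v n)⁻¹ • f + qSharp u v n • tOp v f := by
    rw [yOp_eq, tOp_tOp h.v_ne, map_add, map_smul, h.piOp_of_eigen hf, ← yOp_eq, hf]
  rw [map_sub, map_smul, hf, h2, qSharp_neg_eq hn, inv_inv]
  match_scalars
  · generalize v⁻¹ = v' at *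
    field_simp
    linear_combination h1
  · ring

/-- The value at -k/2 is carried along the chain: X T̂ multiplies it by v⁻¹v = 1, and T̂ - B_n by v
- B_n = A_n ≠ 0. This is where e_n(-k/2) ≠ 0 comes from. -/
theorem Generic.exists_eigen (n : ℤ) : ∃ f : K[T;T⁻¹],
    yOp u v f = (qSharp u v n)⁻¹ • f ∧ evalAt v⁻¹ f = 1 := by
  have hv := h.v_ne
  induction n using sharp_induction with
  | h0 =>
    exact ⟨1, yOp_one u v, evalAt_one _⟩
  | h1 n hn ih =>
    obtain ⟨f, hf, he⟩ := ih
    refine ⟨T 1 * tOp v f, h.eigen_one_sub hf, ?_⟩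
    rw [evalAt_mul (inv_ne_zero hv), evalAt_tOp_inv hv, he, evalAt_T, zpow_one]
    field_simp
  | h2 n hn ih =>
    obtain ⟨f, hf, he⟩ := ih
    have hA := h.tA_ne hn.ne'
    refine ⟨(tA u v n)⁻¹ • (tOp v f - tB u v n • f), ?_, ?_⟩
    · rw [map_smul, h.eigen_neg hn.ne' hf, smul_comm]
    · rw [evalAt_smul, evalAt_sub, evalAt_smul, evalAt_tOp_inv hv, he, mul_one, mul_one,
        h.sub_tB, inv_mul_cancel₀ hA]

end Relations

/-! ### Triangularity of `Ŷ` -/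

/-- The position of `n` in the sequence `0, 1, -1, 2, -2, …`. -/
def sharpRank (n : ℤ) : ℤ := if 0 < n then 2 * n - 1 else -2 * n

theorem functional_coeff (m : ℤ) (f : K[T;T⁻¹]) :
    functional (fun n => if n = m then 1 else 0) f = f.coeff m := by
  rw [functional_apply, Finsupp.sum]
  simp only [mul_ite, mul_one, mul_zero, Finset.sum_ite_eq', Finsupp.mem_support_iff]
  split_ifs with h
  · rfl
  · exact (Finsupp.notMem_support_iff.mp h).symm

theorem coeff_apply (A : K[T;T⁻¹] →ₗ[K] K[T;T⁻¹]) (m : ℤ) (f : K[T;T⁻¹]) :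
    (A f).coeff m = f.coeff.sum fun j a => a * (A (T j)).coeff m := by
  have : functional (fun n => if n = m then 1 else 0) ∘ₗ A
      = functional fun j => (A (T j)).coeff m :=
    laurent_ext fun n => by
      rw [LinearMap.comp_apply, functional_coeff, functional_T]
  rw [← functional_coeff, ← functional_apply, ← this]
  rfl

theorem coeff_piOp (u : K) (f : K[T;T⁻¹]) (m : ℤ) :
    (piOp u f).coeff m = (u ^ 2) ^ (-m) * f.coeff (-m) := by
  have : functional (fun n => if n = m then 1 else 0) ∘ₗ piOp u
      = (u ^ 2) ^ (-m) • functional fun n => if n = -m then 1 else 0 :=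
    laurent_ext fun n => by
      rw [LinearMap.comp_apply, piOp_T, map_smul, functional_T, LinearMap.smul_apply, functional_T]
      rcases eq_or_ne n (-m) with rfl | hn
      · simp
      · rw [if_neg hn, if_neg (by omega), smul_zero, smul_zero]
  rw [← functional_coeff, ← functional_coeff, ← smul_eq_mul, ← LinearMap.smul_apply, ← this]
  rfl

theorem coeff_sum_T (s : Finset ℕ) (w : ℕ → ℤ) (m : ℤ) :
    (∑ i ∈ s, (T (w i) : K[T;T⁻¹])).coeff m = ∑ i ∈ s, if w i = m then 1 else 0 := by
  rw [← functional_coeff, map_sum]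
  simp

theorem coeff_divDiffMonomial {m j : ℤ} (hj : sharpRank m ≤ sharpRank j) :
    (divDiffMonomial m : K[T;T⁻¹]).coeff (-j) = if j = m ∧ 0 < m then -1 else 0 := by
  cases m with
  | ofNat n =>
    rw [divDiffMonomial, AddMonoidAlgebra.coeff_neg, Finsupp.neg_apply, coeff_sum_T]
    simp only [sharpRank, Int.ofNat_eq_natCast] at hj ⊢
    split_ifs with h
    · rw [Finset.sum_eq_single 0]
      · rw [if_pos (by omega)]
      · intro i _ hi
        rw [if_neg (by omega)]
      · intro h0
        exact absurd (Finset.mem_range.mpr (by omega)) h0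
    · rw [Finset.sum_eq_zero, neg_zero]
      intro i hi
      rw [Finset.mem_range] at hi
      rw [if_neg]
      split_ifs at hj <;> omega
  | negSucc n =>
    rw [divDiffMonomial, coeff_sum_T, if_neg (by omega)]
    refine Finset.sum_eq_zero fun i hi => ?_
    rw [Finset.mem_range] at hi
    rw [if_neg]
    simp only [sharpRank] at hj
    split_ifs at hj <;> omega

/-- Ŷ is triangular for the order 0, 1, -1, 2, -2, …. On the diagonal s contributes t^{1/2}; for m >
0 the divided difference also contains X^{-m}, which changes this to t^{-1/2}. Hence the sign of k
in m_♯. -/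
theorem coeff_yOp_T {u v : K} (h : Generic u v) {m j : ℤ} (hj : sharpRank m ≤ sharpRank j) :
    (yOp u v (T m)).coeff j = if m = j then (qSharp u v m)⁻¹ else 0 := by
  have hu := h.u_ne
  have e : (u ^ 2) ^ (-j) = u ^ (-(2 * j)) := by
    rw [← zpow_natCast u 2, ← zpow_mul]; congr 1; push_cast; ring
  rw [yOp_eq, coeff_piOp, tOp_apply, sOp_T, divDiff, ofMonomials_T, AddMonoidAlgebra.coeff_add,
    AddMonoidAlgebra.coeff_smul, AddMonoidAlgebra.coeff_smul, Finsupp.add_apply,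
    Finsupp.smul_apply, Finsupp.smul_apply, coeff_divDiffMonomial hj, LaurentPolynomial.T_apply]
  rcases eq_or_ne m j with rfl | hm
  · rw [if_pos rfl, if_pos rfl, qSharp, mul_inv, e, zpow_neg]
    split_ifs <;> first | omega | simp
  · rw [if_neg (by omega), if_neg (by tauto), if_neg hm]
    simp

/-- Comparing the coefficients of Ŷf at the highest monomial X^m of f, the eigenvalue is the
diagonal entry at m; the spectrum is simple, so m = n. -/
theorem eigen_coeff {u v : K} (h : Generic u v) {n : ℤ} {f : K[T;T⁻¹]} (hf0 : f ≠ 0)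
    (hf : yOp u v f = (qSharp u v n)⁻¹ • f) :
    f.coeff n ≠ 0 ∧ ∀ j, sharpRank n < sharpRank j → f.coeff j = 0 := by
  have hne : f.coeff.support.Nonempty := by
    rw [Finsupp.support_nonempty_iff]
    intro h0
    exact hf0 (LaurentPolynomial.ext fun a => by rw [h0]; rfl)
  obtain ⟨m, hm, hmax⟩ := Finset.exists_max_image f.coeff.support sharpRank hne
  have hfm := Finsupp.mem_support_iff.mp hm
  have h1 := congrArg (fun g : K[T;T⁻¹] => g.coeff m) hf
  simp only [coeff_apply (yOp u v) m f, AddMonoidAlgebra.coeff_smul, Finsupp.smul_apply,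
    smul_eq_mul] at h1
  rw [Finsupp.sum, Finset.sum_congr rfl fun j hj => by rw [coeff_yOp_T h (hmax j hj)]] at h1
  simp only [mul_ite, mul_zero, Finset.sum_ite_eq', if_pos hm] at h1
  have h2 : m = n := by
    rw [mul_comm] at h1
    exact h.qSharp_injective (inv_injective (mul_right_cancel₀ hfm h1))
  subst h2
  refine ⟨hfm, fun j hj => ?_⟩
  by_contra hc
  exact absurd (hmax j (Finsupp.mem_support_iff.mpr hc)) (not_le.mpr hj)

theorem eigen_unique {u v : K} (h : Generic u v) {n : ℤ} {f g : K[T;T⁻¹]}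
    (hf : yOp u v f = (qSharp u v n)⁻¹ • f) (hg : yOp u v g = (qSharp u v n)⁻¹ • g)
    (hc : f.coeff n = g.coeff n) : f = g := by
  by_contra hne
  refine (eigen_coeff h (sub_ne_zero.mpr hne) (n := n) ?_).1 ?_
  · rw [map_sub, hf, hg, smul_sub]
  · rw [AddMonoidAlgebra.coeff_sub, Finsupp.sub_apply, hc, sub_self]

section Spherical

variable {u v : K} (h : Generic u v)
include h

/-- The monomials forbidden in e_n, including X^{-n} for n > 0, all lie above X^n in the order of
`sharpRank`, so every nonzero eigenvector has the required shape up to scaling. -/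
theorem Generic.isMacdonald_of_eigen {n : ℤ} {f : K[T;T⁻¹]} (hf0 : f ≠ 0)
    (hf : yOp u v f = (qSharp u v n)⁻¹ • f) : IsMacdonald u v n ((f.coeff n)⁻¹ • f) := by
  obtain ⟨h1, h2⟩ := eigen_coeff h hf0 hf
  have h3 : ∀ j, sharpRank n < sharpRank j → ((f.coeff n)⁻¹ • f).coeff j = 0 := fun j hj => by
    rw [AddMonoidAlgebra.coeff_smul, Finsupp.smul_apply, h2 j hj, smul_zero]
  refine ⟨by rw [map_smul, hf, smul_comm], fun m hm => h3 m ?_, ?_, fun hn => h3 _ ?_⟩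
  · simp only [sharpRank]
    rw [abs_lt] at hm
    rcases abs_cases m with h4 | h4 <;> split_ifs <;> omega
  · rw [AddMonoidAlgebra.coeff_smul, Finsupp.smul_apply, smul_eq_mul, inv_mul_cancel₀ h1]
  · simp only [sharpRank]
    split_ifs <;> omega

theorem Generic.existsUnique_isMacdonald (n : ℤ) : ∃! e, IsMacdonald u v n e := by
  obtain ⟨f, hf, he⟩ := h.exists_eigen n
  have hf0 : f ≠ 0 := by rintro rfl; simp [evalAt] at he
  exact ⟨_, h.isMacdonald_of_eigen hf0 hf, fun g hg =>
    eigen_unique h hg.eigen (h.isMacdonald_of_eigen hf0 hf).eigen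
      (hg.leading.trans (h.isMacdonald_of_eigen hf0 hf).leading.symm)⟩

theorem Generic.isMacdonald_ePoly (n : ℤ) : IsMacdonald u v n (ePoly u v n) := by
  have := (h.existsUnique_isMacdonald n).exists
  rw [ePoly, dif_pos this]
  exact this.choose_spec

theorem Generic.evalAt_ePoly_ne (n : ℤ) : evalAt v⁻¹ (ePoly u v n) ≠ 0 := by
  obtain ⟨f, hf, he⟩ := h.exists_eigen n
  have hf0 : f ≠ 0 := by rintro rfl; simp [evalAt] at he
  rw [(h.existsUnique_isMacdonald n).unique (h.isMacdonald_ePoly n)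
    (h.isMacdonald_of_eigen hf0 hf), evalAt_smul, he, mul_one]
  exact inv_ne_zero (eigen_coeff h hf0 hf).1

theorem Generic.sphericalDefined : SphericalDefined u v := fun n =>
  ⟨h.existsUnique_isMacdonald n, h.evalAt_ePoly_ne n⟩

theorem Generic.yOp_epsPoly (n : ℤ) :
    yOp u v (epsPoly u v n) = (qSharp u v n)⁻¹ • epsPoly u v n := by
  rw [epsPoly, map_smul, (h.isMacdonald_ePoly n).eigen, smul_comm]

theorem Generic.evalAt_epsPoly (n : ℤ) : evalAt v⁻¹ (epsPoly u v n) = 1 := by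
  rw [epsPoly, evalAt_smul, inv_mul_cancel₀ (h.evalAt_ePoly_ne n)]

/-- The eigenspace is a line, and the value at -k/2 is a coordinate on it. Identities between the
ε_n are thereby reduced to evaluation at one point. -/
theorem Generic.eq_smul_epsPoly {n : ℤ} {f : K[T;T⁻¹]}
    (hf : yOp u v f = (qSharp u v n)⁻¹ • f) : f = evalAt v⁻¹ f • epsPoly u v n := by
  have hc := (h.isMacdonald_ePoly n).leading
  have key : f = f.coeff n • ePoly u v n := by
    refine eigen_unique h hf ?_ ?_
    · rw [map_smul, (h.isMacdonald_ePoly n).eigen, smul_comm]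
    · rw [AddMonoidAlgebra.coeff_smul, Finsupp.smul_apply, hc, smul_eq_mul, mul_one]
  have h2 := congrArg (evalAt v⁻¹) key
  rw [evalAt_smul] at h2
  rw [h2, epsPoly, smul_smul, mul_assoc, mul_inv_cancel₀ (h.evalAt_ePoly_ne n), mul_one]
  exact key

theorem Generic.epsPoly_zero : epsPoly u v 0 = 1 := by
  have := h.eq_smul_epsPoly (yOp_one u v)
  rw [evalAt_one, one_smul] at this
  exact this.symm

/-- `X T̂ ε_n = ε_{1-n}`. -/
theorem Generic.X_mul_tOp_epsPoly (n : ℤ) : T 1 * tOp v (epsPoly u v n) = epsPoly u v (1 - n) := by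
  have hv := h.v_ne
  rw [h.eq_smul_epsPoly (h.eigen_one_sub (h.yOp_epsPoly n)), evalAt_mul (inv_ne_zero hv),
    evalAt_tOp_inv hv, h.evalAt_epsPoly, evalAt_T, zpow_one, mul_one, inv_mul_cancel₀ hv, one_smul]

theorem Generic.piOp_epsPoly (n : ℤ) :
    piOp u (epsPoly u v n) = qSharp u v n • tOp v (epsPoly u v n) :=
  h.piOp_of_eigen (h.yOp_epsPoly n)

/-- The source of duality: T̂ acts on the index with the coefficients of T' at n_♯. By
`Generic.eigen_neg`, T̂ε_n - B_n ε_n is a multiple of ε_{-n}, and its value at -k/2 is v - B_n =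
A_n. -/
theorem Generic.tOp_epsPoly (n : ℤ) : tOp v (epsPoly u v n)
    = tA u v n • epsPoly u v (-n) + tB u v n • epsPoly u v n := by
  have hv := h.v_ne
  rcases eq_or_ne n 0 with rfl | hn
  · have : tOp v (T 0 : K[T;T⁻¹]) = v • T 0 := by
      rw [tOp_apply, sOp_T, divDiff, ofMonomials_T, neg_zero]
      simp [divDiffMonomial]
    rw [LaurentPolynomial.T_zero] at this
    rw [h.epsPoly_zero, this, tA_zero, tB_zero, zero_smul, zero_add]
  · rw [← sub_eq_iff_eq_add,
      h.eq_smul_epsPoly (h.eigen_neg hn (h.yOp_epsPoly n)), evalAt_sub, evalAt_smul,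
      evalAt_tOp_inv hv, h.evalAt_epsPoly, mul_one, mul_one, h.sub_tB]

end Spherical

end Eigenvectors

/-! ## The coefficients of `μ` -/

section BivariateSeries

variable {A : Type*} [CommRing A]

/-- The multi-index of `q^a t^b`. -/
def bidegree (a b : ℕ) : Fin 2 →₀ ℕ := Finsupp.single 0 a + Finsupp.single 1 b

theorem bidegree_zero (a b : ℕ) : bidegree a b 0 = a := by simp [bidegree]

theorem bidegree_one (a b : ℕ) : bidegree a b 1 = b := by simp [bidegree]

theorem bidegree_eta (n : Fin 2 →₀ ℕ) : bidegree (n 0) (n 1) = n := by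
  ext i
  fin_cases i
  · exact bidegree_zero _ _
  · exact bidegree_one _ _

/-- The coefficient of `q^a t^b` for integral `a`, `b` (zero if one of them is negative). -/
def intCoeff (F : MvPowerSeries (Fin 2) A) (a b : ℤ) : A :=
  if 0 ≤ a ∧ 0 ≤ b then MvPowerSeries.coeff (bidegree a.toNat b.toNat) F else 0

theorem intCoeff_ext {F G : MvPowerSeries (Fin 2) A} (h : ∀ a b, intCoeff F a b = intCoeff G a b) :
    F = G := by
  ext n
  have := h (n 0) (n 1)
  simpa [intCoeff, bidegree_eta] using this

theorem intCoeff_of_neg_left (F : MvPowerSeries (Fin 2) A) {a : ℤ} (ha : a < 0) (b : ℤ) :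
    intCoeff F a b = 0 := if_neg fun h => absurd h.1 (not_le.mpr ha)

theorem intCoeff_of_neg_right (F : MvPowerSeries (Fin 2) A) (a : ℤ) {b : ℤ} (hb : b < 0) :
    intCoeff F a b = 0 := if_neg fun h => absurd h.2 (not_le.mpr hb)

@[simp] theorem intCoeff_add (F G : MvPowerSeries (Fin 2) A) (a b : ℤ) :
    intCoeff (F + G) a b = intCoeff F a b + intCoeff G a b := by
  simp only [intCoeff]
  split_ifs <;> simp

@[simp] theorem intCoeff_sub (F G : MvPowerSeries (Fin 2) A) (a b : ℤ) :
    intCoeff (F - G) a b = intCoeff F a b - intCoeff G a b := by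
  simp only [intCoeff]
  split_ifs <;> simp

theorem intCoeff_C_mul (c : A) (F : MvPowerSeries (Fin 2) A) (a b : ℤ) :
    intCoeff (MvPowerSeries.C c * F) a b = c * intCoeff F a b := by
  simp only [intCoeff]
  split_ifs
  · rw [MvPowerSeries.coeff_C_mul]
  · rw [mul_zero]

/-- Integer indices with value zero at negative ones make multiplication by a monomial a plain
shift, without case distinctions in the recursions below. -/
theorem intCoeff_X_pow_mul (i l : ℕ) (F : MvPowerSeries (Fin 2) A) (a b : ℤ) :
    intCoeff (MvPowerSeries.X 0 ^ i * MvPowerSeries.X 1 ^ l * F) a b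
      = intCoeff F (a - i) (b - l) := by
  have e : (MvPowerSeries.X 0 ^ i * MvPowerSeries.X 1 ^ l : MvPowerSeries (Fin 2) A)
      = MvPowerSeries.monomial (bidegree i l) 1 := by
    rw [MvPowerSeries.X_pow_eq, MvPowerSeries.X_pow_eq, MvPowerSeries.monomial_mul_monomial,
      one_mul, bidegree]
  rw [e]
  simp only [intCoeff, MvPowerSeries.coeff_monomial_mul, one_mul]
  have hle : ∀ c d : ℕ, bidegree i l ≤ bidegree c d ↔ i ≤ c ∧ l ≤ d := by
    intro c d
    constructor
    · intro h
      exact ⟨by simpa [bidegree_zero] using h 0, by simpa [bidegree_one] using h 1⟩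
    · rintro ⟨h1, h2⟩ x
      fin_cases x
      · simpa [bidegree_zero] using h1
      · simpa [bidegree_one] using h2
  rcases Classical.em (0 ≤ a - i ∧ 0 ≤ b - l) with h | h
  · rw [if_pos h, if_pos (by omega), if_pos ((hle _ _).mpr (by omega))]
    congr 2
    have hs : bidegree (a - i).toNat (b - l).toNat + bidegree i l
        = bidegree a.toNat b.toNat := by
      ext x
      fin_cases x
      · simp only [Fin.zero_eta, Finsupp.add_apply, bidegree_zero]; omega
      · simp only [Fin.mk_one, Finsupp.add_apply, bidegree_one]; omega
    rw [← hs, add_tsub_cancel_right]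
  · rw [if_neg h]
    split_ifs with h1 h2
    · rw [hle] at h2; omega
    · rfl
    · rfl

end BivariateSeries

/-! ### The functional equation of `μ` and the recursion for its coefficients. -/

section MuRecursion

theorem coeff_T_mul (k : ℤ) (f : ℤ[T;T⁻¹]) (m : ℤ) : (T k * f).coeff m = f.coeff (m - k) := by
  rw [LaurentPolynomial.T, AddMonoidAlgebra.coeff_single_mul_apply, one_mul, sub_eq_neg_add]

/-- The coefficient of `q^a t^b X^m`. -/
def muIdx (F : MvPowerSeries (Fin 2) ℤ[T;T⁻¹]) (a b m : ℤ) : ℤ := (intCoeff F a b).coeff m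

theorem muIdx_sub (F G : MvPowerSeries (Fin 2) ℤ[T;T⁻¹]) (a b m : ℤ) :
    muIdx (F - G) a b m = muIdx F a b m - muIdx G a b m := by
  simp [muIdx]

theorem muIdx_add (F G : MvPowerSeries (Fin 2) ℤ[T;T⁻¹]) (a b m : ℤ) :
    muIdx (F + G) a b m = muIdx F a b m + muIdx G a b m := by
  simp [muIdx]

theorem muIdx_monomial_mul (i l : ℕ) (k : ℤ) (F : MvPowerSeries (Fin 2) ℤ[T;T⁻¹]) (a b m : ℤ) :
    muIdx (qVar ^ i * tVar ^ l * xVar k * F) a b m = muIdx F (a - i) (b - l) (m - k) := by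
  rw [mul_assoc, muIdx, qVar, tVar, intCoeff_X_pow_mul, xVar, intCoeff_C_mul, coeff_T_mul, muIdx]

theorem muIdx_of_neg (F : MvPowerSeries (Fin 2) ℤ[T;T⁻¹]) (a : ℤ) {b : ℤ} (hb : b < 0) (m : ℤ) :
    muIdx F a b m = 0 := by
  rw [muIdx, intCoeff_of_neg_right F a hb]; rfl

theorem muIdx_one_sub (i l : ℕ) (k : ℤ) (F : MvPowerSeries (Fin 2) ℤ[T;T⁻¹]) (a b m : ℤ) :
    muIdx ((1 - qVar ^ i * tVar ^ l * xVar k) * F) a b m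
      = muIdx F a b m - muIdx F (a - i) (b - l) (m - k) := by
  rw [sub_mul, one_mul, muIdx_sub, muIdx_monomial_mul]

/-- `G(X²) = F(q X²)` on the even part, where both are series in `q`, `t`. -/
def IsShift (F G : MvPowerSeries (Fin 2) ℤ[T;T⁻¹]) : Prop :=
  ∀ a b m : ℤ, muIdx G (a + m) b (2 * m) = muIdx F a b (2 * m)

/-- Under X² ↦ qX² the factor 1 - q^i t^l X^{2k} becomes 1 - q^{i+k} t^l X^{2k}. The substitution
may create negative powers of q, so it is treated as a relation between coefficients and not as a
map. -/
theorem IsShift.mul {F G : MvPowerSeries (Fin 2) ℤ[T;T⁻¹]} (h : IsShift F G) (i i' l : ℕ) (k : ℤ)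
    (hi : (i' : ℤ) = i + k) : IsShift ((1 - qVar ^ i * tVar ^ l * xVar (2 * k)) * F)
      ((1 - qVar ^ i' * tVar ^ l * xVar (2 * k)) * G) := by
  intro a b m
  have h2 := h (a - i) (b - l) (m - k)
  have e : a - i + (m - k) = a + m - i' := by rw [hi]; ring
  rw [e] at h2
  rw [muIdx_one_sub, muIdx_one_sub, h, ← mul_sub, h2]

/-- Division by a factor which is 1 modulo t: the coefficients are recovered by induction on the
degree in t. -/
theorem IsShift.of_mul {F G : MvPowerSeries (Fin 2) ℤ[T;T⁻¹]} (i i' : ℕ) (k : ℤ)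
    (hi : (i' : ℤ) = i + k) (h : IsShift ((1 - qVar ^ i * tVar ^ 1 * xVar (2 * k)) * F)
      ((1 - qVar ^ i' * tVar ^ 1 * xVar (2 * k)) * G)) : IsShift F G := by
  have key : ∀ N : ℕ, ∀ a b m : ℤ, b < N →
      muIdx G (a + m) b (2 * m) = muIdx F a b (2 * m) := by
    intro N
    induction N with
    | zero =>
      intro a b m hb
      rw [muIdx_of_neg _ _ (by simpa using hb), muIdx_of_neg _ _ (by simpa using hb)]
    | succ N ih =>
      intro a b m hb
      have h1 := h a b m
      rw [muIdx_one_sub, muIdx_one_sub, ← mul_sub] at h1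
      have h2 := ih (a - i) (b - (1 : ℕ)) (m - k) (by push_cast at hb ⊢; omega)
      have e : a - i + (m - k) = a + m - i' := by rw [hi]; ring
      rw [e] at h2
      linarith
  intro a b m
  exact key (b.toNat + 1) a b m (by omega)

/-- The series has no odd powers of `X`. -/
def IsEvenSeries (F : MvPowerSeries (Fin 2) ℤ[T;T⁻¹]) : Prop :=
  ∀ a b m : ℤ, muIdx F a b (2 * m + 1) = 0

theorem IsEvenSeries.mul {F : MvPowerSeries (Fin 2) ℤ[T;T⁻¹]} (h : IsEvenSeries F) (i l : ℕ)
    (k : ℤ) : IsEvenSeries ((1 - qVar ^ i * tVar ^ l * xVar (2 * k)) * F) := by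
  intro a b m
  rw [muIdx_one_sub, h, show 2 * m + 1 - 2 * k = 2 * (m - k) + 1 by ring, h, sub_zero]

theorem IsEvenSeries.of_mul {F : MvPowerSeries (Fin 2) ℤ[T;T⁻¹]} (i : ℕ) (k : ℤ)
    (h : IsEvenSeries ((1 - qVar ^ i * tVar ^ 1 * xVar (2 * k)) * F)) : IsEvenSeries F := by
  have key : ∀ N : ℕ, ∀ a b m : ℤ, b < N → muIdx F a b (2 * m + 1) = 0 := by
    intro N
    induction N with
    | zero =>
      intro a b m hb
      rw [muIdx_of_neg _ _ (by simpa using hb)]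
    | succ N ih =>
      intro a b m hb
      have h1 := h a b m
      rw [muIdx_one_sub, show 2 * m + 1 - 2 * k = 2 * (m - k) + 1 by ring,
        ih (a - i) (b - (1 : ℕ)) (m - k) (by push_cast at hb ⊢; omega), sub_zero] at h1
      exact h1
  intro a b m
  exact key (b.toNat + 1) a b m (by omega)

theorem one_sub_mul_invOfUnit {w : MvPowerSeries (Fin 2) ℤ[T;T⁻¹]}
    (hw : MvPowerSeries.constantCoeff w = 0) : (1 - w) * MvPowerSeries.invOfUnit (1 - w) 1 = 1 :=
  MvPowerSeries.mul_invOfUnit (1 - w) 1 (by simp [hw])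

theorem constantCoeff_t_mul (i : ℕ) (k : ℤ) :
    MvPowerSeries.constantCoeff (qVar ^ i * tVar * xVar k) = 0 := by
  simp [tVar, MvPowerSeries.constantCoeff_X]

/-- The factor with its denominators cleared; the exponents t^1, t^0 and 2·(±1) are spelled out to
match `IsShift.mul` and `IsEvenSeries.mul`. -/
theorem muFactor_mul (j : ℕ) :
    (1 - qVar ^ j * tVar ^ 1 * xVar (2 * 1)) *
      ((1 - qVar ^ (j + 1) * tVar ^ 1 * xVar (2 * (-1))) * muFactor j)
      = (1 - qVar ^ j * tVar ^ 0 * xVar (2 * 1)) *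
        ((1 - qVar ^ (j + 1) * tVar ^ 0 * xVar (2 * (-1))) * 1) := by
  have h1 := one_sub_mul_invOfUnit (constantCoeff_t_mul j 2)
  have h2 := one_sub_mul_invOfUnit (constantCoeff_t_mul (j + 1) (-2))
  rw [muFactor, mul_one (2 : ℤ), show (2 : ℤ) * -1 = -2 by norm_num, pow_one, pow_zero]
  linear_combination (1 - qVar ^ j * xVar 2) * (1 - qVar ^ (j + 1) * xVar (-2)) *
    ((1 - qVar ^ (j + 1) * tVar * xVar (-2)) *
      MvPowerSeries.invOfUnit (1 - qVar ^ (j + 1) * tVar * xVar (-2)) 1 * h1 + h2)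

/-- The result of `X² ↦ q X²` in the `j`-th factor of `μ`. -/
def muFactorShift (j : ℕ) : MvPowerSeries (Fin 2) ℤ[T;T⁻¹] :=
  (1 - qVar ^ (j + 1) * xVar 2) * (1 - qVar ^ j * xVar (-2)) *
    MvPowerSeries.invOfUnit (1 - qVar ^ (j + 1) * tVar * xVar 2) 1 *
    MvPowerSeries.invOfUnit (1 - qVar ^ j * tVar * xVar (-2)) 1

theorem muFactorShift_mul (j : ℕ) :
    (1 - qVar ^ (j + 1) * tVar ^ 1 * xVar (2 * 1)) *
      ((1 - qVar ^ j * tVar ^ 1 * xVar (2 * (-1))) * muFactorShift j)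
      = (1 - qVar ^ (j + 1) * tVar ^ 0 * xVar (2 * 1)) *
        ((1 - qVar ^ j * tVar ^ 0 * xVar (2 * (-1))) * 1) := by
  have h1 := one_sub_mul_invOfUnit (constantCoeff_t_mul (j + 1) 2)
  have h2 := one_sub_mul_invOfUnit (constantCoeff_t_mul j (-2))
  rw [muFactorShift, mul_one (2 : ℤ), show (2 : ℤ) * -1 = -2 by norm_num, pow_one, pow_zero]
  linear_combination (1 - qVar ^ (j + 1) * xVar 2) * (1 - qVar ^ j * xVar (-2)) *
    ((1 - qVar ^ j * tVar * xVar (-2)) *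
      MvPowerSeries.invOfUnit (1 - qVar ^ j * tVar * xVar (-2)) 1 * h1 + h2)

theorem isShift_prod (N : ℕ) :
    IsShift (∏ j ∈ Finset.range N, muFactor j) (∏ j ∈ Finset.range N, muFactorShift j) := by
  induction N with
  | zero =>
    intro a b m
    simp only [Finset.range_zero, Finset.prod_empty]
    rcases eq_or_ne m 0 with rfl | hm
    · simp
    · have : ∀ a b : ℤ, muIdx 1 a b (2 * m) = 0 := by
        intro a b
        simp only [muIdx, intCoeff]
        split_ifs
        · rw [MvPowerSeries.coeff_one]
          split_ifs
          · rw [← LaurentPolynomial.T_zero, LaurentPolynomial.T_apply, if_neg (by omega)]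
          · rfl
        · rfl
      rw [this, this]
  | succ N ih =>
    rw [Finset.prod_range_succ, Finset.prod_range_succ]
    refine IsShift.of_mul (N + 1) N (-1) (by push_cast; ring)
      (IsShift.of_mul N (N + 1) 1 (by push_cast; ring) ?_)
    have h1 := muFactor_mul N
    have h2 := muFactorShift_mul N
    have h3 := (ih.mul (N + 1) N 0 (-1) (by push_cast; ring)).mul N (N + 1) 0 1 (by push_cast; ring)
    convert h3 using 1
    · linear_combination (∏ j ∈ Finset.range N, muFactor j) * h1
    · linear_combination (∏ j ∈ Finset.range N, muFactorShift j) * h2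

theorem isEvenSeries_prod (N : ℕ) : IsEvenSeries (∏ j ∈ Finset.range N, muFactor j) := by
  induction N with
  | zero =>
    intro a b m
    simp only [Finset.range_zero, Finset.prod_empty, muIdx, intCoeff]
    split_ifs
    · rw [MvPowerSeries.coeff_one]
      split_ifs
      · rw [← LaurentPolynomial.T_zero, LaurentPolynomial.T_apply, if_neg (by omega)]
      · rfl
    · rfl
  | succ N ih =>
    rw [Finset.prod_range_succ]
    refine IsEvenSeries.of_mul (N + 1) (-1) (IsEvenSeries.of_mul N 1 ?_)
    have h1 := muFactor_mul N
    have h3 := (ih.mul (N + 1) 0 (-1)).mul N 0 1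
    convert h3 using 1
    linear_combination (∏ j ∈ Finset.range N, muFactor j) * h1

theorem prod_range_mul_eq {R : Type*} [CommMonoid R] (f : ℕ → R) (N : ℕ) :
    (∏ j ∈ Finset.range N, f j) * f N = f 0 * ∏ j ∈ Finset.range N, f (j + 1) := by
  rw [← Finset.prod_range_succ, Finset.prod_range_succ', mul_comm]

/-- The functional equation of the partial products of `μ` modulo `q^N`. -/
theorem pow_dvd_functional (N : ℕ) : (qVar ^ N : MvPowerSeries (Fin 2) ℤ[T;T⁻¹]) ∣
    (∏ j ∈ Finset.range N, muFactorShift j) * (1 - tVar * xVar (-2))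
      + (∏ j ∈ Finset.range N, muFactor j) * (xVar (-2) - tVar) := by
  set P := ∏ j ∈ Finset.range N, muFactor j
  set P' := ∏ j ∈ Finset.range N, muFactorShift j
  have ha := prod_range_mul_eq (fun j => 1 - qVar ^ j * xVar 2) N
  have hb := prod_range_mul_eq (fun j => 1 - qVar ^ j * xVar (-2)) N
  have hc := prod_range_mul_eq (fun j => 1 - qVar ^ j * tVar * xVar 2) N
  have hd := prod_range_mul_eq (fun j => 1 - qVar ^ j * tVar * xVar (-2)) N
  have hP : (∏ j ∈ Finset.range N, (1 - qVar ^ j * tVar * xVar 2))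
      * (∏ j ∈ Finset.range N, (1 - qVar ^ (j + 1) * tVar * xVar (-2))) * P
      = (∏ j ∈ Finset.range N, (1 - qVar ^ j * xVar 2))
      * (∏ j ∈ Finset.range N, (1 - qVar ^ (j + 1) * xVar (-2))) := by
    rw [← Finset.prod_mul_distrib, ← Finset.prod_mul_distrib, ← Finset.prod_mul_distrib]
    refine Finset.prod_congr rfl fun j _ => ?_
    have := muFactor_mul j
    simp only [pow_one, pow_zero, mul_one, show (2 : ℤ) * -1 = -2 by norm_num] at this
    rw [mul_assoc, this]
  have hP' : (∏ j ∈ Finset.range N, (1 - qVar ^ (j + 1) * tVar * xVar 2))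
      * (∏ j ∈ Finset.range N, (1 - qVar ^ j * tVar * xVar (-2))) * P'
      = (∏ j ∈ Finset.range N, (1 - qVar ^ (j + 1) * xVar 2))
      * (∏ j ∈ Finset.range N, (1 - qVar ^ j * xVar (-2))) := by
    rw [← Finset.prod_mul_distrib, ← Finset.prod_mul_distrib, ← Finset.prod_mul_distrib]
    refine Finset.prod_congr rfl fun j _ => ?_
    have := muFactorShift_mul j
    simp only [pow_one, pow_zero, mul_one, show (2 : ℤ) * -1 = -2 by norm_num] at this
    rw [mul_assoc, this]
  have hu : ∀ i : ℤ, IsUnit (∏ j ∈ Finset.range N,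
      (1 - qVar ^ (j + 1) * tVar * xVar i) : MvPowerSeries (Fin 2) ℤ[T;T⁻¹]) := by
    intro i
    refine Finset.prod_induction _ IsUnit (fun _ _ => IsUnit.mul) isUnit_one fun j _ => ?_
    exact IsUnit.of_mul_eq_one _ (one_sub_mul_invOfUnit (constantCoeff_t_mul (j + 1) i))
  -- The denominators common to both products are units, and multiplying by them leaves an identity
  -- between finite products.
  rw [← ((hu 2).mul (hu (-2))).dvd_mul_left]
  have e : (xVar (-2) * xVar 2 : MvPowerSeries (Fin 2) ℤ[T;T⁻¹]) = 1 := by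
    rw [xVar, xVar, ← map_mul, ← LaurentPolynomial.T_add]; simp
  simp only [pow_zero, one_mul] at ha hb hc hd
  generalize (∏ j ∈ Finset.range N, (1 - qVar ^ j * xVar 2) : MvPowerSeries (Fin 2) ℤ[T;T⁻¹]) = a
    at *
  generalize (∏ j ∈ Finset.range N, (1 - qVar ^ (j + 1) * xVar 2) :
    MvPowerSeries (Fin 2) ℤ[T;T⁻¹]) = a' at *
  generalize (∏ j ∈ Finset.range N, (1 - qVar ^ j * xVar (-2)) :
    MvPowerSeries (Fin 2) ℤ[T;T⁻¹]) = b' at *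
  generalize (∏ j ∈ Finset.range N, (1 - qVar ^ (j + 1) * xVar (-2)) :
    MvPowerSeries (Fin 2) ℤ[T;T⁻¹]) = b at *
  generalize (∏ j ∈ Finset.range N, (1 - qVar ^ j * tVar * xVar 2) :
    MvPowerSeries (Fin 2) ℤ[T;T⁻¹]) = c at *
  generalize (∏ j ∈ Finset.range N, (1 - qVar ^ (j + 1) * tVar * xVar 2) :
    MvPowerSeries (Fin 2) ℤ[T;T⁻¹]) = c' at *
  generalize (∏ j ∈ Finset.range N, (1 - qVar ^ j * tVar * xVar (-2)) :
    MvPowerSeries (Fin 2) ℤ[T;T⁻¹]) = d' at *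
  generalize (∏ j ∈ Finset.range N, (1 - qVar ^ (j + 1) * tVar * xVar (-2)) :
    MvPowerSeries (Fin 2) ℤ[T;T⁻¹]) = d at *
  generalize (xVar 2 : MvPowerSeries (Fin 2) ℤ[T;T⁻¹]) = x at *
  generalize (xVar (-2) : MvPowerSeries (Fin 2) ℤ[T;T⁻¹]) = y at *
  generalize (tVar : MvPowerSeries (Fin 2) ℤ[T;T⁻¹]) = t at *
  generalize (qVar ^ N : MvPowerSeries (Fin 2) ℤ[T;T⁻¹]) = Q at *
  -- Without the end factors 1 - q^N(…) in the telescoping identities `ha`, `hb`, `hc`, `hd` the sum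
  -- would vanish. The witness collects the four end terms divided by q^N.
  refine ⟨-(c' * d' * t * y * P') + a' * b' * y - c * d * t * x * y * P + y * a * x * b, ?_⟩
  linear_combination (-c' * P') * hd + hP' + a' * hb - d * y * P * hc + y * hP + y * b * ha
    + (c' * d * t * P - a' * b) * e

theorem muIdx_eq_zero_of_dvd {N : ℕ} {F : MvPowerSeries (Fin 2) ℤ[T;T⁻¹]} (h : qVar ^ N ∣ F)
    {a : ℤ} (ha : a < N) (b m : ℤ) : muIdx F a b m = 0 := by
  obtain ⟨w, rfl⟩ := h
  have := muIdx_monomial_mul N 0 0 w a b m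
  rw [pow_zero, mul_one, xVar, LaurentPolynomial.T_zero, map_one, mul_one] at this
  rw [this, muIdx, intCoeff_of_neg_left _ (by omega)]
  rfl

theorem muIdx_prod {N : ℕ} {a : ℤ} (ha : a < N) (b m : ℤ) :
    muIdx (∏ j ∈ Finset.range N, muFactor j) a b m = muIdx muSeries a b m := by
  rw [muIdx, muIdx, intCoeff, intCoeff]
  split_ifs with h
  · rw [coeff_prod_muFactor]
    rw [bidegree_zero]
    omega
  · rfl

/-- The functional equation of `μ` in terms of coefficients. -/
theorem muIdx_muSeries_functional (a b m : ℤ) :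
    muIdx muSeries (a - m) b (2 * m) - muIdx muSeries (a - m - 1) (b - 1) (2 * m + 2)
      + muIdx muSeries a b (2 * m + 2) - muIdx muSeries a (b - 1) (2 * m) = 0 := by
  -- Large enough for all q-degrees involved, a, a - m and a - m - 1, so that the partial product
  -- can be replaced by μ.
  set N := a.natAbs + m.natAbs + 1
  have h := muIdx_eq_zero_of_dvd (pow_dvd_functional N) (a := a) (by omega) b (2 * m)
  have e1 : ∀ F : MvPowerSeries (Fin 2) ℤ[T;T⁻¹], F * (1 - tVar * xVar (-2))
      = (1 - qVar ^ 0 * tVar ^ 1 * xVar (-2)) * F := fun F => by rw [pow_zero, pow_one]; ring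
  have e2 : ∀ F : MvPowerSeries (Fin 2) ℤ[T;T⁻¹], F * (xVar (-2) - tVar)
      = qVar ^ 0 * tVar ^ 0 * xVar (-2) * F - qVar ^ 0 * tVar ^ 1 * xVar 0 * F := fun F => by
    rw [pow_zero, pow_zero, pow_one, xVar, xVar, LaurentPolynomial.T_zero, map_one]; ring
  have h1 := isShift_prod N (a - m) b m
  have h2 := isShift_prod N (a - m - 1) (b - 1) (m + 1)
  rw [sub_add_cancel, muIdx_prod (by omega)] at h1
  rw [show a - m - 1 + (m + 1) = a by ring, muIdx_prod (by omega), mul_add, mul_one] at h2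
  rw [e1, e2, muIdx_add, muIdx_sub, muIdx_one_sub, muIdx_monomial_mul, muIdx_monomial_mul] at h
  simp only [Nat.cast_zero, Nat.cast_one, sub_zero, sub_neg_eq_add] at h
  rw [h1, h2, muIdx_prod (by omega), muIdx_prod (by omega)] at h
  linarith

theorem intCoeff_muCoeff (m a b : ℤ) : intCoeff (muCoeff m) a b = muIdx muSeries a b m := by
  rw [muIdx, intCoeff, intCoeff]
  split_ifs
  · rfl
  · rfl

theorem muCoeff_odd (m : ℤ) : muCoeff (2 * m + 1) = 0 := by
  refine intCoeff_ext fun a b => ?_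
  rw [intCoeff_muCoeff, ← muIdx_prod (N := a.natAbs + 1) (by omega), isEvenSeries_prod]
  simp [intCoeff]

/-- The coefficient of X^{2j} in μ(qX²)(1 - tX⁻²) = (t - X⁻²)μ(X²), where μ is regarded as a series
in X². -/
theorem muCoeff_succ (j : ℕ) :
    (1 - MvPowerSeries.X 0 ^ (j + 1) * MvPowerSeries.X 1) * muCoeff (2 * ((j : ℤ) + 1))
      = (MvPowerSeries.X 1 - MvPowerSeries.X 0 ^ j) * muCoeff (2 * (j : ℤ)) := by
  refine intCoeff_ext fun a b => ?_
  have h := muIdx_muSeries_functional a b j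
  have e1 := intCoeff_X_pow_mul (j + 1) 1 (muCoeff (2 * ((j : ℤ) + 1))) a b
  have e2 := intCoeff_X_pow_mul j 0 (muCoeff (2 * (j : ℤ))) a b
  have e3 := intCoeff_X_pow_mul 0 1 (muCoeff (2 * (j : ℤ))) a b
  simp only [pow_one, pow_zero, mul_one, one_mul, Nat.cast_zero, Nat.cast_one, sub_zero] at e1 e2 e3
  rw [sub_mul, sub_mul, one_mul, intCoeff_sub, intCoeff_sub, e1, e2, e3]
  simp only [intCoeff_muCoeff]
  rw [mul_add, mul_one, show a - ((j + 1 : ℕ) : ℤ) = a - j - 1 by push_cast; ring]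
  linarith

/-- The coefficient of X^{-2j-2} in the same equation, multiplied by q^{j+1} to remove negative
powers of q; hence the index a - (j + 1) below. -/
theorem muCoeff_neg_succ (j : ℕ) :
    (1 - MvPowerSeries.X 0 ^ (j + 1) * MvPowerSeries.X 1) * muCoeff (-(2 * ((j : ℤ) + 1)))
      = MvPowerSeries.X 0 * (MvPowerSeries.X 1 - MvPowerSeries.X 0 ^ j)
        * muCoeff (-(2 * (j : ℤ))) := by
  refine intCoeff_ext fun a b => ?_
  have h := muIdx_muSeries_functional (a - (j + 1)) b (-((j : ℤ) + 1))
  have e1 := intCoeff_X_pow_mul (j + 1) 1 (muCoeff (-(2 * ((j : ℤ) + 1)))) a b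
  have e2 := intCoeff_X_pow_mul (j + 1) 0 (muCoeff (-(2 * (j : ℤ)))) a b
  have e3 := intCoeff_X_pow_mul 1 1 (muCoeff (-(2 * (j : ℤ)))) a b
  simp only [pow_one, pow_zero, mul_one, Nat.cast_zero, Nat.cast_one, sub_zero] at e1 e2 e3
  rw [mul_sub, ← pow_succ', sub_mul, sub_mul, one_mul, intCoeff_sub, intCoeff_sub, e1, e2, e3]
  simp only [intCoeff_muCoeff]
  push_cast
  rw [show 2 * -((j : ℤ) + 1) + 2 = -(2 * (j : ℤ)) by ring,
    show 2 * -((j : ℤ) + 1) = -(2 * ((j : ℤ) + 1)) by ring,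
    show a - ((j : ℤ) + 1) - -((j : ℤ) + 1) = a by ring] at h
  linarith

/-- At q = t = 0 the series μ is 1 - X², whose constant term is 1. -/
theorem muCoeff_zero_ne : muCoeff 0 ≠ 0 := by
  intro h
  have h1 : MvPowerSeries.coeff 0 (muCoeff 0) = (1 : ℤ) := by
    have e : MvPowerSeries.coeff 0 muSeries = (1 - T 2 : ℤ[T;T⁻¹]) := by
      rw [← coeff_prod_muFactor 0 1 (by simp), Finset.prod_range_one,
        MvPowerSeries.coeff_zero_eq_constantCoeff_apply, muFactor]
      simp [qVar, tVar, xVar, MvPowerSeries.constantCoeff_invOfUnit]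
    change (MvPowerSeries.coeff 0 muSeries).coeff 0 = 1
    rw [e, ← LaurentPolynomial.T_zero]
    simp [LaurentPolynomial.T_apply, -LaurentPolynomial.T_zero]
  rw [h, map_zero] at h1
  exact zero_ne_one h1

end MuRecursion

/-! ### The coefficients of `μ_∘` as rational functions. -/

section MuCirc

variable {K : Type*} [Field K]

/-- Cancelling the nonzero series `muCoeff 0` turns two presentations into an equality of
polynomials ad = cb, which can be evaluated at (q, t). So the chosen value in `muCirc` can be
computed from any presentation. -/
theorem IsMuCircCoeff.unique {q t : K} {m : ℤ} {r s : K} (hr : IsMuCircCoeff q t m r)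
    (hs : IsMuCircCoeff q t m s) : r = s := by
  obtain ⟨a, b, h, hb, rfl⟩ := hr
  obtain ⟨c, d, h', hd, rfl⟩ := hs
  have e : ((a * d : MvPolynomial (Fin 2) ℤ) : MvPowerSeries (Fin 2) ℤ)
      = ((c * b : MvPolynomial (Fin 2) ℤ) : MvPowerSeries (Fin 2) ℤ) := by
    apply mul_right_cancel₀ muCoeff_zero_ne
    rw [MvPolynomial.coe_mul, MvPolynomial.coe_mul]
    linear_combination -(d : MvPowerSeries (Fin 2) ℤ) * h + (b : MvPowerSeries (Fin 2) ℤ) * h'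
  have e2 := congrArg (MvPolynomial.aeval ![q, t]) (MvPolynomial.coe_injective (Fin 2) ℤ e)
  rw [map_mul, map_mul] at e2
  rw [div_eq_div_iff hb hd, e2]

theorem IsMuCircCoeff.muCirc_eq {q t : K} {m : ℤ} {r : K} (hr : IsMuCircCoeff q t m r) :
    muCirc q t m = r := by
  have h : ∃ r, IsMuCircCoeff q t m r := ⟨r, hr⟩
  rw [muCirc, dif_pos h]
  exact h.choose_spec.unique hr

/-- The coefficient of `X^{2j}` in `μ_∘`. -/
def muRatio (q t : K) (j : ℕ) : K :=
  ∏ l ∈ Finset.range j, (t - q ^ l) / (1 - t * q ^ (l + 1))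

variable {q t : K} (h : ∀ j : ℕ, 1 ≤ j → 1 - t * q ^ j ≠ 0)
include h

theorem isMuCircCoeff_even (j : ℕ) : IsMuCircCoeff q t (2 * (j : ℤ)) (muRatio q t j) := by
  induction j with
  | zero => exact ⟨1, 1, by simp, by simp, by simp [muRatio]⟩
  | succ j ih =>
    obtain ⟨a, b, h1, h2, h3⟩ := ih
    refine ⟨a * (MvPolynomial.X 1 - MvPolynomial.X 0 ^ j),
      b * (1 - MvPolynomial.X 0 ^ (j + 1) * MvPolynomial.X 1), ?_, ?_, ?_⟩
    · have h4 := muCoeff_succ j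
      have e : ∀ p : MvPolynomial (Fin 2) ℤ, (p : MvPowerSeries (Fin 2) ℤ)
        = MvPolynomial.coeToMvPowerSeries.ringHom p := fun p => rfl
      simp only [e, map_mul, map_sub, map_one, map_pow] at h1 ⊢
      simp only [← e, MvPolynomial.coe_X] at h1 ⊢
      push_cast
      linear_combination (b : MvPowerSeries (Fin 2) ℤ) * h4
        + (MvPowerSeries.X 1 - MvPowerSeries.X 0 ^ j) * h1
    · have := h (j + 1) (by omega)
      simp only [map_mul, map_sub, map_one, map_pow, MvPolynomial.aeval_X]
      refine mul_ne_zero h2 ?_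
      simpa [mul_comm] using this
    · rw [muRatio, Finset.prod_range_succ, ← muRatio, h3]
      simp only [map_mul, map_sub, map_one, map_pow, MvPolynomial.aeval_X]
      simp [mul_comm t, div_mul_div_comm]

theorem isMuCircCoeff_neg_even (j : ℕ) :
    IsMuCircCoeff q t (-(2 * (j : ℤ))) (q ^ j * muRatio q t j) := by
  induction j with
  | zero => exact ⟨1, 1, by simp, by simp, by simp [muRatio]⟩
  | succ j ih =>
    obtain ⟨a, b, h1, h2, h3⟩ := ih
    refine ⟨MvPolynomial.X 0 * a * (MvPolynomial.X 1 - MvPolynomial.X 0 ^ j),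
      b * (1 - MvPolynomial.X 0 ^ (j + 1) * MvPolynomial.X 1), ?_, ?_, ?_⟩
    · have h4 := muCoeff_neg_succ j
      have e : ∀ p : MvPolynomial (Fin 2) ℤ, (p : MvPowerSeries (Fin 2) ℤ)
        = MvPolynomial.coeToMvPowerSeries.ringHom p := fun p => rfl
      simp only [e, map_mul, map_sub, map_one, map_pow] at h1 ⊢
      simp only [← e, MvPolynomial.coe_X] at h1 ⊢
      push_cast
      linear_combination (b : MvPowerSeries (Fin 2) ℤ) * h4
        + MvPowerSeries.X 0 * (MvPowerSeries.X 1 - MvPowerSeries.X 0 ^ j) * h1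
    · have := h (j + 1) (by omega)
      simp only [map_mul, map_sub, map_one, map_pow, MvPolynomial.aeval_X]
      refine mul_ne_zero h2 ?_
      simpa [mul_comm] using this
    · have e : q ^ (j + 1) * muRatio q t (j + 1)
          = q * (q ^ j * muRatio q t j) * ((t - q ^ j) / (1 - q ^ (j + 1) * t)) := by
        rw [muRatio, Finset.prod_range_succ, ← muRatio, mul_comm t]
        ring
      rw [e, h3]
      simp only [map_mul, map_sub, map_one, map_pow, MvPolynomial.aeval_X]
      simp [mul_div_assoc', div_mul_eq_mul_div, div_div]

omit h in
theorem isMuCircCoeff_odd (q t : K) (m : ℤ) : IsMuCircCoeff q t (2 * m + 1) 0 :=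
  ⟨0, 1, by rw [muCoeff_odd]; simp, by simp, by simp⟩

theorem isMuCircCoeff_muCirc (m : ℤ) : IsMuCircCoeff q t m (muCirc q t m) := by
  obtain ⟨r, hr⟩ : ∃ r, IsMuCircCoeff q t m r := by
    obtain ⟨j, rfl | rfl⟩ := m.even_or_odd'
    · obtain ⟨i, rfl | rfl⟩ := j.eq_nat_or_neg
      · exact ⟨_, isMuCircCoeff_even h i⟩
      · rw [mul_neg]
        exact ⟨_, isMuCircCoeff_neg_even h i⟩
    · exact ⟨_, isMuCircCoeff_odd q t j⟩
  rwa [hr.muCirc_eq]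

theorem muCirc_even (j : ℕ) : muCirc q t (2 * (j : ℤ)) = muRatio q t j :=
  (isMuCircCoeff_even h j).muCirc_eq

theorem muCirc_neg_even (j : ℕ) : muCirc q t (-(2 * (j : ℤ))) = q ^ j * muRatio q t j :=
  (isMuCircCoeff_neg_even h j).muCirc_eq

omit h in
theorem muCirc_odd (q t : K) (m : ℤ) : muCirc q t (2 * m + 1) = 0 :=
  (isMuCircCoeff_odd q t m).muCirc_eq

end MuCirc

/-! ### Symmetries of the constant term functional. -/

section ConstantTerm

variable {K : Type*} [Field K]

/-- The hypothesis is the condition for w = X^j + X^{-j}. It says that f ↦ Λ((vX - v⁻¹X⁻¹)f) changes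
sign under s, so on symmetric w twice its value is zero. -/
theorem TSelfAdjoint.of_monomials {v : K} {Λ : K[T;T⁻¹] →ₗ[K] K} (h2 : (2 : K) ≠ 0)
    (h : ∀ j : ℤ, v * (Λ (T (1 + j)) + Λ (T (1 - j)))
      = v⁻¹ * (Λ (T (-1 + j)) + Λ (T (-1 - j)))) : TSelfAdjoint v Λ := by
  intro w hw
  have key : Λ ∘ₗ LinearMap.mulLeft K (v • T 1 - v⁻¹ • T (-1)) ∘ₗ sOp
      = -(Λ ∘ₗ LinearMap.mulLeft K (v • T 1 - v⁻¹ • T (-1))) := by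
    refine laurent_ext fun j => ?_
    simp only [LinearMap.comp_apply, LinearMap.neg_apply, LinearMap.mulLeft_apply, sOp_T, sub_mul,
      smul_mul_assoc, T_mul_T', map_sub, map_smul, smul_eq_mul]
    have := h j
    rw [sub_eq_add_neg, sub_eq_add_neg] at this
    linear_combination this
  have h3 := congrArg (fun L : K[T;T⁻¹] →ₗ[K] K => L w) key
  simp only [LinearMap.comp_apply, LinearMap.neg_apply, LinearMap.mulLeft_apply, hw] at h3
  have h4 : 2 * Λ ((v • T 1 - v⁻¹ • T (-1)) * w) = 0 := by linear_combination h3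
  exact (mul_eq_zero.mp h4).resolve_left h2

theorem constTerm_eq (u v : K) (f : K[T;T⁻¹]) :
    constTerm u v f = functional (fun m => muCirc (u ^ 4) (v ^ 2) (-m)) f :=
  (functional_apply _ f).symm

section MuCirc

variable {u v : K} (h : Generic u v)
include h

theorem Generic.mu_regular (j : ℕ) (hj : 1 ≤ j) : 1 - v ^ 2 * (u ^ 4) ^ j ≠ 0 :=
  h.one_sub_t_mul_pow_ne hj

theorem Generic.muCirc_zero : muCirc (u ^ 4) (v ^ 2) 0 = 1 := by
  have := muCirc_even h.mu_regular 0
  simpa [muRatio] using this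

/-- The coefficients of `s p μ_∘ = μ_∘`. -/
theorem Generic.muCirc_neg (m : ℤ) :
    muCirc (u ^ 4) (v ^ 2) (-m) = (u ^ 2) ^ m * muCirc (u ^ 4) (v ^ 2) m := by
  have hu := h.u_ne
  obtain ⟨j, rfl | rfl⟩ := m.even_or_odd'
  · have e : (u ^ 2) ^ (2 * j) = (u ^ 4) ^ j := by
      rw [zpow_mul, zpow_ofNat, ← pow_mul]
    rw [e]
    obtain ⟨i, rfl | rfl⟩ := j.eq_nat_or_neg
    · rw [muCirc_neg_even h.mu_regular, muCirc_even h.mu_regular, zpow_natCast]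
    · rw [mul_neg, neg_neg, muCirc_neg_even h.mu_regular, muCirc_even h.mu_regular, zpow_neg,
        zpow_natCast, inv_mul_cancel_left₀ (pow_ne_zero _ (pow_ne_zero 4 hu))]
  · rw [muCirc_odd, show -(2 * j + 1) = 2 * (-j - 1) + 1 by ring, muCirc_odd, mul_zero]

/-- Coefficient form of the antisymmetry of (t^{1/2}X - t^{-1/2}X⁻¹)μ_∘ under X ↦ X⁻¹. For even j
only odd coefficients occur; for j = 2n + 1 it is the recursion of `muRatio`. -/
theorem Generic.muCirc_balance (j : ℤ) :
    v ^ 2 * (muCirc (u ^ 4) (v ^ 2) (-1 - j) + muCirc (u ^ 4) (v ^ 2) (-1 + j))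
      = muCirc (u ^ 4) (v ^ 2) (1 - j) + muCirc (u ^ 4) (v ^ 2) (1 + j) := by
  have hu := h.u_ne
  have key : ∀ j : ℤ, 0 ≤ j →
      v ^ 2 * (muCirc (u ^ 4) (v ^ 2) (-1 - j) + muCirc (u ^ 4) (v ^ 2) (-1 + j))
      = muCirc (u ^ 4) (v ^ 2) (1 - j) + muCirc (u ^ 4) (v ^ 2) (1 + j) := by
    intro j hj
    obtain ⟨i, rfl | rfl⟩ := j.even_or_odd'
    · rw [show -1 - 2 * i = 2 * (-i - 1) + 1 by ring, show -1 + 2 * i = 2 * (i - 1) + 1 by ring,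
        show 1 - 2 * i = 2 * (-i) + 1 by ring, show 1 + 2 * i = 2 * i + 1 by ring]
      simp only [muCirc_odd]
      ring
    · obtain ⟨n, rfl⟩ : ∃ n : ℕ, i = n := ⟨i.toNat, by omega⟩
      rw [show -1 - (2 * (n : ℤ) + 1) = -(2 * ((n + 1 : ℕ) : ℤ)) by push_cast; ring,
        show -1 + (2 * (n : ℤ) + 1) = 2 * (n : ℤ) by ring,
        show 1 - (2 * (n : ℤ) + 1) = -(2 * (n : ℤ)) by ring,
        show 1 + (2 * (n : ℤ) + 1) = 2 * ((n + 1 : ℕ) : ℤ) by push_cast; ring,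
        muCirc_neg_even h.mu_regular, muCirc_neg_even h.mu_regular, muCirc_even h.mu_regular,
        muCirc_even h.mu_regular, muRatio, Finset.prod_range_succ, ← muRatio]
      have := h.mu_regular (n + 1) (by omega)
      rw [pow_succ (u ^ 4)] at this ⊢
      generalize muRatio (u ^ 4) (v ^ 2) n = ρ
      generalize (u ^ 4) ^ n = Q at *
      generalize u ^ 4 = q at *
      have hr := div_mul_cancel₀ (v ^ 2 - Q) this
      linear_combination (-ρ) * hr
  rcases le_total 0 j with hj | hj
  · exact key j hj
  · have := key (-j) (by omega)
    rw [sub_neg_eq_add, sub_neg_eq_add, ← sub_eq_add_neg, ← sub_eq_add_neg] at this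
    linear_combination this

theorem Generic.tSelfAdjoint_constTerm (h2 : (2 : K) ≠ 0) :
    TSelfAdjoint v (functional fun m => muCirc (u ^ 4) (v ^ 2) (-m)) := by
  refine TSelfAdjoint.of_monomials h2 fun j => ?_
  have hv := h.v_ne
  have := h.muCirc_balance j
  simp only [functional_T]
  rw [show -(1 + j) = -1 - j by ring, show -(1 - j) = -1 + j by ring,
    show -(-1 + j) = 1 - j by ring, show -(-1 - j) = 1 + j by ring]
  field_simp
  linear_combination this

theorem Generic.constTerm_piOp (f : K[T;T⁻¹]) : constTerm u v (piOp u f) = constTerm u v f := by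
  have : functional (fun m => muCirc (u ^ 4) (v ^ 2) (-m)) ∘ₗ piOp u
      = functional fun m => muCirc (u ^ 4) (v ^ 2) (-m) := by
    refine laurent_ext fun m => ?_
    rw [LinearMap.comp_apply, piOp_T, map_smul, functional_T, functional_T, neg_neg, h.muCirc_neg,
      smul_eq_mul]
  rw [constTerm_eq, constTerm_eq]
  exact congrArg (fun L : K[T;T⁻¹] →ₗ[K] K => L f) this

end MuCirc

/-! ### The weights `μ_•` -/

theorem muBullet_one_sub (u v : K) (n : ℤ) : muBullet u v (1 - n) = muBullet u v n := by
  have e : (if 0 < 1 - n then (1 - n - 1).toNat else (-(1 - n)).toNat)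
      = if 0 < n then (n - 1).toNat else (-n).toNat := by
    split_ifs <;> omega
  simp only [muBullet, e]

theorem muBullet_neg_of_pos (u v : K) {n : ℕ} (hn : 0 < n) : muBullet u v (-(n : ℤ))
    = (v ^ 2)⁻¹ * ((1 - (v ^ 2) ^ 2 * (u ^ 4) ^ n) / (1 - (u ^ 4) ^ n)) * muBullet u v n := by
  obtain ⟨m, rfl⟩ : ∃ m, n = m + 1 := ⟨n - 1, by omega⟩
  have e1 : (if 0 < -((m + 1 : ℕ) : ℤ) then (-((m + 1 : ℕ) : ℤ) - 1).toNat
      else (- -((m + 1 : ℕ) : ℤ)).toNat) = m + 1 := by rw [if_neg (by omega)]; omega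
  have e2 : (if 0 < ((m + 1 : ℕ) : ℤ) then (((m + 1 : ℕ) : ℤ) - 1).toNat
      else (-((m + 1 : ℕ) : ℤ)).toNat) = m := by rw [if_pos (by omega)]; omega
  simp only [muBullet, e1, e2]
  rw [Finset.prod_Icc_succ_top (by omega), pow_succ, mul_inv]
  ring

section MuBullet

variable {u v : K} (h : Generic u v)
include h

/-- The ratio of the weights at n and -n, cross-multiplied. The identity is invariant under n ↦ -n,
so n > 0 suffices. -/
theorem Generic.muBullet_neg {n : ℤ} (hn : n ≠ 0) :
    muBullet u v (-n) * (v * (qSharp u v n)⁻¹ - v⁻¹ * qSharp u v n)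
      = -(muBullet u v n * (v * qSharp u v n - v⁻¹ * (qSharp u v n)⁻¹)) := by
  have hv := h.v_ne
  have key : ∀ n : ℕ, 0 < n →
      muBullet u v (-(n : ℤ)) * (v * (qSharp u v n)⁻¹ - v⁻¹ * qSharp u v n)
      = -(muBullet u v n * (v * qSharp u v n - v⁻¹ * (qSharp u v n)⁻¹)) := by
    intro n hn
    have hx := h.qSharp_ne n
    have hq : 1 - (u ^ 4) ^ n ≠ 0 := sub_ne_zero.mpr (h.q_pow n hn).symm
    have hx2 := qSharp_sq_of_pos (u := u) (v := v) (n := n) (by omega)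
    rw [zpow_natCast] at hx2
    rw [muBullet_neg_of_pos u v hn]
    generalize qSharp u v n = x at *
    generalize (u ^ 4) ^ n = Q at *
    generalize muBullet u v n = μ
    field_simp
    rw [hx2]
    ring
  rcases lt_or_gt_of_ne hn with h1 | h1
  · have h2 := key n.natAbs (by omega)
    have e : (n.natAbs : ℤ) = -n := by omega
    rw [e, neg_neg, qSharp_neg_eq hn, inv_inv] at h2
    linear_combination h2
  · have h2 := key n.natAbs (by omega)
    have e : (n.natAbs : ℤ) = n := by omega
    rwa [e] at h2

/-- Detailed balance: the weights symmetrize the part of T' which exchanges n and -n. -/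
theorem Generic.muBullet_mul_tA (n : ℤ) :
    muBullet u v (-n) * tA u v (-n) = muBullet u v n * tA u v n := by
  rcases eq_or_ne n 0 with rfl | hn
  · rw [neg_zero]
  · have h1 := h.qSharp_sq_sub_one_ne hn
    have h2 := h.muBullet_neg hn
    have hx := h.qSharp_ne n
    have hn' : -n ≠ 0 := neg_ne_zero.mpr hn
    have h3 : 1 - qSharp u v n ^ 2 ≠ 0 := by rw [← neg_sub]; exact neg_ne_zero.mpr h1
    have e1 : tA u v (-n) = -((v * (qSharp u v n)⁻¹ - v⁻¹ * qSharp u v n)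
        * (qSharp u v n / (qSharp u v n ^ 2 - 1))) := by
      rw [tA, if_neg hn', qSharp_neg_eq hn]
      have e3 : (qSharp u v n)⁻¹ ^ 2 - 1 = -(qSharp u v n ^ 2 - 1) / qSharp u v n ^ 2 := by
        field_simp
        ring
      rw [e3]
      generalize v⁻¹ = v'
      field_simp
    have e2 : tA u v n = (v * qSharp u v n - v⁻¹ * (qSharp u v n)⁻¹)
        * (qSharp u v n / (qSharp u v n ^ 2 - 1)) := by
      rw [tA, if_neg hn]
      generalize v⁻¹ = v'
      field_simp
    rw [e1, e2]
    linear_combination (-(qSharp u v n / (qSharp u v n ^ 2 - 1))) * h2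

end MuBullet

end ConstantTerm

/-! ## The Fourier transforms over `ℚ(q^{1/4}, t^{1/2})` -/

section GenericConstants

theorem mon_pow (a b : ℤ) (j : ℕ) : mon a b ^ j = mon (j * a) (j * b) := by
  induction j with
  | zero => simp [mon_zero]
  | succ j ih => rw [pow_succ, ih, mon_mul]; congr 1 <;> push_cast <;> ring

theorem generic_u₀_v₀ : Generic u₀ v₀ where
  u_ne := u₀_ne
  v_ne := v₀_ne
  q_pow j hj := by
    rw [u₀, mon_pow, mon_pow, ← mon_zero]
    intro h
    have := (mon_injective h).1
    push_cast at this
    omega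
  t_pow j hj := by
    rw [u₀, v₀, mon_pow, mon_pow, mon_pow, mon_mul, ← mon_zero]
    intro h
    have := (mon_injective h).2
    push_cast at this
    omega

theorem two_ne_Kqt : (2 : Kqt) ≠ 0 := by
  have h := (map_ne_zero ((algebraMap (AddMonoidAlgebra ℚ (ℤ × ℤ)) Kqt).comp
    (algebraMap ℚ (AddMonoidAlgebra ℚ (ℤ × ℤ))))).mpr (two_ne_zero (α := ℚ))
  rwa [map_ofNat] at h

theorem tFunA_eq (n : ℤ) : tFunA n = tA u₀ v₀ n := by
  rw [tA]
  split_ifs with hn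
  · rw [hn, tFunA_zero]
  · rfl

theorem tFunB_eq (n : ℤ) : tFunB n = tB u₀ v₀ n := by
  rw [tB]
  split_ifs with hn
  · rw [hn, tFunB_zero]
  · rfl

theorem tFun_apply (f : Fun) (n : ℤ) :
    tFun f n = tA u₀ v₀ n * f (-n) + tB u₀ v₀ n * f n := by
  rw [← tFunA_eq, ← tFunB_eq]; rfl

theorem xFun_apply (f : Fun) (n : ℤ) : xFun f n = qSharp u₀ v₀ n * f n := by
  simp [xFun, funOp]

theorem piFun_apply (f : Fun) (n : ℤ) : piFun f n = f (1 - n) := by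
  simp [piFun, funOp]

theorem piFun_piFun (f : Fun) : piFun (piFun f) = f := by
  ext n
  simp [piFun_apply]

theorem starK_qSharp (n : ℤ) : starK (qSharp u₀ v₀ n) = (qSharp u₀ v₀ n)⁻¹ := by
  rw [qSharp_eq_mon, starK_mon, mon_inv]

theorem starK_tA (n : ℤ) : starK (tA u₀ v₀ n) = tA u₀ v₀ n := by
  rw [tA]
  split_ifs with hn
  · exact map_zero _
  · have h1 := qSharp_sq_sub_one_ne_zero n
    have h0 := qSharp_ne_zero n
    have hv := v₀_ne
    simp only [map_div₀, map_sub, map_mul, map_pow, map_inv₀, map_one, starK_qSharp, starK_v₀]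
    rw [inv_inv]
    have e3 : (qSharp u₀ v₀ n)⁻¹ ^ 2 - 1 = -(qSharp u₀ v₀ n ^ 2 - 1) / qSharp u₀ v₀ n ^ 2 := by
      field_simp
      ring
    rw [e3]
    generalize v₀⁻¹ = v'
    field_simp
    ring

/-- The correction is the difference between T' and its inverse, so T'^{-1} will be the adjoint of
T' for the sesquilinear form. -/
theorem starK_tB (n : ℤ) : starK (tB u₀ v₀ n) = tB u₀ v₀ n - (v₀ - v₀⁻¹) := by
  rw [← generic_u₀_v₀.sq_mul_tB, tB]
  split_ifs with hn
  · have hv := v₀_ne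
    rw [hn, starK_v₀, qSharp_zero]
    field_simp
  · have h1 := qSharp_sq_sub_one_ne_zero n
    have h0 := qSharp_ne_zero n
    simp only [map_div₀, map_sub, map_neg, map_pow, map_inv₀, map_one, starK_qSharp, starK_v₀]
    rw [inv_inv]
    have e3 : (qSharp u₀ v₀ n)⁻¹ ^ 2 - 1 = -(qSharp u₀ v₀ n ^ 2 - 1) / qSharp u₀ v₀ n ^ 2 := by
      field_simp
      ring
    rw [e3]
    generalize v₀⁻¹ = v'
    field_simp
    ring

end GenericConstants

/-! ### The involution `*` and its compatibility with the functionals. -/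

section StarInvolution

theorem starL_add (f g : Kqt[T;T⁻¹]) : starL (f + g) = starL f + starL g := by
  simp [starL]

theorem starL_mul (f g : Kqt[T;T⁻¹]) : starL (f * g) = starL f * starL g := by
  simp [starL]

theorem starL_T (n : ℤ) : starL (T n) = T (-n) := by
  have : AddMonoidAlgebra.mapRingHom ℤ (starK : Kqt →+* Kqt) (T n) = T n := by
    rw [LaurentPolynomial.T, AddMonoidAlgebra.mapRingHom_single, map_one]
  rw [starL, this, LaurentPolynomial.invert_T]

theorem starL_C (a : Kqt) : starL (LaurentPolynomial.C a) = LaurentPolynomial.C (starK a) := by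
  have : AddMonoidAlgebra.mapRingHom ℤ (starK : Kqt →+* Kqt) (LaurentPolynomial.C a)
      = LaurentPolynomial.C (starK a) := by
    rw [← LaurentPolynomial.single_eq_C, AddMonoidAlgebra.mapRingHom_single]
    rfl
  rw [starL, this, LaurentPolynomial.invert_C]

theorem starL_smul (a : Kqt) (f : Kqt[T;T⁻¹]) : starL (a • f) = starK a • starL f := by
  rw [LaurentPolynomial.smul_eq_C_mul, starL_mul, starL_C, ← LaurentPolynomial.smul_eq_C_mul]

/-- If `F^*` and `G` take the same values on monomials, they define conjugate functionals. -/
theorem functional_starL {F G : ℤ → Kqt} (h : ∀ n, F (-n) = starK (G n)) (f : Kqt[T;T⁻¹]) :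
    functional F (starL f) = starK (functional G f) := by
  induction f using LaurentPolynomial.induction_on' with
  | add p q hp hq => rw [starL_add, map_add, map_add, map_add, hp, hq]
  | C_mul_T n a =>
    rw [← LaurentPolynomial.smul_eq_C_mul, starL_smul, starL_T, map_smul, map_smul, functional_T,
      functional_T, h, smul_eq_mul, smul_eq_mul, map_mul]

theorem evalAt_starL (m : ℤ) (f : Kqt[T;T⁻¹]) :
    evalAt (qSharp u₀ v₀ m) (starL f) = starK (evalAt (qSharp u₀ v₀ m) f) := by
  rw [evalAt_eq, evalAt_eq]
  refine functional_starL (fun n => ?_) f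
  rw [map_zpow₀, starK_qSharp, inv_zpow, zpow_neg]

/-- Inverting q and t multiplies each factor (t - q^l)/(1 - t q^{l+1}) by q. Together with the
values at negative exponents this is μ_∘^* = μ_∘. -/
theorem starK_muRatio (j : ℕ) : starK (muRatio (u₀ ^ 4) (v₀ ^ 2) j)
    = (u₀ ^ 4) ^ j * muRatio (u₀ ^ 4) (v₀ ^ 2) j := by
  induction j with
  | zero => simp [muRatio]
  | succ j ih =>
    rw [muRatio, Finset.prod_range_succ, ← muRatio, map_mul, ih]
    have h1 := generic_u₀_v₀.mu_regular (j + 1) (by omega)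
    have h2 : starK (1 - v₀ ^ 2 * (u₀ ^ 4) ^ (j + 1)) ≠ 0 := (map_ne_zero starK).mpr h1
    have hu := u₀_ne
    have hv := v₀_ne
    have e : starK ((v₀ ^ 2 - (u₀ ^ 4) ^ j) / (1 - v₀ ^ 2 * (u₀ ^ 4) ^ (j + 1)))
        = u₀ ^ 4 * ((v₀ ^ 2 - (u₀ ^ 4) ^ j) / (1 - v₀ ^ 2 * (u₀ ^ 4) ^ (j + 1))) := by
      rw [map_div₀, ← mul_div_assoc, div_eq_div_iff h2 h1]
      simp only [map_sub, map_mul, map_pow, map_one, starK_u₀, starK_v₀, inv_pow, pow_succ (u₀ ^ 4)]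
      have hQ : (u₀ ^ 4) ^ j ≠ 0 := pow_ne_zero _ (pow_ne_zero _ hu)
      generalize (u₀ ^ 4) ^ j = Q at *
      field_simp
      ring
    rw [e]
    ring

theorem starK_muCirc (m : ℤ) : starK (muCirc (u₀ ^ 4) (v₀ ^ 2) m)
    = muCirc (u₀ ^ 4) (v₀ ^ 2) (-m) := by
  have h := generic_u₀_v₀.mu_regular
  obtain ⟨j, rfl | rfl⟩ := m.even_or_odd'
  · obtain ⟨i, rfl | rfl⟩ := j.eq_nat_or_neg
    · rw [muCirc_neg_even h, muCirc_even h, starK_muRatio]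
    · rw [mul_neg, neg_neg, muCirc_neg_even h, muCirc_even h, map_mul, map_pow, map_pow, starK_u₀,
        starK_muRatio, ← mul_assoc, ← mul_pow, ← mul_pow, inv_mul_cancel₀ u₀_ne, one_pow, one_pow,
        one_mul]
  · rw [muCirc_odd, show -(2 * j + 1) = 2 * (-j - 1) + 1 by ring, muCirc_odd, map_zero]

theorem constTerm_starL (f : Kqt[T;T⁻¹]) :
    constTerm u₀ v₀ (starL f) = starK (constTerm u₀ v₀ f) := by
  rw [constTerm_eq, constTerm_eq]
  exact functional_starL (fun n => (starK_muCirc (-n)).symm) f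

end StarInvolution

/-! ### Intertwiners of representations and the action of `σ` on generators. -/

section Intertwining

theorem polyRep_t (f : Kqt[T;T⁻¹]) : polyRep tH f = tOp v₀ f := by
  rw [polyRep, HHlift_t]; rfl

theorem polyRep_x (f : Kqt[T;T⁻¹]) : polyRep xH f = T 1 * f := by
  rw [polyRep, HHlift_x, ← xOp_apply]; rfl

theorem polyRep_y (f : Kqt[T;T⁻¹]) : polyRep yH f = piOp u₀ (tOp v₀ f) := by
  rw [polyRep, HHlift_y]; rfl

theorem funRep_t (f : Fun) : funRep tH f = tFun f := by
  rw [funRep, HHlift_t]; rfl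

theorem funRep_x (f : Fun) : funRep xH f = xFun f := by
  rw [funRep, HHlift_x]; rfl

theorem funRep_y (f : Fun) : funRep yH f = piFun (tFun f) := by
  rw [funRep, HHlift_y]; rfl

theorem rep_inv_apply {M : Type*} [AddCommGroup M] [Module Kqt M] (ρ : HH →ₐ[Kqt] Module.End Kqt M)
    (a : HHˣ) (f : M) : ρ ↑a⁻¹ (ρ a f) = f := by
  rw [← Module.End.mul_apply, ← map_mul, Units.inv_mul, map_one, Module.End.one_apply]

theorem rep_apply_inv {M : Type*} [AddCommGroup M] [Module Kqt M] (ρ : HH →ₐ[Kqt] Module.End Kqt M)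
    (a : HHˣ) (f : M) : ρ a (ρ ↑a⁻¹ f) = f := by
  rw [← Module.End.mul_apply, ← map_mul, Units.mul_inv, map_one, Module.End.one_apply]

/-- A map which is linear on a submodule and intertwines the generators intertwines two
representations. -/
theorem intertwine {M N : Type*} [AddCommGroup M] [Module Kqt M] [AddCommGroup N] [Module Kqt N]
    (ρ : HH →ₐ[Kqt] Module.End Kqt M) (ρ' : HH →ₐ[Kqt] Module.End Kqt N) (S : Submodule Kqt M)
    (hS : ∀ H, ∀ f ∈ S, ρ H f ∈ S) (F : M → N) (hadd : ∀ f ∈ S, ∀ g ∈ S, F (f + g) = F f + F g)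
    (hsmul : ∀ (c : Kqt), ∀ f ∈ S, F (c • f) = c • F f)
    (hT : ∀ f ∈ S, F (ρ tH f) = ρ' tH (F f)) (hX : ∀ f ∈ S, F (ρ xH f) = ρ' xH (F f))
    (hY : ∀ f ∈ S, F (ρ yH f) = ρ' yH (F f)) (H : HH) : ∀ f ∈ S, F (ρ H f) = ρ' H (F f) := by
  have hw : ∀ w : FreeGroup Gen, ∀ f ∈ S, F (ρ (wordU w) f) = ρ' (wordU w) (F f) := by
    have hgen : ∀ a : Gen, ∀ f ∈ S,
        F (ρ (wordU (FreeGroup.of a)) f) = ρ' (wordU (FreeGroup.of a)) (F f) := by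
      intro a
      cases a
      · exact hT
      · exact hX
      · exact hY
    intro w
    induction w using FreeGroup.induction_on with
    | C1 => intro f _; simp
    | of a => exact hgen a
    | inv_of a _ =>
      intro f hf
      -- For an inverse generator the known relation is applied to the vector a⁻¹f, which lies in S
      -- again.
      have h1 := hgen a _ (hS ((wordU (FreeGroup.of a))⁻¹ : HHˣ) f hf)
      rw [rep_apply_inv] at h1
      rw [map_inv, h1, rep_inv_apply]
    | mul x y hx hy =>
      intro f hf
      rw [map_mul, Units.val_mul, map_mul, map_mul, Module.End.mul_apply, Module.End.mul_apply,
        hx _ (hS _ f hf), hy f hf]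
  obtain ⟨z, rfl⟩ := RingQuot.mkAlgHom_surjective Kqt Rel H
  intro f hf
  induction z using MonoidAlgebra.induction_on with
  | of w => exact hw w f hf
  | add x y hx hy =>
    rw [map_add, map_add, map_add, LinearMap.add_apply, LinearMap.add_apply,
      hadd _ (hS _ f hf) _ (hS _ f hf), hx, hy]
  | smul r x hx =>
    rw [map_smul, map_smul, map_smul, LinearMap.smul_apply, LinearMap.smul_apply,
      hsmul _ _ (hS _ f hf), hx]

/-- `σ` on units. -/
theorem sigma_val (a : HHˣ) : sigma (a : HH) = (unitMap (HHlift (isTriple_tauPlus isTriple_gen))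
    (unitMap (HHlift (isTriple_tauMinusInv isTriple_gen))
      (unitMap (HHlift (isTriple_tauPlus isTriple_gen)) a)) : HHˣ) := rfl

theorem sigma_t : sigma tH = tH := by
  rw [sigma_val, unitMap_t, unitMap_t, unitMap_t]

/-- X is fixed by the inner τ_+, becomes q^{-1/4}Y⁻¹X under τ_-^{-1}, and the outer τ_+ sends Y⁻¹ to
q^{1/4}Y⁻¹X⁻¹. -/
theorem sigma_x : sigma xH = (yH⁻¹ : HHˣ) := by
  rw [sigma_val]
  congr 1
  simp only [map_mul, map_inv, unitMap_cU, unitMap_x, unitMap_y]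
  calc (cU HH)⁻¹ * ((cU HH)⁻¹ * xH * yH)⁻¹ * xH
      = ((cU HH)⁻¹ * yH⁻¹) * xH⁻¹ * cU HH * xH := by group
    _ = yH⁻¹ * ((cU HH)⁻¹ * xH⁻¹) * cU HH * xH := by
      rw [((show Commute (cU HH) yH⁻¹ from cU_comm _).inv_left).eq]; group
    _ = yH⁻¹ := by
      rw [((show Commute (cU HH) xH⁻¹ from cU_comm _).inv_left).eq]; group

/-- The computation gives q^{-1/2}Y⁻¹XY, which is XT² by the commutation relation. In terms of π =
YT⁻¹ one gets σ(π) = XT and σ(TX) = TY⁻¹ = π⁻¹. -/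
theorem sigma_y : sigma yH = (xH * tH ^ 2 : HHˣ) := by
  rw [sigma_val]
  congr 1
  simp only [map_mul, map_inv, unitMap_cU, unitMap_x, unitMap_y]
  have hc := isTriple_gen.comm
  have h1 : xH * tH ^ 2 = yH⁻¹ * xH * yH * (cU HH ^ 2)⁻¹ := by
    rw [← hc]; group
  rw [h1]
  calc (cU HH)⁻¹ * ((cU HH)⁻¹ * ((cU HH)⁻¹ * xH * yH)⁻¹ * xH) * ((cU HH)⁻¹ * xH * yH)
      = (cU HH)⁻¹ * (cU HH)⁻¹ * yH⁻¹ * xH⁻¹ * (cU HH * xH) * (cU HH)⁻¹ * xH * yH := by group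
    _ = (cU HH ^ 2)⁻¹ * (yH⁻¹ * xH * yH) := by rw [cU_comm]; group
    _ = yH⁻¹ * xH * yH * (cU HH ^ 2)⁻¹ :=
      ((show Commute (cU HH) (yH⁻¹ * xH * yH) from cU_comm _).pow_left 2).inv_left.eq

theorem sigma_symm_t : sigma.symm tH = tH := by
  rw [AlgEquiv.symm_apply_eq, sigma_t]

theorem sigma_symm_y : sigma.symm yH = (xH⁻¹ : HHˣ) := by
  rw [AlgEquiv.symm_apply_eq]
  have h : unitMap (sigma : HH →ₐ[Kqt] HH) xH = yH⁻¹ := Units.ext sigma_x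
  have h2 := congrArg (fun a : HHˣ => ((a⁻¹ : HHˣ) : HH)) h
  simp only [inv_inv, ← map_inv] at h2
  exact h2.symm

end Intertwining

/-! ### The transform `F_∘` induces `σ`. -/

section FCirc

/-- `F_∘` as a linear map. -/
def FCircL : Kqt[T;T⁻¹] →ₗ[Kqt] Fun :=
  LinearMap.pi fun n => functional (fun m => muCirc (u₀ ^ 4) (v₀ ^ 2) (-m)) ∘ₗ
    LinearMap.mulRight Kqt (epsPoly u₀ v₀ n)

theorem FCircL_apply (f : Kqt[T;T⁻¹]) : FCircL f = FCirc f := by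
  ext n
  simp [FCircL, FCirc, constTerm_eq]

theorem FCirc_add (f g : Kqt[T;T⁻¹]) : FCirc (f + g) = FCirc f + FCirc g := by
  simp only [← FCircL_apply, map_add]

theorem FCirc_smul (c : Kqt) (f : Kqt[T;T⁻¹]) : FCirc (c • f) = c • FCirc f := by
  simp only [← FCircL_apply, map_smul]

theorem constTerm_tOp_mul (f g : Kqt[T;T⁻¹]) :
    constTerm u₀ v₀ (tOp v₀ f * g) = constTerm u₀ v₀ (f * tOp v₀ g) := by
  rw [constTerm_eq, constTerm_eq]
  exact (generic_u₀_v₀.tSelfAdjoint_constTerm two_ne_Kqt).tOp_mul f g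

theorem constTerm_add (f g : Kqt[T;T⁻¹]) :
    constTerm u₀ v₀ (f + g) = constTerm u₀ v₀ f + constTerm u₀ v₀ g := by
  simp only [constTerm_eq, map_add]

theorem constTerm_smul (c : Kqt) (f : Kqt[T;T⁻¹]) :
    constTerm u₀ v₀ (c • f) = c * constTerm u₀ v₀ f := by
  simp only [constTerm_eq, map_smul, smul_eq_mul]

theorem FCirc_tOp (f : Kqt[T;T⁻¹]) : FCirc (tOp v₀ f) = tFun (FCirc f) := by
  ext n
  rw [tFun_apply, FCirc, constTerm_tOp_mul, generic_u₀_v₀.tOp_epsPoly, mul_add, mul_smul_comm,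
    mul_smul_comm, constTerm_add, constTerm_smul, constTerm_smul]
  rfl

/-- This is σ(π) = XT. Invariance of the constant term moves π from f to ε_n, where it becomes
q^{n_♯} T̂; self-adjointness moves T̂ back to f. -/
theorem FCirc_piOp (f : Kqt[T;T⁻¹]) : FCirc (piOp u₀ f) = xFun (tFun (FCirc f)) := by
  ext n
  rw [xFun_apply, ← FCirc_tOp, FCirc, FCirc, ← generic_u₀_v₀.constTerm_piOp,
    piOp_mul u₀_ne, piOp_piOp u₀_ne, generic_u₀_v₀.piOp_epsPoly, mul_smul_comm, constTerm_smul,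
    constTerm_tOp_mul]

/-- The transpose of T̂X is XT̂, which sends ε_n to ε_{1-n}. -/
theorem FCirc_tOp_X (f : Kqt[T;T⁻¹]) : FCirc (tOp v₀ (T 1 * f)) = piFun (FCirc f) := by
  ext n
  rw [piFun_apply, FCirc, FCirc, constTerm_tOp_mul, ← generic_u₀_v₀.X_mul_tOp_epsPoly]
  congr 1
  ring

/-- `F_∘` induces `σ`. -/
theorem FCirc_polyRep (H : HH) (f : Kqt[T;T⁻¹]) :
    FCirc (polyRep H f) = funRep (sigma H) (FCirc f) := by
  refine intertwine polyRep (funRep.comp (sigma : HH →ₐ[Kqt] HH)) ⊤ (fun _ _ _ => trivial) FCirc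
    (fun f _ g _ => FCirc_add f g) (fun c f _ => FCirc_smul c f) (fun f _ => ?_) (fun f _ => ?_)
    (fun f _ => ?_) H f trivial
  · rw [polyRep_t, FCirc_tOp, ← funRep_t]
    exact congrArg (fun a => funRep a (FCirc f)) sigma_t.symm
  · have h1 : funRep (sigma xH) (FCirc f) = funRep (yH⁻¹ : HHˣ) (FCirc f) := by rw [sigma_x]
    -- The relation for X is obtained in the form Y'F_∘(Xf) = F_∘(f) and then inverted.
    have h2 : funRep yH (FCirc (T 1 * f)) = FCirc f := by
      rw [funRep_y, ← FCirc_tOp, FCirc_tOp_X, piFun_piFun]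
    refine Eq.trans ?_ h1.symm
    rw [polyRep_x, ← h2, rep_inv_apply]
  · have h1 : funRep (sigma yH) (FCirc f) = funRep (xH * tH ^ 2 : HHˣ) (FCirc f) := by
      rw [sigma_y]
    refine Eq.trans ?_ h1.symm
    rw [polyRep_y, FCirc_piOp, FCirc_tOp, pow_two, Units.val_mul, Units.val_mul, map_mul, map_mul,
      Module.End.mul_apply, Module.End.mul_apply, funRep_t, funRep_t, funRep_x]

/-- `F_∘(1)` is the characteristic function of `0_♯`. -/
theorem FCirc_one : FCirc 1 = Pi.single 0 1 := by
  ext n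
  have h := generic_u₀_v₀
  rw [FCirc, one_mul]
  rcases eq_or_ne n 0 with rfl | hn
  · rw [h.epsPoly_zero, Pi.single_eq_same, constTerm_eq, ← LaurentPolynomial.T_zero, functional_T,
      neg_zero, h.muCirc_zero]
  · rw [Pi.single_eq_of_ne hn]
    -- The constant term of Ŷε_n is t^{1/2}⟨ε_n⟩_∘, by invariance under π and T̂1 = t^{1/2}. The
    -- eigenvalue q^{-n_♯} equals t^{1/2} only for n = 0.
    have h1 := congrArg (constTerm u₀ v₀) (h.yOp_epsPoly n)
    have h2 := constTerm_tOp_mul (epsPoly u₀ v₀ n) 1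
    rw [mul_one, tOp_one, mul_smul_comm, mul_one] at h2
    rw [yOp_eq, h.constTerm_piOp, h2, constTerm_smul, constTerm_smul] at h1
    have h3 : (v₀ - (qSharp u₀ v₀ n)⁻¹) * constTerm u₀ v₀ (epsPoly u₀ v₀ n) = 0 := by
      linear_combination h1
    refine (mul_eq_zero.mp h3).resolve_left fun h4 => hn ?_
    apply h.qSharp_injective
    rw [qSharp_zero, ← inv_inj, inv_inv]
    exact (sub_eq_zero.mp h4).symm

/-- All monomials are obtained from 1 by X^{±1}, the image of 1 is a delta function, and the
operators σ(X)^{±1} preserve finiteness of the support. -/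
theorem FCirc_finite (f : Kqt[T;T⁻¹]) : (FCirc f).support.Finite := by
  have hT : ∀ n : ℤ, (FCirc (T n)).support.Finite := by
    intro n
    induction n using Int.induction_on with
    | zero =>
      rw [LaurentPolynomial.T_zero, FCirc_one]
      exact (Set.finite_singleton 0).subset Pi.support_single_subset
    | succ n ih =>
      have := funRep_finite (sigma xH) ih
      rwa [← FCirc_polyRep, polyRep_x, T_mul_T', add_comm] at this
    | pred n ih =>
      have := funRep_finite (sigma (xH⁻¹ : HHˣ)) ih
      have e : polyRep (xH⁻¹ : HHˣ) (T (-(n : ℤ))) = T (-(n : ℤ) - 1) := by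
        rw [← rep_inv_apply polyRep xH (T (-(n : ℤ) - 1)), polyRep_x, T_mul_T', add_sub_cancel]
      rwa [← FCirc_polyRep, e] at this
  induction f using LaurentPolynomial.induction_on' with
  | add p q hp hq =>
    rw [FCirc_add]
    exact (hp.union hq).subset (Function.support_add _ _)
  | C_mul_T n a =>
    rw [← LaurentPolynomial.smul_eq_C_mul, FCirc_smul]
    exact (hT n).subset (Function.support_const_smul_subset a _)

end FCirc

/-! ### Adjoints for the pairing `⟨ , ⟩_•`. -/

section FormBullet

theorem formBullet_eq (f g : Fun) :
    formBullet f g = ∑ᶠ n, f n * starK (g n) * muBullet u₀ v₀ n := rfl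

theorem formBullet_term_finite {f : Fun} (hf : f.support.Finite) (g : Fun) :
    (Function.support fun n => f n * starK (g n) * muBullet u₀ v₀ n).Finite :=
  hf.subset fun n hn h0 => hn (by simp [h0])

theorem formBullet_add_left {f f' : Fun} (hf : f.support.Finite) (hf' : f'.support.Finite)
    (g : Fun) : formBullet (f + f') g = formBullet f g + formBullet f' g := by
  simp only [formBullet_eq]
  rw [← finsum_add_distrib (formBullet_term_finite hf g) (formBullet_term_finite hf' g)]
  refine finsum_congr fun n => ?_
  rw [Pi.add_apply]; ring

theorem formBullet_smul_left (c : Kqt) (f g : Fun) :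
    formBullet (c • f) g = c * formBullet f g := by
  simp only [formBullet_eq]
  rw [← smul_eq_mul, smul_finsum]
  refine finsum_congr fun n => ?_
  rw [Pi.smul_apply, smul_eq_mul, smul_eq_mul]; ring

theorem formBullet_add_right {f : Fun} (hf : f.support.Finite) (g g' : Fun) :
    formBullet f (g + g') = formBullet f g + formBullet f g' := by
  simp only [formBullet_eq]
  rw [← finsum_add_distrib (formBullet_term_finite hf g) (formBullet_term_finite hf g')]
  refine finsum_congr fun n => ?_
  rw [Pi.add_apply, map_add]; ring

theorem formBullet_smul_right (c : Kqt) (f g : Fun) :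
    formBullet f (c • g) = starK c * formBullet f g := by
  simp only [formBullet_eq]
  rw [← smul_eq_mul, smul_finsum]
  refine finsum_congr fun n => ?_
  rw [Pi.smul_apply, smul_eq_mul, smul_eq_mul, map_mul]; ring

theorem formBullet_pi (f g : Fun) : formBullet (piFun f) g = formBullet f (piFun g) := by
  rw [formBullet_eq, formBullet_eq, ← finsum_comp_equiv (Equiv.subLeft (1 : ℤ))]
  refine finsum_congr fun n => ?_
  rw [Equiv.subLeft_apply, piFun_apply, piFun_apply, muBullet_one_sub, sub_sub_cancel]

theorem formBullet_x (f g : Fun) : formBullet (xFun f) (xFun g) = formBullet f g := by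
  rw [formBullet_eq, formBullet_eq]
  refine finsum_congr fun n => ?_
  rw [xFun_apply, xFun_apply, map_mul, starK_qSharp]
  have := qSharp_ne_zero n
  field_simp

/-- The adjoint of T' is T'^{-1} = T' - (t^{1/2} - t^{-1/2}). The exchange terms agree by detailed
balance after n ↦ -n, the diagonal terms by `starK_tB`. -/
theorem formBullet_t {f : Fun} (hf : f.support.Finite) (g : Fun) :
    formBullet (tFun f) g = formBullet f (tFun g - (v₀ - v₀⁻¹) • g) := by
  have hfn : (Function.support fun n => f (-n)).Finite :=
    hf.preimage neg_injective.injOn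
  have e1 : formBullet (tFun f) g = ∑ᶠ n, f (-n) * starK (g n) * (muBullet u₀ v₀ n * tA u₀ v₀ n)
      + ∑ᶠ n, f n * starK (g n) * (muBullet u₀ v₀ n * tB u₀ v₀ n) := by
    rw [formBullet_eq, ← finsum_add_distrib (hfn.subset fun n hn h0 => hn (by simp [h0]))
      (hf.subset fun n hn h0 => hn (by simp [h0]))]
    refine finsum_congr fun n => ?_
    rw [tFun_apply]; ring
  have e2 : formBullet f (tFun g - (v₀ - v₀⁻¹) • g)
      = ∑ᶠ n, f n * starK (g (-n)) * (muBullet u₀ v₀ n * tA u₀ v₀ n)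
      + ∑ᶠ n, f n * starK (g n) * (muBullet u₀ v₀ n * tB u₀ v₀ n) := by
    rw [formBullet_eq, ← finsum_add_distrib (hf.subset fun n hn h0 => hn (by simp [h0]))
      (hf.subset fun n hn h0 => hn (by simp [h0]))]
    refine finsum_congr fun n => ?_
    rw [Pi.sub_apply, Pi.smul_apply, tFun_apply, smul_eq_mul, map_sub, map_add, map_mul, map_mul,
      map_mul, starK_tA, starK_tB, map_sub, map_inv₀, starK_v₀, inv_inv]
    ring
  rw [e1, e2, ← finsum_comp_equiv (Equiv.neg ℤ)]
  congr 1
  refine finsum_congr fun n => ?_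
  rw [Equiv.neg_apply, neg_neg, generic_u₀_v₀.muBullet_mul_tA]

theorem formBullet_t_t {f : Fun} (hf : f.support.Finite) (g : Fun) :
    formBullet (tFun f) (tFun g) = formBullet f g := by
  rw [formBullet_t hf, tFun_tFun, add_sub_cancel_left]

end FormBullet

/-! ### Unitarity of `F_∘`. -/

section Unitarity

theorem finite_support_tFun {f : Fun} (hf : f.support.Finite) : (tFun f).support.Finite := by
  rw [← funRep_t]
  exact funRep_finite _ hf

theorem formBullet_y {f : Fun} (hf : f.support.Finite) (g : Fun) :
    formBullet (piFun (tFun f)) (piFun (tFun g)) = formBullet f g := by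
  rw [formBullet_pi, piFun_piFun, formBullet_t_t hf]

theorem yFun_FCirc_X (f : Kqt[T;T⁻¹]) : piFun (tFun (FCirc (T 1 * f))) = FCirc f := by
  rw [← FCirc_tOp, FCirc_tOp_X, piFun_piFun]

theorem formCirc_X (f g : Kqt[T;T⁻¹]) : formCirc (T 1 * f) (T 1 * g) = formCirc f g := by
  rw [formCirc, formCirc, starL_mul, starL_T]
  congr 1
  have : (T 1 : Kqt[T;T⁻¹]) * T (-1) = 1 := by rw [T_mul_T']; simp
  linear_combination f * starL g * this

theorem formBullet_FCirc_X (f g : Kqt[T;T⁻¹]) :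
    formBullet (FCirc (T 1 * f)) (FCirc (T 1 * g)) = formBullet (FCirc f) (FCirc g) := by
  rw [← formBullet_y (FCirc_finite _), yFun_FCirc_X, yFun_FCirc_X]

/-- Since F_∘(1) is the delta function at 0_♯, of weight 1, the right side is the conjugate of
⟨g⟩_∘; the left side is ⟨g^*⟩_∘. -/
theorem formCirc_one (g : Kqt[T;T⁻¹]) : formCirc 1 g = formBullet (FCirc 1) (FCirc g) := by
  rw [formCirc, one_mul, constTerm_starL, FCirc_one, formBullet_eq, finsum_eq_single _ 0]
  · have h1 : muBullet u₀ v₀ 0 = 1 := by simp [muBullet]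
    rw [h1, Pi.single_eq_same, FCirc, generic_u₀_v₀.epsPoly_zero, mul_one, one_mul, mul_one]
  · intro n hn
    rw [Pi.single_eq_of_ne hn, zero_mul, zero_mul]

/-- `F_∘` is unitary. -/
theorem formCirc_eq_formBullet (f g : Kqt[T;T⁻¹]) :
    formCirc f g = formBullet (FCirc f) (FCirc g) := by
  have hX : ∀ g : Kqt[T;T⁻¹], T 1 * (T (-1) * g) = g := fun g => by
    rw [← mul_assoc, T_mul_T', add_neg_cancel, LaurentPolynomial.T_zero, one_mul]
  -- Neither side changes when both arguments are multiplied by X, because F_∘ turns X into the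
  -- inverse of the unitary Y'. So the first argument can be moved to 1.
  have hT : ∀ (n : ℤ) (g : Kqt[T;T⁻¹]), formCirc (T n) g = formBullet (FCirc (T n)) (FCirc g) := by
    intro n
    induction n using Int.induction_on with
    | zero => exact fun g => by rw [LaurentPolynomial.T_zero]; exact formCirc_one g
    | succ n ih =>
      intro g
      rw [add_comm, LaurentPolynomial.T_add, ← hX g, formCirc_X, formBullet_FCirc_X, ih]
    | pred n ih =>
      intro g
      rw [← formCirc_X, ← formBullet_FCirc_X, T_mul_T', add_sub_cancel, ih]
  induction f using LaurentPolynomial.induction_on' with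
  | add p q hp hq =>
    rw [FCirc_add, formBullet_add_left (FCirc_finite p) (FCirc_finite q), ← hp, ← hq, formCirc,
      add_mul, constTerm_add]
    rfl
  | C_mul_T n a =>
    rw [← LaurentPolynomial.smul_eq_C_mul, FCirc_smul, formBullet_smul_left, ← hT, formCirc,
      smul_mul_assoc, constTerm_smul]
    rfl

end Unitarity

/-! ### The transform `F_•` induces `σ^{-1}`. -/

section FBullet

/-- The values of a Laurent polynomial at the points `n_♯`. -/
def sharpValues (f : Kqt[T;T⁻¹]) : Fun := fun n => evalAt (qSharp u₀ v₀ n) f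

theorem sharpValues_add (f g : Kqt[T;T⁻¹]) :
    sharpValues (f + g) = sharpValues f + sharpValues g :=
  funext fun _ => evalAt_add _ _ _

theorem sharpValues_smul (c : Kqt) (f : Kqt[T;T⁻¹]) :
    sharpValues (c • f) = c • sharpValues f :=
  funext fun _ => evalAt_smul _ _ _

theorem sharpValues_tOp (f : Kqt[T;T⁻¹]) : sharpValues (tOp v₀ f) = tFun (sharpValues f) := by
  ext n
  rw [tFun_apply, sharpValues, generic_u₀_v₀.evalAt_tOp_sharp]
  rfl

theorem sharpValues_piOp (f : Kqt[T;T⁻¹]) : sharpValues (piOp u₀ f) = piFun (sharpValues f) := by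
  ext n
  rw [piFun_apply, sharpValues, generic_u₀_v₀.evalAt_piOp_sharp]
  rfl

theorem sharpValues_X (f : Kqt[T;T⁻¹]) : sharpValues (T 1 * f) = xFun (sharpValues f) := by
  ext n
  rw [xFun_apply, sharpValues, evalAt_mul (qSharp_ne_zero n), evalAt_T, zpow_one]
  rfl

/-- The values of ε_n^* are the conjugates of those of ε_n at the points m_♯, so the adjoints of T',
X' and π act on the values of ε_n. -/
theorem FBullet_eq (f : Fun) (n : ℤ) :
    FBullet f n = formBullet f (sharpValues (epsPoly u₀ v₀ n)) := by
  simp only [FBullet, formBullet, evalAt_starL]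
  rfl

/-- Moving T' to ε_n gives T̂^{-1}ε_n = A_n ε_{-n} + (B_n - t^{1/2} + t^{-1/2}) ε_n; conjugating the
coefficients restores A_n and B_n. -/
theorem FBullet_tFun {f : Fun} (hf : f.support.Finite) : FBullet (tFun f) = tFun (FBullet f) := by
  ext n
  have e : tFun (sharpValues (epsPoly u₀ v₀ n)) - (v₀ - v₀⁻¹) • sharpValues (epsPoly u₀ v₀ n)
      = tA u₀ v₀ n • sharpValues (epsPoly u₀ v₀ (-n))
        + (tB u₀ v₀ n - (v₀ - v₀⁻¹)) • sharpValues (epsPoly u₀ v₀ n) := by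
    rw [← sharpValues_tOp, generic_u₀_v₀.tOp_epsPoly, sharpValues_add, sharpValues_smul,
      sharpValues_smul, sub_smul (tB u₀ v₀ n), add_sub_assoc]
  rw [tFun_apply, FBullet_eq, FBullet_eq, FBullet_eq, formBullet_t hf, e,
    formBullet_add_right hf, formBullet_smul_right, formBullet_smul_right, starK_tA, map_sub,
    starK_tB, map_sub, map_inv₀, starK_v₀, inv_inv]
  ring

theorem FBullet_xFun_tFun {f : Fun} (hf : f.support.Finite) :
    FBullet (xFun (tFun f)) = piFun (FBullet f) := by
  ext n
  have e := generic_u₀_v₀.X_mul_tOp_epsPoly (1 - n)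
  rw [sub_sub_cancel] at e
  rw [piFun_apply, FBullet_eq, FBullet_eq, ← e, sharpValues_X, sharpValues_tOp, formBullet_x,
    formBullet_t_t hf]

/-- This is σ^{-1}(π) = X⁻¹T⁻¹ = TX. -/
theorem FBullet_piFun {f : Fun} (hf : f.support.Finite) :
    FBullet (piFun f) = tFun (xFun (FBullet f)) := by
  ext n
  have h := generic_u₀_v₀
  rw [tFun_apply, xFun_apply, xFun_apply, FBullet_eq, formBullet_pi, ← sharpValues_piOp,
    h.piOp_epsPoly, h.tOp_epsPoly, sharpValues_smul, sharpValues_add, sharpValues_smul,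
    sharpValues_smul, formBullet_smul_right, formBullet_add_right hf, formBullet_smul_right,
    formBullet_smul_right, ← FBullet_eq, ← FBullet_eq, starK_tA, starK_tB, ← h.sq_mul_tB,
    starK_qSharp]
  have hx := h.qSharp_ne n
  rcases eq_or_ne n 0 with rfl | hn
  · rw [tA_zero]
    field_simp
    ring
  · rw [qSharp_neg_eq hn]
    field_simp

/-- `F_•` induces `σ^{-1}`. -/
theorem FBullet_funRep (H : HH) {f : Fun} (hf : f.support.Finite) :
    FBullet (funRep H f) = funRep (sigma.symm H) (FBullet f) := by
  let S : Submodule Kqt Fun :=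
    { carrier := {f | f.support.Finite}
      add_mem' := fun hf hg => (hf.union hg).subset (Function.support_add _ _)
      zero_mem' := by simp
      smul_mem' := fun c f hf => hf.subset (Function.support_const_smul_subset c f) }
  have hTi : ∀ f ∈ S, FBullet (funRep (tH⁻¹ : HHˣ) f) = funRep (tH⁻¹ : HHˣ) (FBullet f) := by
    intro f hf
    have h1 := FBullet_tFun (funRep_finite (tH⁻¹ : HHˣ) hf)
    rw [← funRep_t, ← funRep_t, rep_apply_inv] at h1
    rw [h1, rep_inv_apply]
  refine intertwine funRep (funRep.comp (sigma.symm : HH →ₐ[Kqt] HH)) S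
    (fun H f hf => funRep_finite H hf) FBullet (fun f hf g hg => ?_) (fun c f hf => ?_)
    (fun f hf => ?_) (fun f hf => ?_) (fun f hf => ?_) H f hf
  · ext n
    rw [Pi.add_apply, FBullet_eq, FBullet_eq, FBullet_eq, formBullet_add_left hf hg]
  · ext n
    rw [Pi.smul_apply, FBullet_eq, FBullet_eq, formBullet_smul_left, smul_eq_mul]
  · rw [funRep_t, FBullet_tFun hf, ← funRep_t]
    exact congrArg (fun a => funRep a (FBullet f)) sigma_symm_t.symm
  -- From σ(Y) = XT² and σ(T) = T one gets σ^{-1}(X) = YT⁻².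
  · have h1 : funRep (sigma.symm xH) (FBullet f)
        = funRep (yH * (tH⁻¹ * tH⁻¹) : HHˣ) (FBullet f) := by
      congr 2
      rw [AlgEquiv.symm_apply_eq, Units.val_mul, map_mul, sigma_y]
      have h2 : sigma (tH⁻¹ : HHˣ) = (tH⁻¹ : HHˣ) := by
        have h : unitMap (sigma : HH →ₐ[Kqt] HH) tH = tH := Units.ext sigma_t
        have h3 := congrArg (fun a : HHˣ => ((a⁻¹ : HHˣ) : HH)) h
        simp only [← map_inv] at h3
        exact h3
      rw [Units.val_mul tH⁻¹ tH⁻¹, map_mul, h2, ← Units.val_mul, ← Units.val_mul]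
      congr 1
      group
    refine Eq.trans ?_ h1.symm
    have h4 := FBullet_xFun_tFun (funRep_finite (tH⁻¹ : HHˣ) hf)
    rw [← funRep_t, rep_apply_inv, hTi f hf] at h4
    rw [funRep_x, h4, Units.val_mul, Units.val_mul, map_mul, map_mul, Module.End.mul_apply,
      Module.End.mul_apply, funRep_y, ← funRep_t, rep_apply_inv]
  · have h1 : funRep (sigma.symm yH) (FBullet f) = funRep (xH⁻¹ : HHˣ) (FBullet f) := by
      rw [sigma_symm_y]
    refine Eq.trans ?_ h1.symm
    have h2 : funRep xH (FBullet (funRep yH f)) = FBullet f := by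
      rw [funRep_y, funRep_x, FBullet_piFun (finite_support_tFun hf), FBullet_tFun hf,
        tFun_X_tFun]
    rw [← h2, rep_inv_apply]

end FBullet

/-! ### The matrix `ε_n(m_♯)` and abstract Gaussian functionals. -/

section SphericalMatrix

variable {K : Type*} [Field K] {u v : K} (h : Generic u v)

include h in
/-- The matrix `ε_n(m_♯)` is determined up to a factor by the actions of `T` and `s p` on both
indices. -/
theorem Generic.eq_const_mul_evalAt {Ξ : ℤ → ℤ → K} {c : K} (h0 : ∀ m, Ξ m 0 = c)
    (hb : ∀ m n, tA u v n * Ξ m (-n) + tB u v n * Ξ m n = tA u v m * Ξ (-m) n + tB u v m * Ξ m n)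
    (ha : ∀ m n, Ξ m n
      = qSharp u v m * (tA u v m * Ξ (-m) (1 - n) + tB u v m * Ξ m (1 - n))) (n : ℤ) :
    ∀ m, Ξ m n = c * evalAt (qSharp u v m) (epsPoly u v n) := by
  induction n using sharp_induction with
  | h0 => intro m; rw [h0, h.epsPoly_zero, evalAt_one, mul_one]
  | h1 n hn ih =>
    intro m
    rw [ha, sub_sub_cancel, ih, ih, ← h.X_mul_tOp_epsPoly, evalAt_mul (h.qSharp_ne m), evalAt_T,
      zpow_one, h.evalAt_tOp_sharp]
    ring
  | h2 n hn ih =>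
    intro m
    have h1 := hb m n
    have h2 := congrArg (evalAt (qSharp u v m)) (h.tOp_epsPoly n)
    rw [h.evalAt_tOp_sharp, evalAt_add, evalAt_smul, evalAt_smul] at h2
    rw [ih, ih] at h1
    -- Column -n is recovered from column n because A_n ≠ 0.
    apply mul_left_cancel₀ (h.tA_ne hn.ne')
    linear_combination h1 + c * h2

theorem divDiff_sOp (f : K[T;T⁻¹]) : divDiff (sOp f) = -divDiff f := by
  apply T_two_sub_one_mul_cancel
  have h := divDiff_spec f
  have h2 := divDiff_spec (sOp f)
  rw [sOp_sOp] at h2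
  linear_combination h + h2

/-- Conjugation by s turns T̂ for t⁻¹ into T̂^{-1} for t. This transfers the relations for the
inverted parameters to ε_n^*. -/
theorem tOp_sOp (v : K) (f : K[T;T⁻¹]) :
    tOp v (sOp f) = sOp (tOp v⁻¹ f) + (v - v⁻¹) • sOp f := by
  have h := divDiff_spec f
  rw [tOp_apply, tOp_apply, sOp_sOp, divDiff_sOp, map_add, map_smul, map_smul, sOp_sOp,
    sOp_divDiff, sub_eq_iff_eq_add.mp h.symm, inv_inv]
  simp only [LaurentPolynomial.smul_eq_C_mul, map_sub]
  ring

theorem piOp_sOp (u : K) (f : K[T;T⁻¹]) : piOp u (sOp f) = sOp (piOp u⁻¹ f) := by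
  have : piOp u ∘ₗ sOp = (sOp ∘ₗ piOp u⁻¹ : K[T;T⁻¹] →ₗ[K] K[T;T⁻¹]) := laurent_ext fun n => by
    simp [piOp_T]
  exact congrArg (fun L : K[T;T⁻¹] →ₗ[K] K[T;T⁻¹] => L f) this

theorem invert_eq_sOp (f : K[T;T⁻¹]) : LaurentPolynomial.invert f = sOp f := by
  have : (sOp : K[T;T⁻¹] →ₗ[K] K[T;T⁻¹]) = LaurentPolynomial.invert.toLinearMap :=
    laurent_ext fun n => by simp [sOp]
  rw [this]; rfl

theorem qSharp_inv_inv (u v : K) (n : ℤ) : qSharp u⁻¹ v⁻¹ n = (qSharp u v n)⁻¹ := by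
  rw [qSharp, qSharp, mul_inv, inv_zpow]
  congr 1
  split_ifs <;> simp

include h in
-- For numerical q, t the involution need not exist on the field of constants, so `starK_tA` is
-- replaced by inversion of the parameters.
theorem Generic.tA_inv_inv (n : ℤ) : tA u⁻¹ v⁻¹ n = tA u v n := by
  rw [tA, tA]
  split_ifs with hn
  · rfl
  · have h1 := h.qSharp_sq_sub_one_ne hn
    have h0 := h.qSharp_ne n
    rw [qSharp_inv_inv, inv_inv]
    have e3 : (qSharp u v n)⁻¹ ^ 2 - 1 = -(qSharp u v n ^ 2 - 1) / qSharp u v n ^ 2 := by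
      field_simp
      ring
    rw [e3]
    generalize v⁻¹ = v'
    field_simp
    ring

include h in
theorem Generic.tB_inv_inv (n : ℤ) : tB u⁻¹ v⁻¹ n = tB u v n - (v - v⁻¹) := by
  rw [tB, tB]
  split_ifs with hn
  · ring
  · have h1 := h.qSharp_sq_sub_one_ne hn
    have h0 := h.qSharp_ne n
    rw [qSharp_inv_inv, inv_inv]
    have e3 : (qSharp u v n)⁻¹ ^ 2 - 1 = -(qSharp u v n ^ 2 - 1) / qSharp u v n ^ 2 := by
      field_simp
      ring
    rw [e3]
    generalize v⁻¹ = v'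
    field_simp
    ring

/-- The polynomials `ε_n^*`. -/
def epsStar (u v : K) (n : ℤ) : K[T;T⁻¹] := sOp (epsPoly u⁻¹ v⁻¹ n)

include h in
theorem Generic.epsStar_zero : epsStar u v 0 = 1 := by
  rw [epsStar, h.inv.epsPoly_zero, ← LaurentPolynomial.T_zero, sOp_T, neg_zero]

include h in
-- The shift of B_n under inversion of the parameters cancels the difference between T̂ and T̂^{-1},
-- so ε_n^* satisfies the same relation as ε_n.
theorem Generic.tOp_epsStar (n : ℤ) :
    tOp v (epsStar u v n) = tA u v n • epsStar u v (-n) + tB u v n • epsStar u v n := by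
  rw [epsStar, tOp_sOp, h.inv.tOp_epsPoly, h.tA_inv_inv, h.tB_inv_inv, map_add, map_smul, map_smul,
    add_assoc, ← add_smul, sub_add_cancel]
  rfl

include h in
theorem Generic.X_inv_mul_piOp_epsStar (n : ℤ) :
    T (-1) * piOp u (epsStar u v n) = (qSharp u v n)⁻¹ • epsStar u v (1 - n) := by
  rw [epsStar, piOp_sOp, h.inv.piOp_epsPoly, epsStar, ← h.inv.X_mul_tOp_epsPoly, sOp_mul, sOp_T,
    map_smul, qSharp_inv_inv, mul_smul_comm]

/-! ### Gaussian functionals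

The two functionals `⟨f γ̃^{-1}⟩_∘` and `⟨f γ⟩_•` on Laurent polynomials are characterized by their
behaviour under `T` and `s p`; here `g_m = q^{m_♯² - k²/4}`. -/

/-- The normalizing factors `g_m = q^{(m² + 2k|m|)/4}`. -/
structure IsGaussWeight (u v : K) (g : ℤ → K) : Prop where
  ne : ∀ m, g m ≠ 0
  zero : g 0 = 1
  neg : ∀ m, g (-m) = g m
  one_sub : ∀ m, u * g m = qSharp u v m * g (1 - m)

include h in
-- Pairing T̂ε_m with 1 gives A_m Λ(ε_{-m}) + B_m Λ(ε_m) = v Λ(ε_m), and v = A_m + B_m.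
theorem Generic.apply_epsPoly_neg {Λ : K[T;T⁻¹] →ₗ[K] K} (hT : TSelfAdjoint v Λ) {m : ℤ}
    (hm : m ≠ 0) : Λ (epsPoly u v (-m)) = Λ (epsPoly u v m) := by
  have h1 := hT.tOp_mul (epsPoly u v m) 1
  rw [tOp_one, mul_one, mul_smul_comm, mul_one, h.tOp_epsPoly, map_add, map_smul, map_smul,
    map_smul, smul_eq_mul, smul_eq_mul, smul_eq_mul] at h1
  apply mul_left_cancel₀ (h.tA_ne hm)
  linear_combination h1 - Λ (epsPoly u v m) * h.tA_add_tB m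

include h in
-- Self-adjointness makes T act equally on the row and the column index; η stands for ε or ε^*.
theorem Generic.tSelfAdjoint_matrix {Λ : K[T;T⁻¹] →ₗ[K] K} (hT : TSelfAdjoint v Λ)
    {η : ℤ → K[T;T⁻¹]} (hη : ∀ n, tOp v (η n) = tA u v n • η (-n) + tB u v n • η n) (m n : ℤ) :
    tA u v n * Λ (epsPoly u v m * η (-n)) + tB u v n * Λ (epsPoly u v m * η n)
      = tA u v m * Λ (epsPoly u v (-m) * η n) + tB u v m * Λ (epsPoly u v m * η n) := by
  have h1 := hT.tOp_mul (epsPoly u v m) (η n)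
  rw [h.tOp_epsPoly, hη, add_mul, mul_add, smul_mul_assoc, smul_mul_assoc, mul_smul_comm,
    mul_smul_comm, map_add, map_add, map_smul, map_smul, map_smul, map_smul] at h1
  exact h1.symm

include h in
/-- The functional `⟨f γ̃^{-1}⟩_∘`. -/
theorem Generic.gauss_circ_formula {g : ℤ → K} (hg : IsGaussWeight u v g) {Λ : K[T;T⁻¹] →ₗ[K] K}
    (hT : TSelfAdjoint v Λ) (hπ : ∀ f, u * Λ f = Λ (T 1 * piOp u f)) (m n : ℤ) :
    Λ (epsPoly u v m * epsPoly u v n)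
      = g m * g n * evalAt (qSharp u v m) (epsPoly u v n) * Λ 1 := by
  have hu := h.u_ne
  have hv := h.v_ne
  -- π multiplies each factor by q^{m_♯} or q^{n_♯} and applies T̂ to it; the extra X turns T̂ε_n
  -- into ε_{1-n}.
  have ha : ∀ m n, u * Λ (epsPoly u v m * epsPoly u v n)
      = qSharp u v m * qSharp u v n * (tA u v m * Λ (epsPoly u v (-m) * epsPoly u v (1 - n))
        + tB u v m * Λ (epsPoly u v m * epsPoly u v (1 - n))) := by
    intro m n
    have e : T 1 * piOp u (epsPoly u v m * epsPoly u v n)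
        = (qSharp u v m * qSharp u v n) • (tA u v m • (epsPoly u v (-m) * epsPoly u v (1 - n))
          + tB u v m • (epsPoly u v m * epsPoly u v (1 - n))) := by
      rw [piOp_mul hu, h.piOp_epsPoly, h.piOp_epsPoly, smul_mul_smul_comm, mul_smul_comm,
        mul_left_comm, h.X_mul_tOp_epsPoly, h.tOp_epsPoly, add_mul, smul_mul_assoc, smul_mul_assoc]
    rw [hπ, e, map_smul, map_add, map_smul, map_smul]
    simp only [smul_eq_mul]
  have h0 : ∀ m, Λ (epsPoly u v m) = g m * Λ 1 := by
    intro m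
    induction m using sharp_induction with
    | h0 => rw [h.epsPoly_zero, hg.zero, one_mul]
    | h1 m hm ih =>
      have h1 := ha 0 m
      rw [h.epsPoly_zero, one_mul, one_mul, tA_zero, tB_zero, zero_mul, zero_add, qSharp_at_zero,
        ih] at h1
      have h2 := hg.one_sub m
      apply mul_left_cancel₀ (h.qSharp_ne m)
      have h3 : v⁻¹ * v = 1 := inv_mul_cancel₀ hv
      linear_combination -h1 + h2 * Λ 1
        - qSharp u v m * Λ (epsPoly u v (1 - m)) * h3
    | h2 m hm ih => rw [h.apply_epsPoly_neg hT hm.ne', ih, hg.neg]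
  have key := h.eq_const_mul_evalAt (c := Λ 1)
    (Ξ := fun m n => (g m)⁻¹ * (g n)⁻¹ * Λ (epsPoly u v m * epsPoly u v n)) ?_ ?_ ?_ n m
  · have h1 := hg.ne m
    have h2 := hg.ne n
    field_simp at key
    linear_combination key
  · intro m
    have h1 := hg.ne m
    rw [h.epsPoly_zero, mul_one, h0, hg.zero]
    field_simp
  · intro m n
    simp only [hg.neg]
    linear_combination ((g m)⁻¹ * (g n)⁻¹) * h.tSelfAdjoint_matrix hT h.tOp_epsPoly m n
  · intro m n
    have h1 := hg.ne m
    have h2 := hg.ne n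
    have h3 := hg.ne (1 - n)
    have h4 := hg.one_sub n
    have h5 := ha m n
    simp only [hg.neg]
    apply mul_left_cancel₀ hu
    have e : u * (g (1 - n))⁻¹ = qSharp u v n * (g n)⁻¹ := by
      field_simp
      linear_combination h4
    linear_combination (g m)⁻¹ * (g n)⁻¹ * h5 - qSharp u v m * (g m)⁻¹ *
      (tA u v m * Λ (epsPoly u v (-m) * epsPoly u v (1 - n))
        + tB u v m * Λ (epsPoly u v m * epsPoly u v (1 - n))) * e

include h in
/-- The functional `⟨f γ⟩_•`. -/
theorem Generic.gauss_bullet_formula {g : ℤ → K} (hg : IsGaussWeight u v g)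
    {Λ : K[T;T⁻¹] →ₗ[K] K} (hT : TSelfAdjoint v Λ)
    (hπ : ∀ f, Λ f = u * Λ (T (-1) * piOp u f)) (m n : ℤ) :
    Λ (epsPoly u v m * epsStar u v n)
      = (g m * g n)⁻¹ * evalAt (qSharp u v m) (epsPoly u v n) * Λ 1 := by
  have hu := h.u_ne
  have hv := h.v_ne
  have ha : ∀ m n, Λ (epsPoly u v m * epsStar u v n)
      = u * qSharp u v m * (qSharp u v n)⁻¹ *
        (tA u v m * Λ (epsPoly u v (-m) * epsStar u v (1 - n))
        + tB u v m * Λ (epsPoly u v m * epsStar u v (1 - n))) := by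
    intro m n
    have e : T (-1) * piOp u (epsPoly u v m * epsStar u v n)
        = (qSharp u v m * (qSharp u v n)⁻¹) •
          (tA u v m • (epsPoly u v (-m) * epsStar u v (1 - n))
          + tB u v m • (epsPoly u v m * epsStar u v (1 - n))) := by
      rw [piOp_mul hu, mul_left_comm, h.X_inv_mul_piOp_epsStar, h.piOp_epsPoly,
        smul_mul_smul_comm, h.tOp_epsPoly, add_mul, smul_mul_assoc, smul_mul_assoc]
    rw [hπ, e, map_smul, map_add, map_smul, map_smul]
    simp only [smul_eq_mul]
    ring
  -- In column n = 0 the relation `ha` would lead to column 1. Instead `hπ` is applied to πε_m, with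
  -- X⁻¹ε_m = T̂ε_{1-m} and Λ ∘ T̂ = vΛ.
  have hstep : ∀ m, u * Λ (epsPoly u v (1 - m)) = qSharp u v m * Λ (epsPoly u v m) := by
    intro m
    have h1 := h.X_mul_tOp_epsPoly (1 - m)
    rw [sub_sub_cancel] at h1
    have h2 : tOp v (epsPoly u v (1 - m)) = T (-1) * epsPoly u v m := by
      rw [← h1, ← mul_assoc, T_mul_T', neg_add_cancel, LaurentPolynomial.T_zero, one_mul]
    have h3 : ∀ f, Λ (tOp v f) = v * Λ f := fun f => by
      have := hT.tOp_mul f 1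
      rwa [tOp_one, mul_one, mul_smul_comm, mul_one, map_smul, smul_eq_mul] at this
    have h4 := hπ (piOp u (epsPoly u v m))
    rw [piOp_piOp hu, ← h2, h3, h.piOp_epsPoly, map_smul, h3, smul_eq_mul] at h4
    apply mul_left_cancel₀ hv
    linear_combination -h4
  have h0 : ∀ m, g m * Λ (epsPoly u v m) = Λ 1 := by
    intro m
    induction m using sharp_induction with
    | h0 => rw [h.epsPoly_zero, hg.zero, one_mul]
    | h1 m hm ih =>
      apply mul_left_cancel₀ hu
      linear_combination g (1 - m) * hstep m - Λ (epsPoly u v m) * hg.one_sub m + u * ih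
    | h2 m hm ih => rw [h.apply_epsPoly_neg hT hm.ne', hg.neg, ih]
  have key := h.eq_const_mul_evalAt (c := Λ 1)
    (Ξ := fun m n => g m * g n * Λ (epsPoly u v m * epsStar u v n)) ?_ ?_ ?_ n m
  · have h1 := hg.ne m
    have h2 := hg.ne n
    field_simp
    linear_combination key
  · intro m
    rw [h.epsStar_zero, mul_one, hg.zero, mul_one, h0]
  · intro m n
    simp only [hg.neg]
    linear_combination (g m * g n) * h.tSelfAdjoint_matrix hT h.tOp_epsStar m n
  · intro m n
    have h4 := hg.one_sub n
    have hx := h.qSharp_ne n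
    have e : u * g n * (qSharp u v n)⁻¹ = g (1 - n) := by
      rw [h4]
      field_simp
    simp only [hg.neg]
    rw [ha m n]
    linear_combination (g m * qSharp u v m *
      (tA u v m * Λ (epsPoly u v (-m) * epsStar u v (1 - n))
        + tB u v m * Λ (epsPoly u v m * epsStar u v (1 - n)))) * e

end SphericalMatrix

/-! ## Numerical parameters -/

section Powers

variable {q : ℝ} (hq : 0 < q)
include hq

theorem qpow_add (a b : ℂ) : qpow q (a + b) = qpow q a * qpow q b :=
  Complex.cpow_add _ _ (Complex.ofReal_ne_zero.mpr hq.ne')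

theorem qpow_ne (a : ℂ) : qpow q a ≠ 0 := by
  rw [qpow, Complex.cpow_ne_zero_iff]
  exact Or.inl (Complex.ofReal_ne_zero.mpr hq.ne')

omit hq in
theorem qpow_neg (a : ℂ) : qpow q (-a) = (qpow q a)⁻¹ := Complex.cpow_neg _ _

omit hq in
theorem qpow_pow (a : ℂ) (n : ℕ) : qpow q a ^ n = qpow q (n * a) := by
  rw [qpow, qpow, ← Complex.cpow_nat_mul]

omit hq in
theorem qpow_zpow (a : ℂ) (n : ℤ) : qpow q a ^ n = qpow q (n * a) := by
  rw [qpow, qpow, ← Complex.cpow_int_mul]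

theorem norm_qpow (a : ℂ) : ‖qpow q a‖ = q ^ a.re := Complex.norm_cpow_eq_rpow_re_of_pos hq a

omit hq in
theorem uNum_pow_four : uNum q ^ 4 = q := by
  rw [uNum, qpow_pow, qpow]
  norm_num

theorem qSharp_num (k : ℂ) (n : ℤ) : qSharp (uNum q) (vNum q k) n = qpow q (sharp k n) := by
  have e : uNum q ^ (2 * n) = qpow q (n / 2) := by
    rw [uNum, qpow_zpow]
    congr 1
    push_cast
    ring
  rw [qSharp, e, sharp, vNum]
  split_ifs
  · rw [← qpow_add hq]
    congr 1
    ring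
  · rw [← qpow_neg, ← qpow_add hq]
    congr 1
    ring

theorem generic_num (hq1 : q < 1) {k : ℂ} (hk : ∀ j : ℕ, 1 ≤ j → qpow q (2 * k + j) ≠ 1) :
    Generic (uNum q) (vNum q k) where
  u_ne := qpow_ne hq _
  v_ne := qpow_ne hq _
  q_pow j hj := by
    rw [uNum_pow_four]
    have h1 : q ^ j < 1 := pow_lt_one₀ hq.le hq1 (by omega)
    exact_mod_cast h1.ne
  t_pow j hj := by
    have e : vNum q k ^ 4 * (uNum q ^ 4) ^ j = qpow q (2 * k + j) := by
      rw [qpow_add hq, uNum_pow_four, vNum, qpow_pow, qpow, qpow, qpow, Complex.cpow_natCast]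
      congr 2
      push_cast
      ring
    rw [e]
    exact hk j hj

/-- `g_m = q^{(m² + 2k|m|)/4}`. -/
def gaussWeight (q : ℝ) (k : ℂ) (m : ℤ) : ℂ := qpow q ((m ^ 2 + 2 * k * ((|m| : ℤ) : ℂ)) / 4)

theorem isGaussWeight_num (k : ℂ) :
    IsGaussWeight (uNum q) (vNum q k) (gaussWeight q k) where
  ne m := qpow_ne hq _
  zero := by simp [gaussWeight, qpow]
  neg m := by simp [gaussWeight]
  one_sub m := by
    rw [qSharp_num hq, gaussWeight, gaussWeight, uNum, ← qpow_add hq, ← qpow_add hq, sharp]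
    congr 1
    split_ifs with hm
    · rw [abs_of_pos hm, abs_of_nonpos (by omega)]
      push_cast
      ring
    · rw [abs_of_nonpos (by omega), abs_of_pos (by omega)]
      push_cast
      ring

end Powers

/-! ### Absolute convergence of the Gaussian sums. -/

section Convergence

variable {q : ℝ} (hq : 0 < q) (hq1 : q < 1)
include hq hq1

/-- The terms are those of a Jacobi theta series: τ gives exp(πi j²τ) = q^{j²/4} and z gives exp(2πi
jz) = R^j, with Im τ > 0 because q < 1. -/
theorem summable_gauss_zpow {R : ℝ} (hR : 0 < R) :
    Summable fun j : ℤ => q ^ ((j : ℝ) ^ 2 / 4) * R ^ j := by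
  have hlog : Real.log q < 0 := Real.log_neg hq hq1
  set τ : ℂ := Complex.I * (-(Real.log q) / (4 * Real.pi) : ℝ) with hτ
  set z : ℂ := -Complex.I * (Real.log R / (2 * Real.pi) : ℝ) with hz
  have hpi : (Real.pi : ℂ) ≠ 0 := Complex.ofReal_ne_zero.mpr Real.pi_ne_zero
  have him : 0 < τ.im := by
    rw [hτ, Complex.im_mul_ofReal, Complex.I_im, one_mul]
    have := Real.pi_pos
    apply div_pos <;> linarith
  have h := ((summable_jacobiTheta₂_term_iff z τ).mpr him).norm
  refine h.congr fun j => ?_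
  have e : jacobiTheta₂_term j z τ
      = ((Real.exp (Real.log q * ((j : ℝ) ^ 2 / 4) + j * Real.log R) : ℝ) : ℂ) := by
    rw [jacobiTheta₂_term, Complex.ofReal_exp]
    congr 1
    rw [hτ, hz]
    push_cast
    field_simp
    ring_nf
    rw [Complex.I_sq]
    ring
  rw [e, Complex.norm_real, Real.norm_of_nonneg (Real.exp_pos _).le, Real.exp_add,
    Real.rpow_def_of_pos hq]
  congr 1
  rw [← Real.rpow_intCast, Real.rpow_def_of_pos hR, mul_comm]

theorem summable_of_gauss_bound {f : ℤ → ℂ} {C R : ℝ} (hR : 1 ≤ R)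
    (hf : ∀ j, ‖f j‖ ≤ C * (q ^ ((j : ℝ) ^ 2 / 4) * R ^ j.natAbs)) : Summable f := by
  have hR0 : 0 < R := by linarith
  have hC : 0 ≤ C := by
    have := (norm_nonneg _).trans (hf 0)
    simpa using this
  have h1 := summable_gauss_zpow hq hq1 hR0
  have h2 := summable_gauss_zpow hq hq1 (inv_pos.mpr hR0)
  refine Summable.of_norm_bounded ((h1.add h2).mul_left C) fun j => (hf j).trans ?_
  rw [← mul_add]
  have hq2 : 0 ≤ q ^ ((j : ℝ) ^ 2 / 4) := Real.rpow_nonneg hq.le _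
  have hz1 : 0 ≤ R ^ j := zpow_nonneg hR0.le _
  have hz2 : 0 ≤ R⁻¹ ^ j := zpow_nonneg (inv_nonneg.mpr hR0.le) _
  have : R ^ j.natAbs ≤ R ^ j + R⁻¹ ^ j := by
    rcases le_total 0 j with hj | hj
    · have e : R ^ j.natAbs = R ^ j := by
        rw [← zpow_natCast]
        congr 1
        omega
      rw [e]
      linarith
    · have e : R ^ j.natAbs = R⁻¹ ^ j := by
        rw [inv_zpow, ← zpow_neg, ← zpow_natCast]
        congr 1
        omega
      rw [e]
      linarith
  gcongr

omit hq hq1 in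
-- A convergent sequence is bounded, so its partial products grow at most geometrically. The factors
-- of the coefficients of μ_∘ tend to t and those of μ_• to t⁻¹.
theorem exists_prod_bound {f : ℕ → ℂ} {c : ℂ} (hf : Filter.Tendsto f Filter.atTop (nhds c)) :
    ∃ R : ℝ, 1 ≤ R ∧ ∀ n, ‖∏ l ∈ Finset.range n, f l‖ ≤ R ^ n := by
  obtain ⟨B, hB⟩ := (Metric.isBounded_range_of_tendsto f hf).exists_norm_le
  refine ⟨max 1 B, le_max_left _ _, fun n => ?_⟩
  rw [norm_prod]
  refine (Finset.prod_le_prod (fun _ _ => norm_nonneg _) fun l _ =>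
    (hB _ ⟨l, rfl⟩).trans (le_max_right 1 B)).trans (by simp)

theorem tendsto_num_pow : Filter.Tendsto (fun l : ℕ => (q : ℂ) ^ l) Filter.atTop (nhds 0) := by
  apply tendsto_pow_atTop_nhds_zero_of_norm_lt_one
  rwa [Complex.norm_real, Real.norm_of_nonneg hq.le]

variable {k : ℂ} (hk : ∀ j : ℕ, 1 ≤ j → qpow q (2 * k + j) ≠ 1)
include hk

theorem muCirc_bound : ∃ R : ℝ, 1 ≤ R ∧
    ∀ m : ℤ, ‖muCirc (uNum q ^ 4) (vNum q k ^ 2) m‖ ≤ R ^ m.natAbs := by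
  have h := generic_num hq hq1 hk
  have h0 := tendsto_num_pow hq hq1
  have h1 : Filter.Tendsto (fun l : ℕ => (vNum q k ^ 2 - (uNum q ^ 4) ^ l)
      / (1 - vNum q k ^ 2 * (uNum q ^ 4) ^ (l + 1))) Filter.atTop
      (nhds ((vNum q k ^ 2 - 0) / (1 - vNum q k ^ 2 * 0))) := by
    rw [uNum_pow_four]
    refine (tendsto_const_nhds.sub h0).div (tendsto_const_nhds.sub
      (tendsto_const_nhds.mul ((Filter.tendsto_add_atTop_iff_nat 1).mpr h0))) (by simp)
  obtain ⟨R, hR, hb⟩ := exists_prod_bound h1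
  refine ⟨R, hR, fun m => ?_⟩
  have hle : ∀ i : ℕ, ‖muRatio (uNum q ^ 4) (vNum q k ^ 2) i‖ ≤ R ^ (2 * i) := fun i =>
    (hb i).trans (pow_le_pow_right₀ hR (by omega))
  obtain ⟨j, rfl | rfl⟩ := m.even_or_odd'
  · obtain ⟨i, rfl | rfl⟩ := j.eq_nat_or_neg
    · rw [muCirc_even h.mu_regular]
      convert hle i using 2
      omega
    · rw [mul_neg, muCirc_neg_even h.mu_regular, norm_mul]
      have e : (-(2 * (i : ℤ))).natAbs = 2 * i := by omega
      rw [e, ← one_mul (R ^ (2 * i))]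
      refine mul_le_mul ?_ (hle i) (norm_nonneg _) zero_le_one
      rw [uNum_pow_four, norm_pow, Complex.norm_real, Real.norm_of_nonneg hq.le]
      exact pow_le_one₀ hq.le hq1.le
  · rw [muCirc_odd, norm_zero]
    positivity

theorem muBullet_bound : ∃ R : ℝ, 1 ≤ R ∧
    ∀ m : ℤ, ‖muBullet (uNum q) (vNum q k) m‖ ≤ R ^ m.natAbs := by
  have h := generic_num hq hq1 hk
  have h0 := (Filter.tendsto_add_atTop_iff_nat 1).mpr (tendsto_num_pow hq hq1)
  have h1 : Filter.Tendsto (fun l : ℕ => (vNum q k ^ 2)⁻¹ *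
      ((1 - (vNum q k ^ 2) ^ 2 * (uNum q ^ 4) ^ (l + 1)) / (1 - (uNum q ^ 4) ^ (l + 1))))
      Filter.atTop (nhds ((vNum q k ^ 2)⁻¹ * ((1 - (vNum q k ^ 2) ^ 2 * 0) / (1 - 0)))) := by
    rw [uNum_pow_four]
    exact tendsto_const_nhds.mul ((tendsto_const_nhds.sub (tendsto_const_nhds.mul h0)).div
      (tendsto_const_nhds.sub h0) (by simp))
  obtain ⟨R, hR, hb⟩ := exists_prod_bound h1
  refine ⟨R, hR, fun m => ?_⟩
  have e : ∀ N : ℕ, ((vNum q k ^ 2) ^ N)⁻¹ * ∏ j ∈ Finset.Icc 1 N,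
      (1 - (vNum q k ^ 2) ^ 2 * (uNum q ^ 4) ^ j) / (1 - (uNum q ^ 4) ^ j)
      = ∏ l ∈ Finset.range N, (vNum q k ^ 2)⁻¹ *
      ((1 - (vNum q k ^ 2) ^ 2 * (uNum q ^ 4) ^ (l + 1)) / (1 - (uNum q ^ 4) ^ (l + 1))) := by
    intro N
    rw [Finset.prod_mul_distrib, Finset.prod_const, Finset.card_range, inv_pow,
      Finset.range_eq_Ico, Finset.prod_Ico_add' (fun j => (1 - (vNum q k ^ 2) ^ 2 *
        (uNum q ^ 4) ^ j) / (1 - (uNum q ^ 4) ^ j)) 0 N 1]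
    rfl
  simp only [muBullet, e]
  refine (hb _).trans (pow_le_pow_right₀ hR ?_)
  split_ifs <;> omega

end Convergence

/-! ## The Gaussian functionals -/

theorem hasSum_functional {a : ℤ → ℤ → ℂ} {F : ℤ → ℂ} (h : ∀ i, HasSum (a i) (F i))
    (f : ℂ[T;T⁻¹]) : HasSum (fun j => f.coeff.sum fun i c => c * a i j) (functional F f) := by
  rw [functional_apply]
  exact hasSum_sum fun i _ => (h i).mul_left _

section GaussFunctionals

variable {q : ℝ} (hq : 0 < q) (hq1 : q < 1) {k : ℂ}
  (hk : ∀ j : ℕ, 1 ≤ j → qpow q (2 * k + j) ≠ 1)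

/-- `⟨X^i γ̃⁻¹⟩_∘`. -/
def gaussCircMoment (q : ℝ) (k : ℂ) (i : ℤ) : ℂ :=
  ∑' l : ℤ, uNum q ^ (l ^ 2) * muCirc (uNum q ^ 4) (vNum q k ^ 2) (-(l + i))

include hq hq1 hk

theorem hasSum_gaussCircMoment (i : ℤ) :
    HasSum (fun l : ℤ => uNum q ^ (l ^ 2) * muCirc (uNum q ^ 4) (vNum q k ^ 2) (-(l + i)))
      (gaussCircMoment q k i) := by
  obtain ⟨R, hR, hb⟩ := muCirc_bound hq hq1 hk
  refine (summable_of_gauss_bound hq hq1 (C := R ^ i.natAbs) hR fun l => ?_).hasSum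
  rw [norm_mul, uNum, qpow_zpow, norm_qpow hq]
  have e : (((l ^ 2 : ℤ) : ℂ) * (1 / 4)).re = (l : ℝ) ^ 2 / 4 := by
    have : ((l ^ 2 : ℤ) : ℂ) * (1 / 4) = (((l : ℝ) ^ 2 / 4 : ℝ) : ℂ) := by
      push_cast
      ring
    rw [this, Complex.ofReal_re]
  have h1 : R ^ (-(l + i)).natAbs ≤ R ^ i.natAbs * R ^ l.natAbs := by
    rw [← pow_add]
    exact pow_le_pow_right₀ hR (by omega)
  have h2 : 0 ≤ q ^ ((l : ℝ) ^ 2 / 4) := Real.rpow_nonneg hq.le _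
  rw [e, mul_left_comm]
  exact mul_le_mul_of_nonneg_left ((hb _).trans h1) h2

/-- The Gaussian is even. Having both summation orders allows the identities for the moments to be
checked term by term. -/
theorem hasSum_gaussCircMoment_neg (i : ℤ) :
    HasSum (fun l : ℤ => uNum q ^ (l ^ 2) * muCirc (uNum q ^ 4) (vNum q k ^ 2) (l - i))
      (gaussCircMoment q k i) := by
  have h := (Equiv.neg ℤ).hasSum_iff.mpr (hasSum_gaussCircMoment hq hq1 hk i)
  refine h.congr_fun fun l => ?_
  rw [Function.comp_apply, Equiv.neg_apply, neg_sq, neg_add, neg_neg, sub_eq_add_neg]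

theorem hasSum_gaussCircTerm (f : ℂ[T;T⁻¹]) :
    HasSum (gaussCircTerm q k f) (functional (gaussCircMoment q k) f) := by
  refine (hasSum_functional (a := fun i j => qpow q (((j - i : ℤ) : ℂ) ^ 2 / 4)
    * muCirc (uNum q ^ 4) (vNum q k ^ 2) (-j)) (fun i => ?_) f).congr_fun fun j => ?_
  · have h := (Equiv.subRight i).hasSum_iff.mpr (hasSum_gaussCircMoment hq hq1 hk i)
    refine h.congr_fun fun j => ?_
    rw [Function.comp_apply, Equiv.subRight_apply, sub_add_cancel, uNum, qpow_zpow]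
    congr 2
    push_cast
    ring
  · rw [gaussCircTerm, gaussMulCoeff, Finsupp.sum_mul]
    simp only [mul_assoc]

/-- The factor γ̃⁻¹ is symmetric, so it keeps the antisymmetry used for μ_∘. One moment in each pair
is summed over -l, which makes every term an instance of `Generic.muCirc_balance`. -/
theorem tSelfAdjoint_gaussCirc : TSelfAdjoint (vNum q k) (functional (gaussCircMoment q k)) := by
  have h := generic_num hq hq1 hk
  have hv := h.v_ne
  refine .of_monomials two_ne_zero fun j => ?_
  simp only [functional_T]
  have h1 := (hasSum_gaussCircMoment hq hq1 hk (1 + j)).add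
    (hasSum_gaussCircMoment_neg hq hq1 hk (1 - j))
  have h2 := (hasSum_gaussCircMoment hq hq1 hk (-1 + j)).add
    (hasSum_gaussCircMoment_neg hq hq1 hk (-1 - j))
  refine (h1.mul_left _).unique ((h2.mul_left _).congr_fun fun l => ?_)
  have hb := h.muCirc_balance (l + j)
  rw [show -(l + (1 + j)) = -1 - (l + j) by ring, show l - (1 - j) = -1 + (l + j) by ring,
    show -(l + (-1 + j)) = 1 - (l + j) by ring, show l - (-1 - j) = 1 + (l + j) by ring,
    ← mul_add, ← mul_add, ← hb]
  field_simp

/-- μ_∘ is invariant under π, and completing the square gives π γ̃⁻¹ = q^{-1/4} X γ̃⁻¹; the shift of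
the index by 1 is this completion. -/
theorem gaussCirc_piOp (f : ℂ[T;T⁻¹]) : uNum q * functional (gaussCircMoment q k) f
    = functional (gaussCircMoment q k) (T 1 * piOp (uNum q) f) := by
  have h := generic_num hq hq1 hk
  have hu := h.u_ne
  have key : uNum q • functional (gaussCircMoment q k)
      = functional (gaussCircMoment q k) ∘ₗ LinearMap.mulLeft ℂ (T 1) ∘ₗ piOp (uNum q) := by
    refine laurent_ext fun i => ?_
    simp only [LinearMap.smul_apply, LinearMap.comp_apply, LinearMap.mulLeft_apply, piOp_T,
      T_mul_T', map_smul, functional_T, smul_eq_mul]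
    have h1 := (Equiv.addRight (1 : ℤ)).hasSum_iff.mpr (hasSum_gaussCircMoment_neg hq hq1 hk i)
    have h2 := hasSum_gaussCircMoment hq hq1 hk (1 + -i)
    refine (h1.mul_left _).unique ((h2.mul_left _).congr_fun fun l => ?_)
    rw [Function.comp_apply, Equiv.coe_addRight, h.muCirc_neg,
      show l + (1 + -i) = l + 1 - i by ring]
    have e : uNum q * uNum q ^ (l + 1) ^ 2
        = (uNum q ^ 2) ^ i * (uNum q ^ l ^ 2 * (uNum q ^ 2) ^ (l + 1 - i)) := by
      have e1 : ∀ n : ℤ, (uNum q ^ 2) ^ n = uNum q ^ (2 * n) := fun n => by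
        rw [zpow_mul, zpow_ofNat]
      rw [e1, e1, ← zpow_add₀ hu, ← zpow_add₀ hu, ← zpow_one_add₀ hu]
      congr 1
      ring
    linear_combination muCirc (uNum q ^ 4) (vNum q k ^ 2) (l + 1 - i) * e
  exact congrArg (fun L : ℂ[T;T⁻¹] →ₗ[ℂ] ℂ => L f) key

omit hq hq1 hk

/-- `⟨X^i γ⟩_•`. -/
def gaussBulletMoment (q : ℝ) (k : ℂ) (i : ℤ) : ℂ :=
  ∑' j : ℤ, qSharp (uNum q) (vNum q k) j ^ i *
    (qpow q (sharp k j ^ 2) * muBullet (uNum q) (vNum q k) j)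

/-- With j_♯ = (j ± k)/2 the exponent is j²/4 plus terms at most linear in |j|; the latter are
absorbed into a geometric factor. -/
theorem gaussian_exponent_bound (k : ℂ) (i j : ℤ) :
    (j : ℝ) ^ 2 / 4 - (|k.re| + |(i : ℝ)|) / 2 * j.natAbs
      - (|(k ^ 2).re| / 4 + |(i : ℝ)| * |k.re| / 2)
      ≤ ((i : ℂ) * sharp k j + sharp k j ^ 2).re := by
  have hN : (j.natAbs : ℝ) = |(j : ℝ)| := by
    rw [Nat.cast_natAbs, Int.cast_abs]
  have h1 : -(|(i : ℝ)| * |(j : ℝ)|) ≤ i * j := by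
    rw [← abs_mul]
    exact neg_abs_le _
  have h2 := abs_le.mp (abs_mul (i : ℝ) k.re).le
  have h3 := neg_abs_le (k ^ 2).re
  have h4 : -(|k.re| * |(j : ℝ)|) ≤ k.re * |(j : ℝ)| := by
    have := neg_abs_le k.re
    nlinarith [abs_nonneg (j : ℝ)]
  rw [hN]
  have e : ∀ s : ℝ, s = 1 ∨ s = -1 → ((i : ℂ) * ((j + s * k) / 2) + ((j + s * k) / 2) ^ 2)
      = (((i : ℝ) * j / 2 + (j : ℝ) ^ 2 / 4 : ℝ) : ℂ) + ((s * i / 2 + s * j / 2 : ℝ) : ℂ) * k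
        + ((1 / 4 : ℝ) : ℂ) * k ^ 2 := by
    rintro s (rfl | rfl) <;> push_cast <;> ring
  rw [sharp]
  split_ifs with hj
  · have := e 1 (Or.inl rfl)
    rw [Complex.ofReal_one, one_mul] at this
    rw [this, Complex.add_re, Complex.add_re, Complex.re_ofReal_mul, Complex.re_ofReal_mul,
      Complex.ofReal_re]
    have hj' : |(j : ℝ)| = j := abs_of_nonneg (by exact_mod_cast hj.le)
    rw [hj'] at h1 h4 ⊢
    linarith [h2.1]
  · have := e (-1) (Or.inr rfl)
    rw [Complex.ofReal_neg, Complex.ofReal_one, neg_one_mul] at this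
    rw [this, Complex.add_re, Complex.add_re, Complex.re_ofReal_mul, Complex.re_ofReal_mul,
      Complex.ofReal_re]
    have hj' : |(j : ℝ)| = -j := abs_of_nonpos (by exact_mod_cast not_lt.mp hj)
    rw [hj'] at h1 h4 ⊢
    linarith [h2.2]

include hq hq1 hk

theorem hasSum_gaussBulletMoment (i : ℤ) :
    HasSum (fun j : ℤ => qSharp (uNum q) (vNum q k) j ^ i *
      (qpow q (sharp k j ^ 2) * muBullet (uNum q) (vNum q k) j)) (gaussBulletMoment q k i) := by
  obtain ⟨R, hR, hb⟩ := muBullet_bound hq hq1 hk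
  set A : ℝ := (|k.re| + |(i : ℝ)|) / 2 with hA
  set D : ℝ := |(k ^ 2).re| / 4 + |(i : ℝ)| * |k.re| / 2 with hD
  have hA1 : 1 ≤ q ^ (-A) :=
    Real.one_le_rpow_of_pos_of_le_one_of_nonpos hq hq1.le (neg_nonpos.mpr (by positivity))
  refine (summable_of_gauss_bound hq hq1 (C := q ^ (-D)) (R := q ^ (-A) * R)
    (one_le_mul_of_one_le_of_one_le hA1 hR) fun j => ?_).hasSum
  have e : q ^ ((j : ℝ) ^ 2 / 4 - A * j.natAbs - D)
      = q ^ (-D) * (q ^ ((j : ℝ) ^ 2 / 4) * (q ^ (-A)) ^ j.natAbs) := by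
    rw [← Real.rpow_natCast (q ^ (-A)), ← Real.rpow_mul hq.le, ← Real.rpow_add hq,
      ← Real.rpow_add hq]
    congr 1
    ring
  rw [← mul_assoc, norm_mul, qSharp_num hq, qpow_zpow, ← qpow_add hq, norm_qpow hq, mul_pow,
    ← mul_assoc (q ^ ((j : ℝ) ^ 2 / 4)), ← mul_assoc, ← e]
  exact mul_le_mul (Real.rpow_le_rpow_of_exponent_ge hq hq1.le (gaussian_exponent_bound k i j))
    (hb j) (norm_nonneg _) (Real.rpow_nonneg hq.le _)

theorem hasSum_gaussBulletTerm (f : ℂ[T;T⁻¹]) :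
    HasSum (gaussBulletTerm q k f) (functional (gaussBulletMoment q k) f) := by
  refine (hasSum_functional (hasSum_gaussBulletMoment hq hq1 hk) f).congr_fun fun j => ?_
  rw [gaussBulletTerm, evalAt, mul_assoc, Finsupp.sum_mul, qSharp_num hq]
  simp only [mul_assoc]

/-- The difference of the two sides is a sum over l of terms D(l) with D(-l) = -D(l): γ takes equal
values at l_♯ and (-l)_♯ = -l_♯ for l ≠ 0, `Generic.muBullet_neg` supplies the sign, and at l = 0
the factor vX - v⁻¹X⁻¹ vanishes. -/
theorem tSelfAdjoint_gaussBullet :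
    TSelfAdjoint (vNum q k) (functional (gaussBulletMoment q k)) := by
  have h := generic_num hq hq1 hk
  have hv := h.v_ne
  refine .of_monomials two_ne_zero fun j => ?_
  simp only [functional_T]
  set D : ℤ → ℂ := fun l => (vNum q k * qSharp (uNum q) (vNum q k) l
      - (vNum q k)⁻¹ * (qSharp (uNum q) (vNum q k) l)⁻¹)
    * (qSharp (uNum q) (vNum q k) l ^ j + qSharp (uNum q) (vNum q k) l ^ (-j))
    * (qpow q (sharp k l ^ 2) * muBullet (uNum q) (vNum q k) l) with hD
  have hs := (((hasSum_gaussBulletMoment hq hq1 hk (1 + j)).add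
    (hasSum_gaussBulletMoment hq hq1 hk (1 - j))).mul_left (vNum q k)).sub
    (((hasSum_gaussBulletMoment hq hq1 hk (-1 + j)).add
    (hasSum_gaussBulletMoment hq hq1 hk (-1 - j))).mul_left (vNum q k)⁻¹)
  replace hs := hs.congr_fun (g := D) fun l => by
    have hx := h.qSharp_ne l
    simp only [hD]
    rw [sub_eq_add_neg 1 j, sub_eq_add_neg (-1) j, zpow_add₀ hx, zpow_add₀ hx, zpow_add₀ hx,
      zpow_add₀ hx, zpow_one, zpow_neg_one]
    ring
  have hodd : ∀ l, D (-l) = -D l := by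
    intro l
    rcases eq_or_ne l 0 with rfl | hl
    · have : D 0 = 0 := by
        simp only [hD]
        rw [qSharp_at_zero, inv_inv, mul_inv_cancel₀ hv, inv_mul_cancel₀ hv, sub_self, zero_mul,
          zero_mul]
      rw [neg_zero, this, neg_zero]
    · have hμ := h.muBullet_neg hl
      have hγ : sharp k (-l) ^ 2 = sharp k l ^ 2 := by
        rw [sharp, sharp]
        push_cast
        split_ifs <;> first | omega | ring
      simp only [hD]
      rw [hγ, qSharp_neg_eq hl, inv_zpow, inv_zpow, zpow_neg, inv_inv, inv_inv]
      linear_combination (qpow q (sharp k l ^ 2) * (qSharp (uNum q) (vNum q k) l ^ j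
        + (qSharp (uNum q) (vNum q k) l ^ j)⁻¹)) * hμ
  have h2 := ((Equiv.neg ℤ).hasSum_iff.mpr hs).congr_fun (g := fun l => -D l)
    fun l => (hodd l).symm
  have h3 := h2.unique hs.neg
  exact sub_eq_zero.mp (self_eq_neg.mp h3)

/-- Reindexing by j ↦ 1 - j preserves μ_•, and γ(1/2 - z) = q^{1/4} q^{-z} γ(z). -/
theorem gaussBullet_piOp (f : ℂ[T;T⁻¹]) : functional (gaussBulletMoment q k) f
    = uNum q * functional (gaussBulletMoment q k) (T (-1) * piOp (uNum q) f) := by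
  have h := generic_num hq hq1 hk
  have key : functional (gaussBulletMoment q k)
      = uNum q • functional (gaussBulletMoment q k) ∘ₗ LinearMap.mulLeft ℂ (T (-1))
        ∘ₗ piOp (uNum q) := by
    refine laurent_ext fun i => ?_
    simp only [LinearMap.smul_apply, LinearMap.comp_apply, LinearMap.mulLeft_apply, piOp_T,
      T_mul_T', map_smul, functional_T, smul_eq_mul]
    have h1 := (Equiv.subLeft (1 : ℤ)).hasSum_iff.mpr (hasSum_gaussBulletMoment hq hq1 hk i)
    have h2 := (hasSum_gaussBulletMoment hq hq1 hk (-1 + -i)).mul_left ((uNum q ^ 2) ^ i)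
    refine h1.unique ((h2.mul_left (uNum q)).congr_fun fun l => ?_)
    have hx := h.qSharp_ne l
    have hγ : qpow q (sharp k (1 - l) ^ 2)
        = uNum q * (qSharp (uNum q) (vNum q k) l)⁻¹ * qpow q (sharp k l ^ 2) := by
      rw [qSharp_num hq, uNum, ← qpow_neg, ← qpow_add hq, ← qpow_add hq, sharp, sharp]
      congr 1
      push_cast
      split_ifs <;> first | omega | ring
    rw [Function.comp_apply, Equiv.subLeft_apply, muBullet_one_sub, hγ, h.qSharp_one_sub, mul_zpow,
      inv_zpow, zpow_add₀ hx, zpow_neg_one, zpow_neg]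
    ring
  exact congrArg (fun L : ℂ[T;T⁻¹] →ₗ[ℂ] ℂ => L f) key

theorem gaussCirc_epsNum (m n : ℤ) : gaussCirc q k (epsNum q k m * epsNum q k n)
    = gaussWeight q k m * gaussWeight q k n * evalAt (qpow q (sharp k m)) (epsNum q k n)
      * gaussCirc q k 1 := by
  rw [gaussCirc, gaussCirc, (hasSum_gaussCircTerm hq hq1 hk _).tsum_eq,
    (hasSum_gaussCircTerm hq hq1 hk _).tsum_eq, ← qSharp_num hq]
  exact (generic_num hq hq1 hk).gauss_circ_formula (isGaussWeight_num hq k)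
    (tSelfAdjoint_gaussCirc hq hq1 hk) (gaussCirc_piOp hq hq1 hk) m n

theorem gaussBullet_epsNum (m n : ℤ) : gaussBullet q k (epsNum q k m * epsStarNum q k n)
    = (gaussWeight q k m * gaussWeight q k n)⁻¹ * evalAt (qpow q (sharp k m)) (epsNum q k n)
      * gaussBullet q k 1 := by
  rw [gaussBullet, gaussBullet, (hasSum_gaussBulletTerm hq hq1 hk _).tsum_eq,
    (hasSum_gaussBulletTerm hq hq1 hk _).tsum_eq, ← qSharp_num hq, epsStarNum, invert_eq_sOp]
  exact (generic_num hq hq1 hk).gauss_bullet_formula (isGaussWeight_num hq k)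
    (tSelfAdjoint_gaussBullet hq hq1 hk) (gaussBullet_piOp hq hq1 hk) m n

omit hq1 hk in
theorem gaussWeight_mul (k : ℂ) (m n : ℤ) : gaussWeight q k m * gaussWeight q k n
    = qpow q ((m ^ 2 + n ^ 2 + 2 * k * ((|m| + |n| : ℤ) : ℂ)) / 4) := by
  rw [gaussWeight, gaussWeight, ← qpow_add hq]
  congr 1
  push_cast
  ring

end GaussFunctionals

end RankOneDAHA

end

theorem theorem3p1 :
    -- i), over the field of constants `ℚ(q^{1/4}, t^{1/2})`; the objects are well defined
    (SphericalDefined u₀ v₀ ∧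
      (∀ j : ℤ, IsMuCircCoeff (u₀ ^ 4) (v₀ ^ 2) j (muCirc (u₀ ^ 4) (v₀ ^ 2) j)) ∧
      (∀ f : Kqt[T;T⁻¹], (FCirc f).support.Finite) ∧
      -- `F_∘` induces `σ`
      (∀ (H : HH) (f : Kqt[T;T⁻¹]), FCirc (polyRep H f) = funRep (sigma H) (FCirc f)) ∧
      -- `F_∘` is unitary
      (∀ f g : Kqt[T;T⁻¹], formCirc f g = formBullet (FCirc f) (FCirc g)) ∧
      -- `F_•` induces `σ^{-1}`
      (∀ (H : HH) (f : Fun), f.support.Finite →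
        FBullet (funRep H f) = funRep (sigma.symm H) (FBullet f))) ∧
    -- ii), for `0 < q < 1` and all `k` for which the spherical polynomials are defined
    (∀ (q : ℝ) (k : ℂ), 0 < q → q < 1 → (∀ j : ℕ, 1 ≤ j → qpow q (2 * k + j) ≠ 1) →
      SphericalDefined (uNum q) (vNum q k) ∧
      SphericalDefined (uNum q)⁻¹ (vNum q k)⁻¹ ∧
      (∀ j : ℤ, IsMuCircCoeff (uNum q ^ 4) (vNum q k ^ 2) j
        (muCirc (uNum q ^ 4) (vNum q k ^ 2) j)) ∧
      ∀ m n : ℤ,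
        Summable (gaussCircTerm q k (epsNum q k m * epsNum q k n)) ∧
        gaussCirc q k (epsNum q k m * epsNum q k n)
          = qpow q ((m ^ 2 + n ^ 2 + 2 * k * ((|m| + |n| : ℤ) : ℂ)) / 4)
            * evalAt (qpow q (sharp k m)) (epsNum q k n) * gaussCirc q k 1 ∧
        Summable (gaussBulletTerm q k (epsNum q k m * epsStarNum q k n)) ∧
        gaussBullet q k (epsNum q k m * epsStarNum q k n)
          = qpow q (-((m ^ 2 + n ^ 2 + 2 * k * ((|m| + |n| : ℤ) : ℂ)) / 4))
            * evalAt (qpow q (sharp k m)) (epsNum q k n) * gaussBullet q k 1) := by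
  refine ⟨⟨generic_u₀_v₀.sphericalDefined,
    isMuCircCoeff_muCirc generic_u₀_v₀.mu_regular, FCirc_finite, FCirc_polyRep,
    formCirc_eq_formBullet, fun H _ hf => FBullet_funRep H hf⟩, fun q k hq hq1 hk => ?_⟩
  have h := generic_num hq hq1 hk
  refine ⟨h.sphericalDefined, h.inv.sphericalDefined, isMuCircCoeff_muCirc h.mu_regular,
    fun m n => ⟨(hasSum_gaussCircTerm hq hq1 hk _).summable, ?_,
      (hasSum_gaussBulletTerm hq hq1 hk _).summable, ?_⟩⟩
  · rw [← gaussWeight_mul hq, gaussCirc_epsNum hq hq1 hk]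
  · rw [qpow_neg, ← gaussWeight_mul hq, gaussBullet_epsNum hq hq1 hk]
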